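/- Let $\mathfrak{k}$ be a commutative ring of characteristic zero and $n\ge 0$. Let $\bar U(\mathbf h)$ be the localization of $\mathfrak{k}[\tilde h_1,\dots,\tilde h_n]$ at the multiplicative set generated by $\tilde h_{ij}+m$ ($i\ne j$, $m\in\mathbb Z$), $\tilde h_{ij}:=\tilde h_i-\tilde h_j$; let $\varepsilon_j$ be its automorphism $\tilde h_i\mapsto\tilde h_i+\delta_i^j$ and write $p[\varepsilon_j]:=\varepsilon_j(p)$. Let $\hat R=(\hat R^{ij}_{kl})$ be the matrix over $\bar U(\mathbf h)$ with nonzero entries $\hat R^{ij}_{ij}=\tilde h_{ij}^{-1}$ for $i\neq j$, $\hat R^{ij}_{ji}=(\tilde h_{ij}^2-1)/\tilde h_{ij}^2$ for $i<j$, and $\hat R^{ij}_{ji}=1$ for $i\ge j$. For $N\ge 0$ let $\mathrm{Diff}_{\mathbf h}(n,N)$ be the $\mathfrak{k}$-algebra generated by $\bar U(\mathbf h)$ and elements $Z^{j,\alpha},\partial_{j,\alpha}$ ($1\le j\le n$, $1\le\alpha\le N$) with the defining relations $\tilde h_iZ^{j,\alpha}=Z^{j,\alpha}(\tilde h_i+\delta_i^j)$,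 $\tilde h_i\partial_{j,\alpha}=\partial_{j,\alpha}(\tilde h_i-\delta_i^j)$, $$Z^{i,\alpha}Z^{j,\beta}=\sum_{k,l}\hat R^{ij}_{kl}Z^{k,\beta}Z^{l,\alpha},\quad \partial_{i,\alpha}\partial_{j,\beta}=\sum_{k,l}\hat R^{lk}_{ji}\partial_{k,\beta}\partial_{l,\alpha},\quad Z^{i,\alpha}\partial_{j,\beta}=\sum_{k,l}\hat R^{ki}_{lj}[\varepsilon_k]\,\partial_{k,\beta}Z^{l,\alpha}-\delta^\alpha_\beta\delta^i_j .$$ Let the diagonal reduction algebra $\mathcal D(\mathfrak{gl}_n)$ be the $\mathfrak{k}$-algebra generated by $\bar U(\mathbf h)$ and elements $L_i^j$ ($1\le i,j\le n$) with the defining relations $\tilde h_mL_i^j=L_i^j(\tilde h_m+\delta_m^j-\delta_m^i)$ and the reflection equation $$\hat R_{12}L_1\hat R_{12}L_1-L_1\hat R_{12}L_1\hat R_{12}=\hat R_{12}L_1-L_1\hat R_{12},$$ where upper indices label rows and lower indices label columns, so that $(\hat R_{12})^{ij}_{kl}=\hat R^{ij}_{kl}$ and $(L_1)^{ij}_{kl}=L_k^i\,\delta^j_l$.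 Then the following hold. 1. For every $N$ there is a unique action of $S_n$ by $\mathfrak{k}$-algebra automorphisms on $\mathrm{Diff}_{\mathbf h}(n,N)$ in which each transposition $s_i=(i,i+1)$ acts by $$s_i(Z^{i,\alpha})=-Z^{i+1,\alpha}\tilde h_{i,i+1},\quad s_i(Z^{i+1,\alpha})=Z^{i,\alpha}\tilde h_{i,i+1}^{-1},\quad s_i(\partial_{i,\alpha})=-\tilde h_{i,i+1}^{-1}\partial_{i+1,\alpha},\quad s_i(\partial_{i+1,\alpha})=\tilde h_{i,i+1}\partial_{i,\alpha},$$ $s_i(Z^{j,\alpha})=Z^{j,\alpha}$ and $s_i(\partial_{j,\alpha})=\partial_{j,\alpha}$ for $j\ne i,i+1$, and $s_i(\tilde h_j)=\tilde h_{s_i(j)}$ for all $j$. 2. For every $N$ there is a unique $\mathfrak{k}$-algebra homomorphism $\tau_N:\mathcal D(\mathfrak{gl}_n)\to\mathrm{Diff}_{\mathbf h}(n,N)$ that is compatible with the maps from $\bar U(\mathbf h)$ and satisfies $\tau_N(L_i^j)=\sum_\alpha Z^{j,\alpha}\partial_{i,\alpha}$. 3. For every $N$ and every $\pi\in S_n$,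 the automorphism $\pi$ of $\mathrm{Diff}_{\mathbf h}(n,N)$ maps the image of $\tau_N$ onto itself. 4. $\tau_N$ is injective for $N\ge n$. 5. There is a unique action of $S_n$ by $\mathfrak{k}$-algebra automorphisms on $\mathcal D(\mathfrak{gl}_n)$ such that $\tau_N(\pi(x))=\pi(\tau_N(x))$ for all $N$, all $\pi\in S_n$ and all $x\in\mathcal D(\mathfrak{gl}_n)$. -/

import Mathlib

namespace HDiff

noncomputable section

/-- The multiplicative set of `U(h) = k[h̃₁, …, h̃ₙ]` generated by the elements
`h̃ᵢ - h̃ⱼ + m` with `i ≠ j` and `m ∈ ℤ`. -/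
def denominators (k : Type*) [CommRing k] (n : ℕ) : Submonoid (MvPolynomial (Fin n) k) :=
  Submonoid.closure
    {p | ∃ (i j : Fin n) (m : ℤ), i ≠ j ∧
      p = MvPolynomial.X i - MvPolynomial.X j + (m : MvPolynomial (Fin n) k)}

/-- The ring of fractions `Ū(h)` of `U(h)` with denominators `h̃ᵢ - h̃ⱼ + m`. -/
abbrev Ubar (k : Type*) [CommRing k] (n : ℕ) : Type _ := Localization (denominators k n)

/-- The generator `h̃ᵢ` of `Ū(h)`. -/
def hh (k : Type*) [CommRing k] (n : ℕ) (i : Fin n) : Ubar k n :=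
  algebraMap (MvPolynomial (Fin n) k) (Ubar k n) (MvPolynomial.X i)

/-- The difference `h̃ᵢⱼ = h̃ᵢ - h̃ⱼ`. -/
def hd (k : Type*) [CommRing k] (n : ℕ) (i j : Fin n) : Ubar k n :=
  hh k n i - hh k n j

theorem isUnit_hd_add (k : Type*) [CommRing k] (n : ℕ) {i j : Fin n} (hij : i ≠ j) (m : ℤ) :
    IsUnit (hd k n i j + (m : Ubar k n)) := by
  have h := IsLocalization.map_units (Ubar k n)
    (⟨_, Submonoid.subset_closure ⟨i, j, m, hij, rfl⟩⟩ : denominators k n)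
  simpa [hd, hh] using h

/-- The inverse of `h̃ᵢⱼ`, for `i ≠ j`. -/
def hdInv (k : Type*) [CommRing k] (n : ℕ) (i j : Fin n) : Ubar k n :=
  Ring.inverse (hd k n i j)

theorem hd_mul_hdInv (k : Type*) [CommRing k] (n : ℕ) {i j : Fin n} (hij : i ≠ j) :
    hd k n i j * hdInv k n i j = 1 :=
  Ring.mul_inverse_cancel _ (by simpa using isUnit_hd_add k n hij 0)

/-- The elementary translation on polynomials, `h̃ᵢ ↦ h̃ᵢ + δᵢⱼ`, with values in `Ū(h)`. -/
def preShift (k : Type*) [CommRing k] (n : ℕ) (j : Fin n) :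
    MvPolynomial (Fin n) k →ₐ[k] Ubar k n :=
  MvPolynomial.aeval fun i => hh k n i + if i = j then 1 else 0

theorem isUnit_preShift (k : Type*) [CommRing k] (n : ℕ) (j : Fin n)
    (y : denominators k n) : IsUnit (preShift k n j y) := by
  have h : denominators k n ≤ (IsUnit.submonoid (Ubar k n)).comap (preShift k n j) := by
    refine Submonoid.closure_le.mpr ?_
    rintro p ⟨a, b, m, hab, rfl⟩
    change IsUnit (preShift k n j _)
    have e : preShift k n j (MvPolynomial.X a - MvPolynomial.X b + (m : MvPolynomial (Fin n) k))
        = hd k n a b + (((if a = j then 1 else 0) - (if b = j then 1 else 0) + m : ℤ) :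
          Ubar k n) := by
      simp only [preShift, hd, map_add, map_sub, map_intCast, MvPolynomial.aeval_X]
      push_cast
      ring
    rw [e]
    exact isUnit_hd_add k n hab _
  exact h y.2

/-- The elementary translation `εⱼ` of `Ū(h)`, `εⱼ(h̃ᵢ) = h̃ᵢ + δᵢⱼ`; `shift j p` is `p[εⱼ]`. -/
def shift (k : Type*) [CommRing k] (n : ℕ) (j : Fin n) : Ubar k n →ₐ[k] Ubar k n :=
  IsLocalization.liftAlgHom (M := denominators k n) (f := preShift k n j) (isUnit_preShift k n j)

theorem shift_hh (k : Type*) [CommRing k] (n : ℕ) (i j : Fin n) :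
    shift k n j (hh k n i) = hh k n i + if i = j then 1 else 0 := by
  simp [shift, hh, preShift]

/-- The entry `R̂^{ij}_{kl}` (here `Rhat i j a b` has upper indices `i j`, lower indices `a b`)
of the standard solution of the dynamical Yang-Baxter equation of type A. -/
def Rhat (k : Type*) [CommRing k] (n : ℕ) (i j a b : Fin n) : Ubar k n :=
  if i ≠ j ∧ a = i ∧ b = j then hdInv k n i j
  else if a = j ∧ b = i then
    if i < j then (hd k n i j ^ 2 - 1) * hdInv k n i j ^ 2 else 1
  else 0

/-- Generators of `Diff_h(n,N)`: the elements of `Ū(h)`, the `Z^{i,α}` and the `∂_{i,α}`. -/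
inductive DiffGen (k : Type*) [CommRing k] (n N : ℕ) : Type _
  | coef (p : Ubar k n) : DiffGen k n N
  | Z (i : Fin n) (α : Fin N) : DiffGen k n N
  | d (i : Fin n) (α : Fin N) : DiffGen k n N

/-- The free algebra on the generators of `Diff_h(n,N)`. -/
abbrev DiffFree (k : Type*) [CommRing k] (n N : ℕ) : Type _ := FreeAlgebra k (DiffGen k n N)

def fCoef (k : Type*) [CommRing k] (n N : ℕ) (p : Ubar k n) : DiffFree k n N :=
  FreeAlgebra.ι k (DiffGen.coef p)

def fZ (k : Type*) [CommRing k] (n N : ℕ) (i : Fin n) (α : Fin N) : DiffFree k n N :=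
  FreeAlgebra.ι k (DiffGen.Z i α)

def fd (k : Type*) [CommRing k] (n N : ℕ) (i : Fin n) (α : Fin N) : DiffFree k n N :=
  FreeAlgebra.ι k (DiffGen.d i α)

/-- The relations of `Diff_h(n,N)`: the first three make `Ū(h)` map to it as a `k`-algebra, the
next two relate the left and the right `Ū(h)`-module structures, the last three are the defining
relations among the `Z^{i,α}` and `∂_{i,α}`. -/
inductive DiffRel (k : Type*) [CommRing k] (n N : ℕ) : DiffFree k n N → DiffFree k n N → Prop
  | coef_add (p q : Ubar k n) :
      DiffRel k n N (fCoef k n N (p + q)) (fCoef k n N p + fCoef k n N q)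
  | coef_mul (p q : Ubar k n) :
      DiffRel k n N (fCoef k n N (p * q)) (fCoef k n N p * fCoef k n N q)
  | coef_scalar (c : k) :
      DiffRel k n N (fCoef k n N (algebraMap k (Ubar k n) c)) (algebraMap k (DiffFree k n N) c)
  | weight_Z (i j : Fin n) (α : Fin N) :
      DiffRel k n N (fCoef k n N (hh k n i) * fZ k n N j α)
        (fZ k n N j α * (fCoef k n N (hh k n i) + if i = j then 1 else 0))
  | weight_d (i j : Fin n) (α : Fin N) :
      DiffRel k n N (fCoef k n N (hh k n i) * fd k n N j α)
        (fd k n N j α * (fCoef k n N (hh k n i) - if i = j then 1 else 0))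
  | Z_Z (i j : Fin n) (α β : Fin N) :
      DiffRel k n N (fZ k n N i α * fZ k n N j β)
        (∑ a, ∑ b, fCoef k n N (Rhat k n i j a b) * fZ k n N a β * fZ k n N b α)
  | d_d (i j : Fin n) (α β : Fin N) :
      DiffRel k n N (fd k n N i α * fd k n N j β)
        (∑ a, ∑ b, fCoef k n N (Rhat k n b a j i) * fd k n N a β * fd k n N b α)
  | Z_d (i j : Fin n) (α β : Fin N) :
      DiffRel k n N (fZ k n N i α * fd k n N j β)
        ((∑ a, ∑ b, fCoef k n N (shift k n a (Rhat k n a i b j)) * fd k n N a β * fZ k n N b α)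
          - if α = β ∧ i = j then 1 else 0)

/-- The ring `Diff_h(n,N)` of `h`-deformed differential operators of type A. -/
abbrev Diff (k : Type*) [CommRing k] (n N : ℕ) : Type _ := RingQuot (DiffRel k n N)

/-- The image of an element of `Ū(h)` in `Diff_h(n,N)`. -/
def dCoef (k : Type*) [CommRing k] (n N : ℕ) (p : Ubar k n) : Diff k n N :=
  RingQuot.mkAlgHom k (DiffRel k n N) (fCoef k n N p)

/-- The generator `Z^{i,α}` of `Diff_h(n,N)`. -/
def dZ (k : Type*) [CommRing k] (n N : ℕ) (i : Fin n) (α : Fin N) : Diff k n N :=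
  RingQuot.mkAlgHom k (DiffRel k n N) (fZ k n N i α)

/-- The generator `∂_{i,α}` of `Diff_h(n,N)`. -/
def dd (k : Type*) [CommRing k] (n N : ℕ) (i : Fin n) (α : Fin N) : Diff k n N :=
  RingQuot.mkAlgHom k (DiffRel k n N) (fd k n N i α)

/-- Generators of `D(gl_n)`: the elements of `Ū(h)` and the `L_i^j`. -/
inductive RedGen (k : Type*) [CommRing k] (n : ℕ) : Type _
  | coef (p : Ubar k n) : RedGen k n
  | L (i j : Fin n) : RedGen k n

/-- The free algebra on the generators of `D(gl_n)`. -/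
abbrev RedFree (k : Type*) [CommRing k] (n : ℕ) : Type _ := FreeAlgebra k (RedGen k n)

def gCoef (k : Type*) [CommRing k] (n : ℕ) (p : Ubar k n) : RedFree k n :=
  FreeAlgebra.ι k (RedGen.coef p)

/-- `gL i j` is `L_i^j`, with lower index `i` and upper index `j`. -/
def gL (k : Type*) [CommRing k] (n : ℕ) (i j : Fin n) : RedFree k n :=
  FreeAlgebra.ι k (RedGen.L i j)

/-- The matrix `R̂₁₂`; rows carry the upper indices, columns the lower ones. -/
def R12 (k : Type*) [CommRing k] (n : ℕ) :
    Matrix (Fin n × Fin n) (Fin n × Fin n) (RedFree k n) :=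
  fun r c => gCoef k n (Rhat k n r.1 r.2 c.1 c.2)

/-- The matrix `L₁ = L ⊗ 1`; rows carry the upper indices, columns the lower ones. -/
def L1 (k : Type*) [CommRing k] (n : ℕ) :
    Matrix (Fin n × Fin n) (Fin n × Fin n) (RedFree k n) :=
  fun r c => if r.2 = c.2 then gL k n c.1 r.1 else 0

/-- The relations of `D(gl_n)`: the first three make `Ū(h)` map to it as a `k`-algebra, the next
one relates the left and the right `Ū(h)`-module structures (`L_i^j` has weight `εⱼ - εᵢ`), the
last one is the reflection equation, entry by entry. -/
inductive RedRel (k : Type*) [CommRing k] (n : ℕ) : RedFree k n → RedFree k n → Prop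
  | coef_add (p q : Ubar k n) :
      RedRel k n (gCoef k n (p + q)) (gCoef k n p + gCoef k n q)
  | coef_mul (p q : Ubar k n) :
      RedRel k n (gCoef k n (p * q)) (gCoef k n p * gCoef k n q)
  | coef_scalar (c : k) :
      RedRel k n (gCoef k n (algebraMap k (Ubar k n) c)) (algebraMap k (RedFree k n) c)
  | weight_L (m i j : Fin n) :
      RedRel k n (gCoef k n (hh k n m) * gL k n i j)
        (gL k n i j *
          (gCoef k n (hh k n m) + (if m = j then 1 else 0) - (if m = i then 1 else 0)))
  | reflection (r c : Fin n × Fin n) :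
      RedRel k n
        ((R12 k n * L1 k n * R12 k n * L1 k n - L1 k n * R12 k n * L1 k n * R12 k n) r c)
        ((R12 k n * L1 k n - L1 k n * R12 k n) r c)

/-- The diagonal reduction algebra `D(gl_n)`. -/
abbrev Red (k : Type*) [CommRing k] (n : ℕ) : Type _ := RingQuot (RedRel k n)

/-- The image of an element of `Ū(h)` in `D(gl_n)`. -/
def rCoef (k : Type*) [CommRing k] (n : ℕ) (p : Ubar k n) : Red k n :=
  RingQuot.mkAlgHom k (RedRel k n) (gCoef k n p)

/-- The generator `L_i^j` of `D(gl_n)`. -/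
def rL (k : Type*) [CommRing k] (n : ℕ) (i j : Fin n) : Red k n :=
  RingQuot.mkAlgHom k (RedRel k n) (gL k n i j)

/-- `a = i` and `b = i + 1`, so that `Equiv.swap a b` is the simple transposition `sᵢ`; the
automorphism `s` acts on the generators of `Diff_h(n,N)` by the formulas for `sᵢ`. -/
structure IsSimpleAut (k : Type*) [CommRing k] (n N : ℕ) (a b : Fin n)
    (s : Diff k n N ≃ₐ[k] Diff k n N) : Prop where
  Z_left : ∀ α, s (dZ k n N a α) = -(dZ k n N b α * dCoef k n N (hd k n a b))
  Z_right : ∀ α, s (dZ k n N b α) = dZ k n N a α * dCoef k n N (hdInv k n a b)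
  Z_other : ∀ j α, j ≠ a → j ≠ b → s (dZ k n N j α) = dZ k n N j α
  d_left : ∀ α, s (dd k n N a α) = -(dCoef k n N (hdInv k n a b) * dd k n N b α)
  d_right : ∀ α, s (dd k n N b α) = dCoef k n N (hd k n a b) * dd k n N a α
  d_other : ∀ j α, j ≠ a → j ≠ b → s (dd k n N j α) = dd k n N j α
  h_perm : ∀ j, s (dCoef k n N (hh k n j)) = dCoef k n N (hh k n (Equiv.swap a b j))

/-- `A` is the action of the symmetric group `S_n` on `Diff_h(n,N)`: every simple transposition
`sᵢ = (i, i+1)` acts by the formulas of `IsSimpleAut`. -/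
def IsDiffAction (k : Type*) [CommRing k] (n N : ℕ)
    (A : Equiv.Perm (Fin n) →* (Diff k n N ≃ₐ[k] Diff k n N)) : Prop :=
  ∀ a b : Fin n, (b : ℕ) = (a : ℕ) + 1 → IsSimpleAut k n N a b (A (Equiv.swap a b))

/-- `τ` is the homomorphism `τ_N` of `Ū(h)`-bimodules and `k`-algebras from `D(gl_n)` to
`Diff_h(n,N)` with `τ_N(L_i^j) = ∑_α Z^{j,α} ∂_{i,α}`. -/
structure IsTau (k : Type*) [CommRing k] (n N : ℕ) (τ : Red k n →ₐ[k] Diff k n N) : Prop where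
  coef : ∀ p : Ubar k n, τ (rCoef k n p) = dCoef k n N p
  L : ∀ i j : Fin n, τ (rL k n i j) = ∑ α, dZ k n N j α * dd k n N i α

end

end HDiff

/-! Normalization makes the symmetry visible. Put φ_j = ∏_{a<j} h̃_{ja} (`vph j`) and replace
Z^{j,α} by Z^{j,α}φ_j and ∂_{j,α} by φ_j⁻¹∂_{j,α}. The entries of R̂ distinguish i < j from i > j,
but the relations between the normalized generators involve only differences h̃_{ij} and have the
same form for all i ≠ j (`isDiffSys_iff_isNormSys`). Every permutation of the indices is therefore
an automorphism, the group law is evident, and for a simple transposition the factors φ produce the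
prescribed formulas.

The homomorphism τ_N expresses associativity. With L = Z∂ and Y = R̂₁₂L₁R̂₁₂ - R̂₁₂ the relations of
Diff give ZL = YZ and L∂ = ∂Y. The reflection equation says that L₁Y = YL₁, and this is (ZL)∂ =
Z(L∂). A permutation permutes the normalized sums, which differ from the L_i^j by units of Ū(h), so
it preserves the image.

The hard part is injectivity. A representation of Diff is built on functions from a lattice to
D(gl_n) in which τ_N(x) acts as left multiplication by x; applied to the constant function 1 it
recovers x. The relation ZL = YZ suggests an exchange homomorphism ρ from D(gl_n) to n × n matrices
over it, with ρ(L) = Y. It exists by a Jucys-Murphy computation from the dynamical Yang-Baxter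
equation (`jucysMurphy_commute`), which also shows that ρ applied twice commutes with R̂
(`rho_rho`). The entries of ρ, seen as operators on D(gl_n), form a matrix T. Its inverse comes from
a second homomorphism `rhoDual`, obtained by bending one strand around; this needs the rotated R̂ to
be invertible, which reduces to a Cauchy determinant (`isUnit_det_cauchy`).

The column index of T is still dynamical: it carries a weight for right multiplication, and products
of entries of T satisfy an R̂-relation with right coefficients. A gauge matrix with rows φ_a⁻¹(1,
h̃_a, h̃_a², …)C turns it into a plain index α. Here C is an invertible matrix of shift and Euler
operators, obtained by induction on its size from factors of degree at most one of Yangian type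
(`exists_row`). The product Z of T and the gauge matrix is invertible, ∂ = Z⁻¹L supplies
derivatives, and ∑ Z∂ = L by construction (`IsFrame`, `IsTwist.exists_frame`). For N = n + r, the
columns are extended by r further ones with the help of Heisenberg pairs, without changing ∑ Z∂
(`IsExtension`).

Injectivity of τ_n finally transports the action to D(gl_n): the proposed images of the generators
satisfy the relations because they do so in Diff. Compatibility for other N is checked on
generators, and uniqueness is again injectivity of τ_n. -/

namespace HDiff

noncomputable section

/-! ### The coefficient ring Ū(h), its translations and permutations, and the entries of R̂ -/

open Matrix

variable (k : Type*) [CommRing k] {n : ℕ}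

/-- The homomorphism from `Ū(h)` to a commutative algebra given by the images of the `h̃ᵢ`. -/
def ubarLift {B : Type*} [CommRing B] [Algebra k B] (v : Fin n → B)
    (hv : ∀ (i j : Fin n) (m : ℤ), i ≠ j → IsUnit (v i - v j + (m : B))) : Ubar k n →ₐ[k] B :=
  IsLocalization.liftAlgHom (M := denominators k n) (f := MvPolynomial.aeval v) (by
    have h : denominators k n ≤ (IsUnit.submonoid B).comap (MvPolynomial.aeval (R := k) v) := by
      refine Submonoid.closure_le.mpr ?_
      rintro p ⟨a, b, m, hab, rfl⟩
      change IsUnit (MvPolynomial.aeval (R := k) v _)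
      simpa using hv a b m hab
    exact fun y => h y.2)

@[simp] theorem ubarLift_hh {B : Type*} [CommRing B] [Algebra k B] (v : Fin n → B)
    (hv : ∀ (i j : Fin n) (m : ℤ), i ≠ j → IsUnit (v i - v j + (m : B))) (i : Fin n) :
    ubarLift k v hv (hh k n i) = v i := by
  exact (IsLocalization.lift_eq _ _).trans (MvPolynomial.aeval_X v i)

variable {k}

/-- Intertwining relations on the generators `h̃ᵢ` extend to all of `Ū(h)`. -/
theorem ubar_intertwine {S : Type*} [Ring S] [Algebra k S] (c₁ c₂ : Ubar k n →ₐ[k] S) (z : S)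
    (h : ∀ i, c₁ (hh k n i) * z = z * c₂ (hh k n i)) (p : Ubar k n) : c₁ p * z = z * c₂ p := by
  have key : ∀ q : MvPolynomial (Fin n) k,
      c₁ (algebraMap _ (Ubar k n) q) * z = z * c₂ (algebraMap _ (Ubar k n) q) := by
    intro q
    induction q using MvPolynomial.induction_on with
    | C a =>
      have e : algebraMap (MvPolynomial (Fin n) k) (Ubar k n) (MvPolynomial.C a)
          = algebraMap k (Ubar k n) a := by
        rw [IsScalarTower.algebraMap_apply k (MvPolynomial (Fin n) k) (Ubar k n)]; rfl
      rw [e, AlgHom.commutes, AlgHom.commutes, Algebra.commutes]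
    | add p q hp hq => simp only [map_add, add_mul, mul_add, hp, hq]
    | mul_X p i hp =>
      have := h i
      simp only [hh] at this
      rw [map_mul, map_mul, map_mul, mul_assoc, this, ← mul_assoc, hp, mul_assoc]
  obtain ⟨⟨a, b⟩, hab⟩ := IsLocalization.surj (denominators k n) p
  have hu : IsUnit (algebraMap (MvPolynomial (Fin n) k) (Ubar k n) b) :=
    IsLocalization.map_units _ b
  obtain ⟨w, hw⟩ := hu.map c₁
  -- Multiplication by the invertible element c₁(b), with b a denominator of `p`, reduces the claim
  -- to the polynomial case `key`.
  have h1 : c₁ (algebraMap _ (Ubar k n) (b : MvPolynomial (Fin n) k)) * (c₁ p * z)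
      = c₁ (algebraMap _ (Ubar k n) (b : MvPolynomial (Fin n) k)) * (z * c₂ p) := by
    rw [← mul_assoc, ← map_mul, mul_comm _ p, hab, key, ← hab, mul_comm p, map_mul, ← mul_assoc,
      ← key, mul_assoc]
  rw [← hw] at h1
  exact w.isUnit.mul_left_cancel h1

theorem ubar_algHom_ext {S : Type*} [Ring S] [Algebra k S] {c₁ c₂ : Ubar k n →ₐ[k] S}
    (h : ∀ i, c₁ (hh k n i) = c₂ (hh k n i)) : c₁ = c₂ := by
  refine AlgHom.ext fun p => ?_
  simpa using ubar_intertwine c₁ c₂ 1 (by simpa using h) p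

variable (k)

/-- The translation `h̃ᵢ ↦ h̃ᵢ + wᵢ` of `Ū(h)`. -/
def trans (w : Fin n → ℤ) : Ubar k n →ₐ[k] Ubar k n :=
  ubarLift k (fun i => hh k n i + (w i : Ubar k n)) (by
    intro i j m hij
    have e : hh k n i + (w i : Ubar k n) - (hh k n j + (w j : Ubar k n)) + (m : Ubar k n)
        = hd k n i j + ((w i - w j + m : ℤ) : Ubar k n) := by
      simp only [hd]; push_cast; ring
    rw [e]
    exact isUnit_hd_add k n hij _)

@[simp] theorem trans_hh (w : Fin n → ℤ) (i : Fin n) :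
    trans k w (hh k n i) = hh k n i + (w i : Ubar k n) :=
  ubarLift_hh k _ _ i

@[simp] theorem trans_trans (v w : Fin n → ℤ) (p : Ubar k n) :
    trans k v (trans k w p) = trans k (v + w) p := by
  have : (trans k v).comp (trans k w) = trans k (v + w) :=
    ubar_algHom_ext fun i => by simp [add_assoc]
  exact DFunLike.congr_fun this p

@[simp] theorem trans_zero (p : Ubar k n) : trans k 0 p = p := by
  have : trans k (0 : Fin n → ℤ) = AlgHom.id k (Ubar k n) :=
    ubar_algHom_ext fun i => by simp
  exact DFunLike.congr_fun this p

/-- The unit weight `εᵢ`. -/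
abbrev ew (i : Fin n) : Fin n → ℤ := Pi.single i 1

theorem shift_eq_trans (j : Fin n) : shift k n j = trans k (ew j) := by
  refine ubar_algHom_ext fun i => ?_
  rw [shift_hh, trans_hh]
  by_cases h : i = j
  · subst h; simp
  · simp [h]

/-- The permutation `h̃ᵢ ↦ h̃_{g(i)}` of `Ū(h)`. -/
def perm (g : Equiv.Perm (Fin n)) : Ubar k n →ₐ[k] Ubar k n :=
  ubarLift k (fun i => hh k n (g i)) (fun _ _ m hij =>
    isUnit_hd_add k n (fun h => hij (g.injective h)) m)

@[simp] theorem perm_hh (g : Equiv.Perm (Fin n)) (i : Fin n) :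
    perm k g (hh k n i) = hh k n (g i) :=
  ubarLift_hh k _ _ i

@[simp] theorem perm_perm (g g' : Equiv.Perm (Fin n)) (p : Ubar k n) :
    perm k g (perm k g' p) = perm k (g * g') p := by
  have : (perm k g).comp (perm k g') = perm k (g * g') := ubar_algHom_ext fun i => by simp
  exact DFunLike.congr_fun this p

@[simp] theorem perm_one (p : Ubar k n) : perm k (1 : Equiv.Perm (Fin n)) p = p := by
  have : perm k (1 : Equiv.Perm (Fin n)) = AlgHom.id k (Ubar k n) :=
    ubar_algHom_ext fun i => by simp
  exact DFunLike.congr_fun this p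

theorem perm_trans (g : Equiv.Perm (Fin n)) (w : Fin n → ℤ) (p : Ubar k n) :
    perm k g (trans k w p) = trans k (fun i => w (g.symm i)) (perm k g p) := by
  have : (perm k g).comp (trans k w) = (trans k (fun i => w (g.symm i))).comp (perm k g) :=
    ubar_algHom_ext fun i => by simp
  exact DFunLike.congr_fun this p

/-- The inverse of `h̃ᵢⱼ + m`, for `i ≠ j`. -/
def hinv (i j : Fin n) (m : ℤ) : Ubar k n := Ring.inverse (hd k n i j + (m : Ubar k n))

theorem mul_hinv {i j : Fin n} (hij : i ≠ j) (m : ℤ) :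
    (hd k n i j + (m : Ubar k n)) * hinv k i j m = 1 :=
  Ring.mul_inverse_cancel _ (isUnit_hd_add k n hij m)

theorem hdInv_eq (i j : Fin n) : hdInv k n i j = hinv k i j 0 := by simp [hdInv, hinv]

theorem hinv_unique {i j : Fin n} (hij : i ≠ j) (m : ℤ) {x : Ubar k n}
    (hx : (hd k n i j + (m : Ubar k n)) * x = 1) : hinv k i j m = x :=
  (isUnit_hd_add k n hij m).mul_left_cancel ((mul_hinv k hij m).trans hx.symm)

theorem trans_hd (w : Fin n → ℤ) (i j : Fin n) :
    trans k w (hd k n i j) = hd k n i j + ((w i - w j : ℤ) : Ubar k n) := by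
  simp only [hd, map_sub, trans_hh]; push_cast; ring

theorem trans_hinv (w : Fin n → ℤ) {i j : Fin n} (hij : i ≠ j) (m : ℤ) :
    trans k w (hinv k i j m) = hinv k i j (w i - w j + m) := by
  refine (hinv_unique k hij _ ?_).symm
  have := congrArg (trans k w) (mul_hinv k hij m)
  rw [map_mul, map_add, trans_hd, map_intCast, map_one] at this
  rw [← this]; push_cast; ring

theorem perm_hd (g : Equiv.Perm (Fin n)) (i j : Fin n) :
    perm k g (hd k n i j) = hd k n (g i) (g j) := by simp [hd]

theorem perm_hinv (g : Equiv.Perm (Fin n)) {i j : Fin n} (hij : i ≠ j) (m : ℤ) :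
    perm k g (hinv k i j m) = hinv k (g i) (g j) m := by
  refine (hinv_unique k (fun h => hij (g.injective h)) _ ?_).symm
  have := congrArg (perm k g) (mul_hinv k hij m)
  rwa [map_mul, map_add, perm_hd, map_intCast, map_one] at this

theorem hd_swap (i j : Fin n) : hd k n i j = -hd k n j i := by simp [hd]

theorem hd_add (i j l : Fin n) : hd k n i j + hd k n j l = hd k n i l := by simp [hd]

theorem hinv_swap {i j : Fin n} (hij : i ≠ j) (m : ℤ) : hinv k i j m = -hinv k j i (-m) := by
  refine hinv_unique k hij m ?_
  rw [← mul_hinv k hij.symm (-m), hd_swap k i j]; push_cast; ring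

/-- The coefficient `R̂^{ij}_{ij}`, without the part `i = j`. -/
def rf (i j : Fin n) : Ubar k n := if i = j then 0 else hinv k i j 0

/-- The coefficient `R̂^{ij}_{ji}`. -/
def rg (i j : Fin n) : Ubar k n :=
  if i < j then (hd k n i j ^ 2 - 1) * hinv k i j 0 ^ 2 else 1

theorem Rhat_eq (i j a b : Fin n) : Rhat k n i j a b =
    (if a = i ∧ b = j then rf k i j else 0) + (if a = j ∧ b = i then rg k i j else 0) := by
  unfold Rhat rf rg
  rw [hdInv_eq]
  by_cases hij : i = j
  · subst hij; simp
  · by_cases h1 : a = i ∧ b = j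
    · obtain ⟨rfl, rfl⟩ := h1
      simp [hij]
    · simp [hij, h1]

@[simp] theorem rf_self (i : Fin n) : rf k i i = 0 := by simp [rf]

@[simp] theorem rg_self (i : Fin n) : rg k i i = 1 := by simp [rg]

theorem rf_swap (i j : Fin n) : rf k i j = -rf k j i := by
  by_cases hij : i = j
  · subst hij; simp
  · simp only [rf, if_neg hij, if_neg (Ne.symm hij)]
    simpa using hinv_swap k hij 0

/-- One of the two factors is 1 and the other is (h̃² - 1)/h̃². This is the unitarity R̂² = 1 on the
pair of indices i, j. -/
theorem rg_mul_rg {i j : Fin n} (hij : i ≠ j) : rg k i j * rg k j i = 1 - rf k i j ^ 2 := by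
  wlog h : i < j generalizing i j
  · rw [mul_comm, this hij.symm (lt_of_le_of_ne (not_lt.mp h) hij.symm), rf_swap k i j]; ring
  have e := mul_hinv k hij 0
  simp only [Int.cast_zero, add_zero] at e
  simp only [rg, rf, h, if_true, h.not_gt, if_false, if_neg hij]
  linear_combination (hd k n i j * hinv k i j 0 + 1) * e

/-- A row of R̂ has at most two nonzero entries, at (i,j) and (j,i), so contractions with R̂ become
explicit two-term expressions. -/
theorem sum_Rhat_left (i j : Fin n) {S : Type*} [Ring S] (c : Ubar k n →+* S)
    (X : Fin n → Fin n → S) :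
    ∑ a, ∑ b, c (Rhat k n i j a b) * X a b = c (rf k i j) * X i j + c (rg k i j) * X j i := by
  simp only [Rhat_eq, map_add, add_mul, Finset.sum_add_distrib, apply_ite c, map_zero, ite_mul,
    zero_mul, ite_and]
  simp

theorem sum_Rhat_right (a b : Fin n) {S : Type*} [Ring S] (c : Ubar k n →+* S)
    (X : Fin n → Fin n → S) :
    ∑ i, ∑ j, X i j * c (Rhat k n i j a b) = X a b * c (rf k a b) + X b a * c (rg k b a) := by
  have h : ∀ i j, X i j * c (Rhat k n i j a b) = (if i = a then if j = b then X i j * c (rf k i j)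
      else 0 else 0) + (if i = b then if j = a then X i j * c (rg k i j) else 0 else 0) := by
    intro i j
    rw [Rhat_eq]
    by_cases h1 : i = a <;> by_cases h2 : j = b <;> by_cases h3 : i = b <;> by_cases h4 : j = a <;>
      simp_all [eq_comm]
  simp only [h, Finset.sum_add_distrib]
  simp

end

end HDiff

/-! ### The dynamical Yang-Baxter equation -/

namespace HDiff

noncomputable section

open Matrix

variable (k : Type*) [CommRing k] {n : ℕ}

theorem trans_rf (w : Fin n → ℤ) (i j : Fin n) :
    trans k w (rf k i j) = if i = j then 0 else hinv k i j (w i - w j) := by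
  unfold rf
  split_ifs with h
  · simp
  · rw [trans_hinv k w h, add_zero]

theorem trans_rg (w : Fin n → ℤ) (i j : Fin n) :
    trans k w (rg k i j) = if i < j then ((hd k n i j + ((w i - w j : ℤ) : Ubar k n)) ^ 2 - 1)
      * hinv k i j (w i - w j) ^ 2 else 1 := by
  unfold rg
  split_ifs with h
  · simp [trans_hinv k w h.ne, trans_hd]
  · simp

theorem trans_rf_congr {v w : Fin n → ℤ} {i j : Fin n} (h : v i - v j = w i - w j) :
    trans k v (rf k i j) = trans k w (rf k i j) := by simp only [trans_rf, h]

theorem trans_rg_congr {v w : Fin n → ℤ} {i j : Fin n} (h : v i - v j = w i - w j) :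
    trans k v (rg k i j) = trans k w (rg k i j) := by simp only [trans_rg, h]

theorem trans_rf_self {w : Fin n → ℤ} {i j : Fin n} (h : w i = w j) :
    trans k w (rf k i j) = rf k i j := by
  rw [trans_rf_congr k (w := 0) (by simp [h]), trans_zero]

theorem trans_rg_self {w : Fin n → ℤ} {i j : Fin n} (h : w i = w j) :
    trans k w (rg k i j) = rg k i j := by
  rw [trans_rg_congr k (w := 0) (by simp [h]), trans_zero]

/-- The action of `R̂` on the first two of three indices. -/
def actA (X : Fin n → Fin n → Fin n → Ubar k n) : Fin n → Fin n → Fin n → Ubar k n :=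
  fun i j l => rf k i j * X i j l + rg k i j * X j i l

/-- The action of the translated `R̂` on the last two of three indices. -/
def actB (X : Fin n → Fin n → Fin n → Ubar k n) : Fin n → Fin n → Fin n → Ubar k n :=
  fun i j l => trans k (-ew i) (rf k j l) * X i j l + trans k (-ew i) (rg k j l) * X i l j

/-- The resolvent identity. It compares 1/h̃ with 1/(h̃ ± 1) in the Yang-Baxter equation when two
indices coincide. -/
theorem hinv_sub {i j : Fin n} (hij : i ≠ j) (m m' : ℤ) : hinv k i j m - hinv k i j m'
    = ((m' - m : ℤ) : Ubar k n) * hinv k i j m * hinv k i j m' := by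
  have h1 := mul_hinv k hij m
  have h2 := mul_hinv k hij m'
  push_cast
  linear_combination (-hinv k i j m) * h2 + hinv k i j m' * h1

/-- Partial fractions 1/(xy) = (1/x + 1/y)/(x + y), since h̃_{ij} + h̃_{jl} = h̃_{il}. -/
theorem rf_mul_rf {i j l : Fin n} (hij : i ≠ j) (hjl : j ≠ l) (hil : i ≠ l) :
    rf k i j * rf k j l = rf k i l * (rf k i j + rf k j l) := by
  have h1 := mul_hinv k hij 0
  have h2 := mul_hinv k hjl 0
  have h3 := mul_hinv k hil 0
  simp only [rf, if_neg hij, if_neg hjl, if_neg hil, Int.cast_zero, add_zero] at *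
  rw [← hd_add k i j l] at h3
  linear_combination (-hinv k i j 0 * hinv k j l 0) * h3 +
    hinv k i l 0 * hinv k j l 0 * h1 + hinv k i l 0 * hinv k i j 0 * h2

theorem rf_eq {i j : Fin n} (hij : i ≠ j) : rf k i j = hinv k i j 0 := if_neg hij

/-- The cases are the possible coincidences among the three indices. For distinct indices the
translations act trivially, and partial fractions and unitarity suffice. If exactly two coincide,
translated entries are shifted by one, and the resolvent identity and unitarity remain. -/
theorem actA_actB_actA (X : Fin n → Fin n → Fin n → Ubar k n) :
    actA k (actB k (actA k X)) = actB k (actA k (actB k X)) := by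
  funext i j l
  by_cases hij : i = j
  · subst hij
    by_cases hil : i = l
    · subst hil; simp [actA, actB]
    · have e1 : trans k (-ew i) (rf k i l) = hinv k i l (-1) := by simp [trans_rf, hil, Ne.symm hil]
      have e2 : trans k (-ew i) (rf k l i) = -hinv k i l (-1) := by
        rw [rf_swap, map_neg, e1]
      have e3 := congrArg (trans k (-ew i)) (rg_mul_rg k hil)
      have e4 := hinv_sub k hil (-1) 0
      rw [map_mul, map_sub, map_one, map_pow, e1] at e3
      push_cast at e4
      simp only [actA, actB, e1, e2, rf_self, rg_self, map_zero, map_one]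
      rw [rf_eq k hil]
      linear_combination (X i i l * (1 - hinv k i l (-1)) + X i l i * trans k (-ew i) (rg k i l)
        * (-1)) * e4 - X i i l * hinv k i l 0 * e3
  · by_cases hjl : j = l
    · subst hjl
      have e1 : trans k (-ew j) (rf k i j) = hinv k i j 1 := by simp [trans_rf, hij]
      have e3 := rg_mul_rg k hij
      have e4 := hinv_sub k hij 0 1
      push_cast at e4
      simp only [actA, actB, e1, rf_self, rg_self, map_zero, map_one, rf_swap k j i]
      rw [rf_eq k hij] at *
      linear_combination (X i j j * (-1 + hinv k i j 0) + X j i j * rg k i j) * e4 +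
        X i j j * hinv k i j 1 * e3
    · by_cases hil : i = l
      · subst hil
        have e1 : trans k (-ew i) (rf k i j) = hinv k i j (-1) := by
          simp [trans_rf, hij, Ne.symm hij]
        have e2 : trans k (-ew i) (rf k j i) = -hinv k i j (-1) := by
          rw [rf_swap, map_neg, e1]
        have e3 := congrArg (trans k (-ew i)) (rg_mul_rg k hij)
        have e4 := hinv_sub k hij (-1) 0
        have e5 := rg_mul_rg k hij
        rw [map_mul, map_sub, map_one, map_pow, e1] at e3
        push_cast at e4
        simp only [actA, actB, e1, e2, rf_self, rg_self, map_zero, map_one]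
        rw [rf_swap k j i]
        rw [rf_eq k hij] at e5 ⊢
        linear_combination (X i j i * (hinv k i j (-1) + hinv k i j 0) - X i i j *
          trans k (-ew i) (rg k j i) + X j i i * rg k i j) * e4 + X i j i * e5 - X i j i * e3
      · have t1 : ∀ {a b c : Fin n}, a ≠ b → a ≠ c → trans k (-ew a) (rf k b c) = rf k b c :=
          fun h1 h2 => trans_rf_self k (by simp [h1.symm, h2.symm])
        have t2 : ∀ {a b c : Fin n}, a ≠ b → a ≠ c → trans k (-ew a) (rg k b c) = rg k b c :=
          fun h1 h2 => trans_rg_self k (by simp [h1.symm, h2.symm])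
        have hji := Ne.symm hij
        have hlj := Ne.symm hjl
        have hli := Ne.symm hil
        simp only [actA, actB, t1 hij hil, t2 hij hil, t1 hji hjl, t2 hji hjl, t1 hli hlj,
          t2 hli hlj, t1 hil hij, t2 hil hij]
        rw [rf_swap k j i, rf_swap k l j]
        linear_combination (X i j l * (rf k i j - rf k j l) + X j i l * rg k i j
          - X i l j * rg k j l) * rf_mul_rf k hij hjl hil
          + X i j l * rf k i l * rg_mul_rg k hij - X i j l * rf k i l * rg_mul_rg k hjl

theorem actA_actA (X : Fin n → Fin n → Fin n → Ubar k n) : actA k (actA k X) = X := by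
  funext i j l
  by_cases hij : i = j
  · subst hij; simp [actA]
  · simp only [actA, rf_swap k j i]
    linear_combination X i j l * rg_mul_rg k hij

variable (n) in
/-- Triples of indices, the first strand written last. -/
abbrev I3 : Type := (Fin n × Fin n) × Fin n

variable (n) in
/-- `R̂` on the first two strands. -/
def matR1 : Matrix (I3 n) (I3 n) (Ubar k n) :=
  fun r c => if r.1.2 = c.1.2 then Rhat k n r.2 r.1.1 c.2 c.1.1 else 0

variable (n) in
/-- The translated `R̂` on the last two strands. -/
def matR2 : Matrix (I3 n) (I3 n) (Ubar k n) :=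
  fun r c => if r.2 = c.2 then trans k (-ew r.2) (Rhat k n r.1.1 r.1.2 c.1.1 c.1.2) else 0

theorem matR1_mul (M : Matrix (I3 n) (I3 n) (Ubar k n)) (i j l : Fin n) (c : I3 n) :
    (matR1 k n * M) ((j, l), i) c = actA k (fun i j l => M ((j, l), i) c) i j l := by
  rw [Matrix.mul_apply, Fintype.sum_prod_type, Fintype.sum_prod_type]
  simp only [matR1, ite_mul, zero_mul]
  rw [Finset.sum_congr rfl fun a _ => Finset.sum_comm]
  simp only [Finset.sum_ite_eq, Finset.mem_univ, if_true]
  rw [Finset.sum_comm]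
  exact sum_Rhat_left k i j (RingHom.id _) fun a b => M ((b, l), a) c

theorem matR2_mul (M : Matrix (I3 n) (I3 n) (Ubar k n)) (i j l : Fin n) (c : I3 n) :
    (matR2 k n * M) ((j, l), i) c = actB k (fun i j l => M ((j, l), i) c) i j l := by
  rw [Matrix.mul_apply, Fintype.sum_prod_type, Fintype.sum_prod_type]
  simp only [matR2, ite_mul, zero_mul]
  simp only [Finset.sum_ite_eq, Finset.mem_univ, if_true]
  exact sum_Rhat_left k j l (trans k (-ew i)).toRingHom fun a b => M ((a, b), i) c

theorem matR1_sq : matR1 k n * matR1 k n = (1 : Matrix (I3 n) (I3 n) (Ubar k n)) := by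
  ext ⟨⟨j, l⟩, i⟩ c
  have h : ∀ i j l, (matR1 k n * (1 : Matrix (I3 n) (I3 n) (Ubar k n))) ((j, l), i) c = _ :=
    fun i j l => matR1_mul k 1 i j l c
  simp only [mul_one] at h
  rw [matR1_mul]
  simp only [h]
  exact congrFun (congrFun (congrFun (actA_actA k _) i) j) l

/-- The dynamical Yang-Baxter equation. -/
theorem matR_braid : matR1 k n * matR2 k n * matR1 k n
    = (matR2 k n * matR1 k n * matR2 k n : Matrix (I3 n) (I3 n) (Ubar k n)) := by
  ext ⟨⟨j, l⟩, i⟩ c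
  have h1 : ∀ i j l, (matR1 k n * (1 : Matrix (I3 n) (I3 n) (Ubar k n))) ((j, l), i) c = _ :=
    fun i j l => matR1_mul k 1 i j l c
  have h2 : ∀ i j l, (matR2 k n * (1 : Matrix (I3 n) (I3 n) (Ubar k n))) ((j, l), i) c = _ :=
    fun i j l => matR2_mul k 1 i j l c
  simp only [mul_one] at h1 h2
  simp only [mul_assoc, matR1_mul, matR2_mul, h1, h2]
  exact congrFun (congrFun (congrFun (actA_actB_actA k _) i) j) l

variable (n) in
/-- The matrix `R̂` over `Ū(h)`. -/
def matR : Matrix (Fin n × Fin n) (Fin n × Fin n) (Ubar k n) :=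
  fun r c => Rhat k n r.1 r.2 c.1 c.2

theorem matR_mul (M : Matrix (Fin n × Fin n) (Fin n × Fin n) (Ubar k n)) (i j : Fin n)
    (c : Fin n × Fin n) :
    (matR k n * M) (i, j) c = rf k i j * M (i, j) c + rg k i j * M (j, i) c := by
  rw [Matrix.mul_apply, Fintype.sum_prod_type]
  exact sum_Rhat_left k i j (RingHom.id _) fun a b => M (a, b) c

theorem matR_sq : matR k n * matR k n = (1 : Matrix (Fin n × Fin n) (Fin n × Fin n) (Ubar k n)) := by
  ext ⟨i, j⟩ c
  have h : ∀ i j, (matR k n * (1 : Matrix (Fin n × Fin n) (Fin n × Fin n) (Ubar k n))) (i, j) c = _ :=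
    fun i j => matR_mul k 1 i j c
  simp only [mul_one] at h
  rw [matR_mul]
  simp only [h]
  by_cases hij : i = j
  · subst hij; simp
  · rw [rf_swap k j i]
    linear_combination (1 : Matrix (Fin n × Fin n) (Fin n × Fin n) (Ubar k n)) (i, j) c
      * rg_mul_rg k hij

theorem Rhat_weight {i j a b : Fin n} (h : ew i + ew j ≠ ew a + ew b) : Rhat k n i j a b = 0 := by
  rw [Rhat_eq]
  have h1 : ¬(a = i ∧ b = j) := by rintro ⟨rfl, rfl⟩; exact h rfl
  have h2 : ¬(a = j ∧ b = i) := by rintro ⟨rfl, rfl⟩; exact h (add_comm _ _)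
  simp [h1, h2]

theorem trans_Rhat_congr {v w : Fin n → ℤ} {i j : Fin n} (h : v i - v j = w i - w j)
    (a b : Fin n) : trans k v (Rhat k n i j a b) = trans k w (Rhat k n i j a b) := by
  simp only [Rhat_eq, map_add, apply_ite (trans k v), apply_ite (trans k w), map_zero,
    trans_rf_congr k h, trans_rg_congr k h]

/-- The entry depends on h̃_i and h̃_j only through their difference, which a translation by εᵢ + εⱼ
preserves. Hence entries of R̂ commute with the quadratic monomials that they multiply. -/
theorem trans_Rhat_weight (v : Fin n → ℤ) (i j a b : Fin n) :
    trans k (v - ew i - ew j) (Rhat k n i j a b) = trans k v (Rhat k n i j a b) := by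
  by_cases hij : i = j
  · subst hij; exact trans_Rhat_congr k (by simp) a b
  · refine trans_Rhat_congr k ?_ a b
    simp [hij, Ne.symm hij]

end

end HDiff

/-! ### Operators on three slots, the Cauchy determinant and the rotated R̂ -/

namespace HDiff

noncomputable section

open Matrix

section Spectator

variable {n : ℕ} {R : Type*} [Ring R]

/-- Family of operators on the first two of three slots. -/
def spec3 (F : Fin n → Matrix (Fin n × Fin n) (Fin n × Fin n) R) : Matrix (I3 n) (I3 n) R :=
  fun r c => if r.2 = c.2 then F r.2 r.1 c.1 else 0

/-- Family of operators on the first and third of three slots. -/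
def spec2 (F : Fin n → Matrix (Fin n × Fin n) (Fin n × Fin n) R) : Matrix (I3 n) (I3 n) R :=
  fun r c => if r.1.2 = c.1.2 then F r.1.2 (r.1.1, r.2) (c.1.1, c.2) else 0

/-- Family of operators on the last two of three slots. -/
def spec1 (F : Fin n → Matrix (Fin n × Fin n) (Fin n × Fin n) R) : Matrix (I3 n) (I3 n) R :=
  fun r c => if r.1.1 = c.1.1 then F r.1.1 (r.1.2, r.2) (c.1.2, c.2) else 0

variable (F G : Fin n → Matrix (Fin n × Fin n) (Fin n × Fin n) R) (M : Matrix (I3 n) (I3 n) R)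

theorem spec3_mul_apply (a b d : Fin n) (c : I3 n) :
    (spec3 F * M) ((a, b), d) c = ∑ x, ∑ y, F d (a, b) (x, y) * M ((x, y), d) c := by
  simp only [Matrix.mul_apply, Fintype.sum_prod_type, spec3, ite_mul, zero_mul, Finset.sum_ite_eq,
    Finset.mem_univ, if_true]

theorem spec2_mul_apply (a b d : Fin n) (c : I3 n) :
    (spec2 F * M) ((a, b), d) c = ∑ x, ∑ y, F b (a, d) (x, y) * M ((x, b), y) c := by
  simp only [Matrix.mul_apply, Fintype.sum_prod_type, spec2, ite_mul, zero_mul,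
    Finset.sum_ite_irrel, Finset.sum_const_zero, Finset.sum_ite_eq, Finset.mem_univ, if_true]

theorem spec1_mul_apply (a b d : Fin n) (c : I3 n) :
    (spec1 F * M) ((a, b), d) c = ∑ x, ∑ y, F a (b, d) (x, y) * M ((a, x), y) c := by
  simp only [Matrix.mul_apply, Fintype.sum_prod_type, spec1, ite_mul, zero_mul,
    Finset.sum_ite_irrel, Finset.sum_const_zero, Finset.sum_ite_eq, Finset.mem_univ, if_true]

theorem spec3_mul : spec3 F * spec3 G = spec3 fun i => F i * G i := by
  ext ⟨⟨a, b⟩, d⟩ ⟨⟨a', b'⟩, d'⟩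
  rw [spec3_mul_apply]
  by_cases h : d = d' <;> simp [spec3, h, Matrix.mul_apply, Fintype.sum_prod_type]

theorem spec2_mul : spec2 F * spec2 G = spec2 fun i => F i * G i := by
  ext ⟨⟨a, b⟩, d⟩ ⟨⟨a', b'⟩, d'⟩
  rw [spec2_mul_apply]
  by_cases h : b = b' <;> simp [spec2, h, Matrix.mul_apply, Fintype.sum_prod_type]

theorem spec1_mul : spec1 F * spec1 G = spec1 fun i => F i * G i := by
  ext ⟨⟨a, b⟩, d⟩ ⟨⟨a', b'⟩, d'⟩
  rw [spec1_mul_apply]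
  by_cases h : a = a' <;> simp [spec1, h, Matrix.mul_apply, Fintype.sum_prod_type]

theorem spec3_one : spec3 (fun _ => 1) = (1 : Matrix (I3 n) (I3 n) R) := by
  ext ⟨⟨a, b⟩, d⟩ ⟨⟨a', b'⟩, d'⟩
  simp only [spec3, Matrix.one_apply, Prod.mk.injEq, ← ite_and]
  congr 1; simp only [eq_iff_iff]; tauto

theorem spec2_one : spec2 (fun _ => 1) = (1 : Matrix (I3 n) (I3 n) R) := by
  ext ⟨⟨a, b⟩, d⟩ ⟨⟨a', b'⟩, d'⟩
  simp only [spec2, Matrix.one_apply, Prod.mk.injEq, ← ite_and]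
  congr 1; simp only [eq_iff_iff]; tauto

theorem spec1_one : spec1 (fun _ => 1) = (1 : Matrix (I3 n) (I3 n) R) := by
  ext ⟨⟨a, b⟩, d⟩ ⟨⟨a', b'⟩, d'⟩
  simp only [spec1, Matrix.one_apply, Prod.mk.injEq, ← ite_and]
  congr 1; simp only [eq_iff_iff]; tauto

end Spectator

variable (k : Type*) [CommRing k] (n : ℕ)

/-- The Cauchy matrix with entries `1 / (1 + h̃_{dj})`. -/
def cauchy : Matrix (Fin n) (Fin n) (Ubar k n) := fun j d => if d = j then 1 else hinv k d j 1

theorem isUnit_det_vandermonde (c : Ubar k n) :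
    IsUnit (Matrix.vandermonde fun i => hh k n i + c).det := by
  rw [Matrix.det_vandermonde]
  refine IsUnit.prod_iff.mpr fun i _ => IsUnit.prod_iff.mpr fun j hj => ?_
  simpa [hd] using isUnit_hd_add k n (Finset.mem_Ioi.mp hj).ne' 0

-- Two evaluations of the same polynomials P_j(x) = ∏_{l≠j} (x - h̃_l + 1) replace the closed
-- formula for the Cauchy determinant: one shows that their coefficient matrix is invertible, the
-- other exhibits the Cauchy matrix as a factor.
open Polynomial in
theorem isUnit_det_cauchy : IsUnit (cauchy k n).det := by
  let P : Fin n → (Ubar k n)[X] := fun j => ∏ l ∈ Finset.univ.erase j, (X - C (hh k n l + (-1)))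
  have hdeg : ∀ j, (P j).natDegree < n := by
    intro j
    refine lt_of_le_of_lt (natDegree_prod_le _ _) ?_
    refine lt_of_le_of_lt (Finset.sum_le_card_nsmul _ _ 1 fun l _ => natDegree_X_sub_C_le _) ?_
    rw [Finset.card_erase_of_mem (Finset.mem_univ j), Finset.card_univ, Fintype.card_fin]
    have := j.pos
    simp only [smul_eq_mul, mul_one]; omega
  let Q : Matrix (Fin n) (Fin n) (Ubar k n) := fun j r => (P j).coeff r
  have hQ : ∀ v : Fin n → Ubar k n, Q * (Matrix.vandermonde v)ᵀ = fun j d => (P j).eval (v d) := by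
    intro v
    ext j d
    rw [Matrix.mul_apply, eval_eq_sum_range' (hdeg j), Finset.sum_range]
    rfl
  have h1 : IsUnit Q.det := by
    -- P_j vanishes at h̃_d - 1 for d ≠ j, so at these nodes the matrix of values is diagonal with
    -- unit entries.
    have e := congrArg Matrix.det (hQ fun i => hh k n i + (-1))
    rw [Matrix.det_mul, Matrix.det_transpose] at e
    have e2 : (fun j d => (P j).eval (hh k n d + (-1)) : Matrix (Fin n) (Fin n) (Ubar k n))
        = Matrix.diagonal fun j => ∏ l ∈ Finset.univ.erase j, hd k n j l := by
      ext j d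
      simp only [P, eval_prod, eval_sub, eval_X, eval_C]
      by_cases h : j = d
      · subst h; simp [hd]
      · rw [Matrix.diagonal_apply_ne _ h]
        exact Finset.prod_eq_zero (Finset.mem_erase.mpr ⟨Ne.symm h, Finset.mem_univ d⟩)
          (sub_self _)
    rw [e2, Matrix.det_diagonal] at e
    suffices h : IsUnit (Q.det * (vandermonde fun i => hh k n i + -1).det) from
      isUnit_of_mul_isUnit_left h
    rw [e]
    refine IsUnit.prod_iff.mpr fun i _ => IsUnit.prod_iff.mpr fun j hj => ?_
    simpa using isUnit_hd_add k n (Finset.ne_of_mem_erase hj).symm 0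
  -- At the node h̃_d the value of P_j is ∏_l (h̃_{dl} + 1) divided by h̃_{dj} + 1, that is, a
  -- Cauchy entry times a factor depending on d alone.
  have e := congrArg Matrix.det (hQ fun i => hh k n i + 0)
  have e2 : (fun j d => (P j).eval (hh k n d + 0) : Matrix (Fin n) (Fin n) (Ubar k n))
      = cauchy k n * Matrix.diagonal fun d => ∏ l, (hd k n d l + 1) := by
    ext j d
    rw [Matrix.mul_diagonal, ← Finset.mul_prod_erase _ _ (Finset.mem_univ j), ← mul_assoc]
    have : cauchy k n j d * (hd k n d j + 1) = 1 := by
      unfold cauchy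
      split_ifs with h
      · subst h; simp [hd]
      · have := mul_hinv k h 1
        push_cast at this
        rw [mul_comm, this]
    rw [this, one_mul]
    simp only [P, eval_prod, eval_sub, eval_X, eval_C, hd]
    refine Finset.prod_congr rfl fun l _ => by ring
  rw [e2, Matrix.det_mul, Matrix.det_mul, Matrix.det_transpose] at e
  have h2 := h1.mul (isUnit_det_vandermonde k n 0)
  rw [e] at h2
  exact isUnit_of_mul_isUnit_left h2

/-- The rotated matrix `R̂`, an operator from `V* ⊗ V` to `V ⊗ V*`. -/
def matK : Matrix (Fin n × Fin n) (Fin n × Fin n) (Ubar k n) :=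
  fun r c => trans k (ew c.2) (Rhat k n c.2 r.1 c.1 r.2)

-- By weight conservation K splits into the Cauchy matrix on the pairs (j,j) and a diagonal matrix
-- on the pairs of distinct indices. Its invertibility is checked on each part.
variable {n} in
theorem matK_apply (j p a d : Fin n) : matK k n (j, p) (a, d) =
    if j = p then (if a = d then cauchy k n j d else 0)
    else if a = j ∧ d = p then trans k (ew p) (rg k p j) else 0 := by
  simp only [matK, Rhat_eq, map_add, apply_ite (trans k (ew d)), map_zero, cauchy]
  by_cases hjp : j = p
  · subst hjp
    by_cases had : a = d
    · subst had
      by_cases haj : a = j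
      · subst haj; simp
      · simp [haj, Ne.symm haj, trans_rf]
    · simp [had]; rintro rfl rfl; exact (had rfl).elim
  · by_cases h : a = j ∧ d = p
    · obtain ⟨rfl, rfl⟩ := h
      simp [hjp]
    · have : ¬ (a = j ∧ p = d) := fun h' => h ⟨h'.1, h'.2.symm⟩
      have h2 : ¬ (a = d ∧ p = j) := fun h' => hjp h'.2.symm
      simp [hjp, h, this, Ne.symm hjp]

variable {n} in
theorem isUnit_trans_rg {i j : Fin n} (hij : i ≠ j) : IsUnit (trans k (ew i) (rg k i j)) := by
  have h0 : IsUnit (hinv k i j 1) := IsUnit.of_mul_eq_one_right _ (mul_hinv k hij 1)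
  rw [trans_rg]
  split_ifs with h
  · have e : (ew i i - ew i j : ℤ) = 1 := by simp [Ne.symm hij]
    rw [e]
    refine IsUnit.mul ?_ (h0.pow 2)
    have := (isUnit_hd_add k n hij 0).mul (isUnit_hd_add k n hij 2)
    convert this using 1
    push_cast; ring
  · exact isUnit_one

theorem exists_matK_inv : ∃ Q, matK k n * Q = 1 := by
  let D : Matrix (Fin n) (Fin n) (Ubar k n) := (cauchy k n)⁻¹
  let Q : Matrix (Fin n × Fin n) (Fin n × Fin n) (Ubar k n) := fun r c =>
    if r.1 = r.2 then (if c.1 = c.2 then D r.1 c.1 else 0)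
    else if c = r then Ring.inverse (trans k (ew r.2) (rg k r.2 r.1)) else 0
  refine ⟨Q, ?_⟩
  ext ⟨j, p⟩ ⟨c, e⟩
  rw [Matrix.mul_apply, Fintype.sum_prod_type]
  simp only [matK_apply, Q]
  by_cases hjp : j = p
  · subst hjp
    simp only [if_true, ite_mul, zero_mul, Finset.sum_ite_eq, Finset.mem_univ]
    by_cases hce : c = e
    · subst hce
      have := congrFun (congrFun (Matrix.mul_nonsing_inv _ (isUnit_det_cauchy k n)) j) c
      rw [Matrix.mul_apply] at this
      simp only [if_true, D, this, Matrix.one_apply, Prod.mk.injEq, and_self]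
    · simp only [if_neg hce, mul_zero, Finset.sum_const_zero]
      rw [Matrix.one_apply_ne]
      simp only [ne_eq, Prod.mk.injEq]; rintro ⟨rfl, rfl⟩; exact hce rfl
  · rw [Finset.sum_eq_single j, Finset.sum_eq_single p]
    · simp only [if_neg hjp, and_self, if_true, mul_ite, mul_zero,
        Ring.mul_inverse_cancel _ (isUnit_trans_rg k (Ne.symm hjp)), Matrix.one_apply]
      simp only [eq_comm]
    · intro x _ hx; simp [hx, hjp]
    · simp
    · intro x _ hx; simp [hx, hjp]
    · simp

/-- The inverse of the rotated matrix. -/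
def matKi : Matrix (Fin n × Fin n) (Fin n × Fin n) (Ubar k n) := (exists_matK_inv k n).choose

theorem matK_mul_matKi : matK k n * matKi k n = 1 := (exists_matK_inv k n).choose_spec

theorem matKi_mul_matK : matKi k n * matK k n = 1 :=
  mul_eq_one_comm.mp (matK_mul_matKi k n)

end

end HDiff

/-! ### Braid and cup-cap identities with a dual strand -/

namespace HDiff

noncomputable section

open Matrix

variable (k : Type*) [CommRing k] (n : ℕ)

theorem matR1_eq : matR1 k n = spec2 fun _ => (matR k n).submatrix Prod.swap Prod.swap := rfl

theorem matR2_eq : matR2 k n = spec3 fun i => (matR k n).map (trans k (-ew i)) := rfl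

/-- `R̂` on `V ⊗ V ⊗ V*`. -/
def matE1 : Matrix (I3 n) (I3 n) (Ubar k n) := spec3 fun _ => matR k n

/-- `R̂` on `V* ⊗ V ⊗ V`, the dual strand written last. -/
def matE3 : Matrix (I3 n) (I3 n) (Ubar k n) := spec3 fun d => (matR k n).map (trans k (ew d))

/-- The rotated matrix from `V* ⊗ V ⊗ V` to `V ⊗ V* ⊗ V`. -/
def matK1 : Matrix (I3 n) (I3 n) (Ubar k n) := spec2 fun _ => matK k n

/-- The inverse of `matK1`. -/
def matKi1 : Matrix (I3 n) (I3 n) (Ubar k n) := spec2 fun _ => matKi k n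

/-- The rotated matrix from `V ⊗ V* ⊗ V` to `V ⊗ V ⊗ V*`. -/
def matK2 : Matrix (I3 n) (I3 n) (Ubar k n) := spec1 fun i => (matK k n).map (trans k (-ew i))

/-- The inverse of `matK2`. -/
def matKi2 : Matrix (I3 n) (I3 n) (Ubar k n) := spec1 fun i => (matKi k n).map (trans k (-ew i))

/-- Evaluation followed by coevaluation, from `V* ⊗ V` to `V ⊗ V*`. -/
def matT : Matrix (Fin n × Fin n) (Fin n × Fin n) (Ubar k n) :=
  fun r c => if r.1 = r.2 ∧ c.1 = c.2 then 1 else 0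

/-- `matT` on the first two factors. -/
def matT1 : Matrix (I3 n) (I3 n) (Ubar k n) := spec2 fun _ => matT k n

/-- `matT` on the last two factors. -/
def matT2 : Matrix (I3 n) (I3 n) (Ubar k n) := spec1 fun _ => matT k n

/-- Evaluation on the last two factors of `V ⊗ V* ⊗ V` followed by coevaluation in front. -/
def matJ : Matrix (I3 n) (I3 n) (Ubar k n) :=
  fun r c => if r.1.1 = r.2 ∧ c.1.2 = c.2 ∧ r.1.2 = c.1.1 then 1 else 0

variable {n} in
theorem map_mul_eq_one {M N : Matrix (Fin n × Fin n) (Fin n × Fin n) (Ubar k n)} (h : M * N = 1)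
    (w : Fin n → ℤ) : M.map (trans k w) * N.map (trans k w) = 1 := by
  have : M.map (trans k w) * N.map (trans k w) = (M * N).map (trans k w) :=
    (Matrix.map_mul (f := (trans k w : Ubar k n →ₐ[k] Ubar k n).toRingHom)).symm
  rw [this, h]
  exact Matrix.map_one _ (map_zero _) (map_one _)

theorem matE1_sq : matE1 k n * matE1 k n = 1 := by
  simp only [matE1, spec3_mul, matR_sq, spec3_one]

theorem matE3_sq : matE3 k n * matE3 k n = 1 := by
  simp only [matE3, spec3_mul, map_mul_eq_one k (matR_sq k), spec3_one]

theorem matK1_mul_matKi1 : matK1 k n * matKi1 k n = 1 := by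
  simp only [matK1, matKi1, spec2_mul, matK_mul_matKi, spec2_one]

theorem matKi1_mul_matK1 : matKi1 k n * matK1 k n = 1 := by
  simp only [matK1, matKi1, spec2_mul, matKi_mul_matK, spec2_one]

theorem matK2_mul_matKi2 : matK2 k n * matKi2 k n = 1 := by
  simp only [matK2, matKi2, spec1_mul, map_mul_eq_one k (matK_mul_matKi k n), spec1_one]

theorem matKi2_mul_matK2 : matKi2 k n * matK2 k n = 1 := by
  simp only [matK2, matKi2, spec1_mul, map_mul_eq_one k (matKi_mul_matK k n), spec1_one]

/-- The dynamical Yang-Baxter equation, entry by entry. -/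
theorem sum_Rhat_braid (d i j a b p : Fin n) :
    ∑ x, ∑ y, ∑ w, Rhat k n d i x w * trans k (-ew x) (Rhat k n w j y p) * Rhat k n x y a b
    = ∑ x, ∑ y, ∑ z, trans k (-ew d) (Rhat k n i j x y) * Rhat k n d x a z *
        trans k (-ew a) (Rhat k n z y b p) := by
  have h := congrFun (congrFun (matR_braid k (n := n)) ((i, j), d)) ((b, p), a)
  rw [mul_assoc, mul_assoc] at h
  simp only [matR1_eq, matR2_eq] at h
  rw [spec2_mul_apply, spec3_mul_apply] at h
  simp only [spec3_mul_apply, spec2_mul_apply] at h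
  simp only [spec2, spec3, mul_ite, mul_zero, Finset.sum_ite_eq', Finset.mem_univ,
    if_true, submatrix_apply, Prod.swap, map_apply, matR, Finset.mul_sum] at h
  simp only [← mul_assoc] at h
  rw [Finset.sum_comm] at h
  rw [Finset.sum_congr rfl fun x _ => Finset.sum_comm]
  rw [h]

/-- This is the Yang-Baxter equation, translated by ε_d, with the strand of d bent into a dual one.
Conservation of weight identifies the translations of the individual factors on both sides. -/
theorem matK_braid : matK2 k n * matK1 k n * matE3 k n = matE1 k n * matK2 k n * matK1 k n := by
  ext ⟨⟨i, j⟩, p⟩ ⟨⟨a, b⟩, d⟩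
  have h := congrArg (trans k (ew d)) (sum_Rhat_braid k n d i j a b p)
  simp only [map_sum, map_mul, trans_trans] at h
  rw [mul_assoc, mul_assoc, matK2, matK1, matE3, matE1]
  rw [spec1_mul_apply, spec3_mul_apply]
  simp only [spec2_mul_apply, spec1_mul_apply]
  simp only [spec2, spec3, mul_ite, mul_zero, Finset.sum_ite_eq', 
    Finset.mem_univ, if_true, map_apply, matR, matK,
    Finset.sum_ite_irrel, Finset.sum_const_zero, Finset.mul_sum, trans_trans, ← mul_assoc]
  rw [Finset.sum_congr rfl fun x _ => Finset.sum_comm, Finset.sum_comm]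
  refine Eq.trans ?_ (h.trans ?_)
  · refine Finset.sum_congr rfl fun x _ => Finset.sum_congr rfl fun y _ =>
      Finset.sum_congr rfl fun w _ => ?_
    by_cases hw : ew d + ew i = ew x + ew w
    · have e : ew d + -ew x = -ew i + ew w := by linear_combination hw
      rw [e]; ring
    · simp [Rhat_weight k hw]
  · refine Finset.sum_congr rfl fun x _ => Finset.sum_congr rfl fun y _ =>
      Finset.sum_congr rfl fun z _ => ?_
    by_cases hw : ew d + ew x = ew a + ew z
    · have e : ew d + -ew a = -ew x + ew z := by linear_combination hw
      rw [e, add_neg_cancel, trans_zero]; ring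
    · simp [Rhat_weight k hw]

/-- A crossing next to a cap is a rotated crossing, by the definition of K; `matJ` records the cap
and cup after the slide. The next lemma is the same fact for the cup. -/
theorem matT1_mul_matE3 : matT1 k n * matE3 k n = matJ k n * matK1 k n := by
  ext ⟨⟨i, j⟩, p⟩ ⟨⟨a, b⟩, d⟩
  rw [matT1, spec2_mul_apply, Matrix.mul_apply, Fintype.sum_prod_type, Fintype.sum_prod_type]
  simp only [matT, matE3, matJ, matK1, spec3, spec2, matK, matR, map_apply]
  by_cases h : i = p
  · simp [h, ite_and]
  · simp [h]

theorem matE1_mul_matT2 : matE1 k n * matT2 k n = matK2 k n * matJ k n := by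
  ext ⟨⟨i, j⟩, p⟩ ⟨⟨a, b⟩, d⟩
  rw [matE1, matK2, spec3_mul_apply, spec1_mul_apply]
  simp only [matT, matT2, matJ, spec1, matK, matR, map_apply]
  by_cases h : b = d
  · simp [h, ite_and]
  · simp [h]

theorem matT2_mul_matJ : matT2 k n * matJ k n = matT2 k n := by
  ext ⟨⟨i, j⟩, p⟩ ⟨⟨a, b⟩, d⟩
  rw [matT2, spec1_mul_apply]
  simp only [matT, matJ, spec1]
  by_cases h : j = p <;> by_cases h' : b = d <;> by_cases h2 : i = a <;>
    simp [h, h', h2, ite_and, eq_comm]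

end

end HDiff

/-! ### The presentation of D(gl_n), and weights of matrices -/

namespace HDiff

noncomputable section

open Matrix

variable {k : Type*} [CommRing k] {n : ℕ} {S : Type*} [Ring S] [Algebra k S]

/-- The matrix `R̂` over an algebra under `Ū(h)`. -/
def mR (c : Ubar k n →ₐ[k] S) : Matrix (Fin n × Fin n) (Fin n × Fin n) S := (matR k n).map c

/-- The matrix `L ⊗ 1`. -/
def mL (L : Fin n → Fin n → S) : Matrix (Fin n × Fin n) (Fin n × Fin n) S :=
  fun r x => if r.2 = x.2 then L x.1 r.1 else 0

/-- The second Jucys-Murphy type matrix `R̂ L₁ R̂ - R̂`. -/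
def mY (c : Ubar k n →ₐ[k] S) (L : Fin n → Fin n → S) :
    Matrix (Fin n × Fin n) (Fin n × Fin n) S := mR c * mL L * mR c - mR c

/-- The data of a homomorphism from the diagonal reduction algebra. -/
structure IsRedSys (c : Ubar k n →ₐ[k] S) (L : Fin n → Fin n → S) : Prop where
  weight : ∀ p i j, c p * L i j = L i j * c (trans k (ew j - ew i) p)
  reflection : mL L * mY c L = mY c L * mL L

theorem mapMatrix_trans_comp {I : Type*} [Fintype I] [DecidableEq I] (c : Ubar k n →ₐ[k] S)
    {M N : Matrix I I (Ubar k n)} (h : M * N = 1) : M.map c * N.map c = 1 := by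
  have : M.map c * N.map c = (M * N).map c := (Matrix.map_mul (f := c.toRingHom)).symm
  rw [this, h]
  exact Matrix.map_one _ (map_zero _) (map_one _)

theorem mR_sq (c : Ubar k n →ₐ[k] S) : mR c * mR c = 1 := mapMatrix_trans_comp c (matR_sq k)

theorem IsRedSys.reflection' {c : Ubar k n →ₐ[k] S} {L : Fin n → Fin n → S} (h : IsRedSys c L) :
    mR c * mL L * mR c * mL L - mL L * mR c * mL L * mR c = mR c * mL L - mL L * mR c := by
  have := h.reflection
  simp only [mY, mul_sub, sub_mul, ← mul_assoc] at this
  rw [← sub_eq_zero] at this ⊢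
  rw [← neg_eq_zero, ← this]
  abel

section RedAlgebra

variable (k n) in
/-- The homomorphism from `Ū(h)` to the diagonal reduction algebra. -/
def rC : Ubar k n →ₐ[k] Red k n where
  toFun := rCoef k n
  map_one' := by
    have := RingQuot.mkAlgHom_rel k (RedRel.coef_scalar (k := k) (n := n) 1)
    simpa [rCoef] using this
  map_mul' p q := by
    have := RingQuot.mkAlgHom_rel k (RedRel.coef_mul (k := k) (n := n) p q)
    simpa [rCoef] using this
  map_zero' := by
    have := RingQuot.mkAlgHom_rel k (RedRel.coef_scalar (k := k) (n := n) 0)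
    simpa [rCoef] using this
  map_add' p q := by
    have := RingQuot.mkAlgHom_rel k (RedRel.coef_add (k := k) (n := n) p q)
    simpa [rCoef] using this
  commutes' a := by
    have := RingQuot.mkAlgHom_rel k (RedRel.coef_scalar (k := k) (n := n) a)
    simpa only [rCoef, AlgHom.commutes] using this

theorem red_induction {P : Red k n → Prop} (coef : ∀ p, P (rC k n p)) (L : ∀ i j, P (rL k n i j))
    (add : ∀ x y, P x → P y → P (x + y)) (mul : ∀ x y, P x → P y → P (x * y)) (x : Red k n) :
    P x := by
  obtain ⟨y, rfl⟩ := RingQuot.mkAlgHom_surjective k (RedRel k n) x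
  induction y using FreeAlgebra.induction with
  | grade0 r =>
    rw [AlgHom.commutes, ← (rC k n).commutes]
    exact coef _
  | grade1 x => cases x with
    | coef p => exact coef p
    | L i j => exact L i j
  | mul a b ha hb => rw [map_mul]; exact mul _ _ ha hb
  | add a b ha hb => rw [map_add]; exact add _ _ ha hb

theorem red_algHom_ext {f g : Red k n →ₐ[k] S} (hC : ∀ p, f (rC k n p) = g (rC k n p))
    (hL : ∀ i j, f (rL k n i j) = g (rL k n i j)) : f = g :=
  AlgHom.ext <| red_induction hC hL (fun x y hx hy => by rw [map_add, map_add, hx, hy])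
    (fun x y hx hy => by rw [map_mul, map_mul, hx, hy])

theorem mL_mul_apply (L : Fin n → Fin n → S) (M : Matrix (Fin n × Fin n) (Fin n × Fin n) S)
    (i j : Fin n) (x : Fin n × Fin n) : (mL L * M) (i, j) x = ∑ a, L a i * M (a, j) x := by
  simp only [Matrix.mul_apply, Fintype.sum_prod_type, mL, ite_mul, zero_mul, Finset.sum_ite_eq,
    Finset.mem_univ, if_true]

theorem mul_mL_apply (L : Fin n → Fin n → S) (M : Matrix (Fin n × Fin n) (Fin n × Fin n) S)
    (x : Fin n × Fin n) (i j : Fin n) : (M * mL L) x (i, j) = ∑ a, M x (a, j) * L i a := by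
  simp only [Matrix.mul_apply, Fintype.sum_prod_type, mL, mul_ite, mul_zero, Finset.sum_ite_eq',
    Finset.mem_univ, if_true]

variable (k n) in
theorem isRedSys_red : IsRedSys (rC k n) (rL k n) := by
  have hw : ∀ p i j, rC k n p * rL k n i j = rL k n i j * rC k n (trans k (ew j - ew i) p) := by
    intro p i j
    refine ubar_intertwine (rC k n) ((rC k n).comp (trans k (ew j - ew i))) _ (fun m => ?_) p
    have := RingQuot.mkAlgHom_rel k (RedRel.weight_L (k := k) (n := n) m i j)
    simp only [map_mul, map_add, map_sub, apply_ite (RingQuot.mkAlgHom k (RedRel k n)), map_one,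
      map_zero] at this
    rw [AlgHom.comp_apply, trans_hh, map_add, map_intCast]
    refine Eq.trans this ?_
    rw [add_sub_assoc]
    change rL k n i j * (rC k n (hh k n m) + _) = _
    congr 2
    simp [Pi.single_apply]
  refine ⟨hw, ?_⟩
  let π := (RingQuot.mkAlgHom k (RedRel k n)).mapMatrix (m := Fin n × Fin n)
  have hR : π (R12 k n) = mR (rC k n) := rfl
  have hL : π (L1 k n) = mL (rL k n) := by
    ext r c
    simp only [π, AlgHom.mapMatrix_apply, map_apply, L1, mL]
    split_ifs
    · rfl
    · exact map_zero _
  have h : π (R12 k n * L1 k n * R12 k n * L1 k n - L1 k n * R12 k n * L1 k n * R12 k n)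
      = π (R12 k n * L1 k n - L1 k n * R12 k n) := by
    ext r c
    exact RingQuot.mkAlgHom_rel k (RedRel.reflection (k := k) (n := n) r c)
  simp only [map_sub, map_mul, hR, hL] at h
  simp only [mY, mul_sub, sub_mul, ← mul_assoc]
  rw [sub_eq_sub_iff_sub_eq_sub, ← neg_inj]
  simp only [neg_sub]
  exact h

/-- The homomorphism from the diagonal reduction algebra given by a solution of its relations. -/
def redLift (c : Ubar k n →ₐ[k] S) (L : Fin n → Fin n → S) (h : IsRedSys c L) : Red k n →ₐ[k] S :=
  RingQuot.liftAlgHom k ⟨FreeAlgebra.lift k (fun g => match g with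
    | RedGen.coef p => c p
    | RedGen.L i j => L i j), by
    let f : RedFree k n →ₐ[k] S := FreeAlgebra.lift k (fun g => match g with
      | RedGen.coef p => c p
      | RedGen.L i j => L i j)
    have hc : ∀ p, f (gCoef k n p) = c p := fun p => FreeAlgebra.lift_ι_apply _ _
    have hl : ∀ i j, f (gL k n i j) = L i j := fun i j => FreeAlgebra.lift_ι_apply _ _
    intro x y hxy
    change f x = f y
    cases hxy with
    | coef_add p q => simp only [map_add, hc]
    | coef_mul p q => simp only [map_mul, hc]
    | coef_scalar a => simp only [hc, AlgHom.commutes]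
    | weight_L m i j =>
      simp only [map_mul, map_add, map_sub, hc, hl, apply_ite f, map_one, map_zero, h.weight,
        trans_hh]
      rw [add_sub_assoc]
      congr 2
      simp [Pi.single_apply]
    | reflection r s =>
      let π := f.mapMatrix (m := Fin n × Fin n)
      have hR : π (R12 k n) = mR c := by ext r s; exact hc _
      have hL : π (L1 k n) = mL L := by
        ext r s
        simp only [π, AlgHom.mapMatrix_apply, map_apply, L1, mL]
        split_ifs
        · exact hl _ _
        · exact map_zero _
      have e : π (R12 k n * L1 k n * R12 k n * L1 k n - L1 k n * R12 k n * L1 k n * R12 k n)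
          = π (R12 k n * L1 k n - L1 k n * R12 k n) := by
        simp only [map_sub, map_mul, hR, hL]
        exact h.reflection'
      exact congrFun (congrFun e r) s⟩

@[simp] theorem redLift_rC (c : Ubar k n →ₐ[k] S) (L : Fin n → Fin n → S) (h : IsRedSys c L)
    (p : Ubar k n) : redLift c L h (rC k n p) = c p :=
  (RingQuot.liftAlgHom_mkAlgHom_apply k _ _ _).trans (FreeAlgebra.lift_ι_apply _ _)

@[simp] theorem redLift_rL (c : Ubar k n →ₐ[k] S) (L : Fin n → Fin n → S) (h : IsRedSys c L)
    (i j : Fin n) : redLift c L h (rL k n i j) = L i j :=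
  (RingQuot.liftAlgHom_mkAlgHom_apply k _ _ _).trans (FreeAlgebra.lift_ι_apply _ _)

end RedAlgebra

section Weights

variable {I : Type*}

/-- The entries of a matrix have the weights prescribed by their row and column. -/
def HasWeight (c : Ubar k n →ₐ[k] S) (wt : I → Fin n → ℤ) (M : Matrix I I S) : Prop :=
  ∀ p r x, c p * M r x = M r x * c (trans k (wt r - wt x) p)

variable {c : Ubar k n →ₐ[k] S} {wt : I → Fin n → ℤ} {M N : Matrix I I S}

theorem HasWeight.mul [Fintype I] (hM : HasWeight c wt M) (hN : HasWeight c wt N) :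
    HasWeight c wt (M * N) := by
  intro p r x
  rw [Matrix.mul_apply, Finset.mul_sum, Finset.sum_mul]
  refine Finset.sum_congr rfl fun y _ => ?_
  rw [← mul_assoc, hM, mul_assoc, hN, mul_assoc, trans_trans]
  congr 4; abel_nf

theorem HasWeight.add (hM : HasWeight c wt M) (hN : HasWeight c wt N) :
    HasWeight c wt (M + N) := by
  intro p r x
  rw [Matrix.add_apply, mul_add, add_mul, hM, hN]

theorem HasWeight.sub (hM : HasWeight c wt M) (hN : HasWeight c wt N) :
    HasWeight c wt (M - N) := by
  intro p r x
  rw [Matrix.sub_apply, mul_sub, sub_mul, hM, hN]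

theorem hasWeight_map {M : Matrix I I (Ubar k n)} (h : ∀ r x, wt r ≠ wt x → M r x = 0) :
    HasWeight c wt (M.map c) := by
  intro p r x
  by_cases e : wt r = wt x
  · rw [e, sub_self, trans_zero, map_apply, ← map_mul, mul_comm, map_mul]
  · simp [h r x e]

variable [Fintype I] [DecidableEq I]

/-- Having weights means commuting with certain diagonal matrices, a condition that passes to the
inverse matrix. This is how K⁻¹, which is not explicit, gets its weights. -/
theorem hasWeight_iff : HasWeight c wt M ↔ ∀ p,
    Matrix.diagonal (fun r => c (trans k (-wt r) p)) * M
      = M * Matrix.diagonal (fun r => c (trans k (-wt r) p)) := by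
  constructor
  · intro h p
    ext r x
    rw [Matrix.diagonal_mul, Matrix.mul_diagonal, h, trans_trans]
    congr 3; abel_nf
  · intro h p r x
    have := congrFun (congrFun (h (trans k (wt r) p)) r) x
    rw [Matrix.diagonal_mul, Matrix.mul_diagonal, trans_trans, trans_trans] at this
    rw [neg_add_cancel, trans_zero] at this
    rw [this]
    congr 3; abel_nf

theorem HasWeight.inv (hM : HasWeight c wt M) (h1 : M * N = 1) (h2 : N * M = 1) :
    HasWeight c wt N := by
  rw [hasWeight_iff] at hM ⊢
  intro p
  calc _ = N * (M * Matrix.diagonal (fun r => c (trans k (-wt r) p))) * N := by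
        rw [← mul_assoc, h2, one_mul]
    _ = _ := by rw [← hM, mul_assoc, mul_assoc, h1, mul_one]

end Weights

/-- The weight of a pair of vector indices. -/
def wtVV (r : Fin n × Fin n) : Fin n → ℤ := ew r.1 + ew r.2

/-- The weight of a pair of a vector index and a covector index. -/
def wtVD (r : Fin n × Fin n) : Fin n → ℤ := ew r.1 - ew r.2

theorem hasWeight_mR (c : Ubar k n →ₐ[k] S) : HasWeight c wtVV (mR c) :=
  hasWeight_map fun _ _ h => Rhat_weight k h

theorem IsRedSys.hasWeight_mL {c : Ubar k n →ₐ[k] S} {L : Fin n → Fin n → S} (h : IsRedSys c L)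
    {wt : Fin n × Fin n → Fin n → ℤ} (hwt : ∀ i j l, wt (i, l) - wt (j, l) = ew i - ew j) :
    HasWeight c wt (mL L) := by
  rintro p ⟨i, l⟩ ⟨j, l'⟩
  simp only [mL]
  split_ifs with e
  · subst e; rw [hwt, h.weight]
  · simp

theorem IsRedSys.hasWeight_mY {c : Ubar k n →ₐ[k] S} {L : Fin n → Fin n → S} (h : IsRedSys c L) :
    HasWeight c wtVV (mY c L) :=
  (((hasWeight_mR c).mul (h.hasWeight_mL fun i j l => by simp [wtVV])).mul (hasWeight_mR c)).sub
    (hasWeight_mR c)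

theorem hasWeight_matK (c : Ubar k n →ₐ[k] S) : HasWeight c wtVD ((matK k n).map c) := by
  refine hasWeight_map fun r x h => ?_
  have : Rhat k n x.2 r.1 x.1 r.2 = 0 := Rhat_weight k fun e => h (by
    simp only [wtVD]; linear_combination e)
  rw [matK, this, map_zero]

theorem hasWeight_matKi (c : Ubar k n →ₐ[k] S) : HasWeight c wtVD ((matKi k n).map c) :=
  (hasWeight_matK c).inv (mapMatrix_trans_comp c (matK_mul_matKi k n))
    (mapMatrix_trans_comp c (matKi_mul_matK k n))

theorem hasWeight_matT (c : Ubar k n →ₐ[k] S) : HasWeight c wtVD ((matT k n).map c) := by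
  refine hasWeight_map fun r x h => if_neg ?_
  rintro ⟨h1, h2⟩
  exact h (by simp [wtVD, h1, h2])

end

end HDiff

/-! ### Jucys-Murphy elements in an abstract ring -/

namespace HDiff

noncomputable section

open Matrix

variable {k : Type*} [CommRing k] {n : ℕ}

section Abstract

variable {A : Type*} [Ring A]

/-- The induction step for the commuting family of a degenerate affine Hecke algebra, with y₁ = y,
y₂ = r₁y₁r₁ - r₁ and y₃ = r₂y₂r₂ - r₂. The braid relation moves r₁ through y₃; y passes y₃ because
it passes r₂ and y₂; and y₂ is made of r₁ and y. -/
theorem jucysMurphy_commute {r₁ r₂ y : A} (h1 : r₁ * r₁ = 1) (hb : r₁ * r₂ * r₁ = r₂ * r₁ * r₂)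
    (hy : y * r₂ = r₂ * y) (h : y * (r₁ * y * r₁ - r₁) = (r₁ * y * r₁ - r₁) * y) :
    r₁ * (r₂ * (r₁ * y * r₁ - r₁) * r₂ - r₂) = (r₂ * (r₁ * y * r₁ - r₁) * r₂ - r₂) * r₁ ∧
    (r₁ * y * r₁ - r₁) * (r₂ * (r₁ * y * r₁ - r₁) * r₂ - r₂)
      = (r₂ * (r₁ * y * r₁ - r₁) * r₂ - r₂) * (r₁ * y * r₁ - r₁) := by
  set z := r₂ * (r₁ * y * r₁ - r₁) * r₂ - r₂ with hz
  have e1 : r₁ * z = z * r₁ := by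
    have a1 : r₁ * (r₂ * (r₁ * y * r₁) * r₂) = r₂ * (r₁ * y * r₁) * r₂ * r₁ := by
      calc r₁ * (r₂ * (r₁ * y * r₁) * r₂) = (r₁ * r₂ * r₁) * y * r₁ * r₂ := by noncomm_ring
        _ = r₂ * r₁ * (r₂ * y) * r₁ * r₂ := by rw [hb]; noncomm_ring
        _ = r₂ * r₁ * y * (r₂ * r₁ * r₂) := by rw [← hy]; noncomm_ring
        _ = r₂ * (r₁ * y * r₁) * r₂ * r₁ := by rw [← hb]; noncomm_ring
    have a2 : r₁ * (r₂ * r₁ * r₂) = r₂ * r₁ := by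
      rw [← hb, ← mul_assoc, ← mul_assoc, h1, one_mul]
    have a3 : r₂ * r₁ * r₂ * r₁ = r₁ * r₂ := by rw [← hb, mul_assoc, h1, mul_one]
    calc r₁ * z = r₁ * (r₂ * (r₁ * y * r₁) * r₂) - r₁ * (r₂ * r₁ * r₂) - r₁ * r₂ := by
          rw [hz]; noncomm_ring
      _ = r₂ * (r₁ * y * r₁) * r₂ * r₁ - r₂ * r₁ * r₂ * r₁ - r₂ * r₁ := by
          rw [a1, a2, a3]; abel
      _ = z * r₁ := by rw [hz]; noncomm_ring
  have e2 : y * z = z * y := by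
    calc y * z = y * r₂ * (r₁ * y * r₁ - r₁) * r₂ - y * r₂ := by rw [hz]; noncomm_ring
      _ = r₂ * (y * (r₁ * y * r₁ - r₁)) * r₂ - r₂ * y := by rw [hy]; noncomm_ring
      _ = r₂ * (r₁ * y * r₁ - r₁) * (y * r₂) - r₂ * y := by rw [h]; noncomm_ring
      _ = z * y := by rw [hy, hz]; noncomm_ring
  refine ⟨e1, ?_⟩
  calc (r₁ * y * r₁ - r₁) * z = r₁ * y * (r₁ * z) - r₁ * z := by noncomm_ring
    _ = r₁ * (y * z) * r₁ - z * r₁ := by rw [e1]; noncomm_ring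
    _ = (r₁ * z) * y * r₁ - z * r₁ := by rw [e2]; noncomm_ring
    _ = z * (r₁ * y * r₁ - r₁) := by rw [e1]; noncomm_ring

/-- The analogue with one dual strand, as in walled Brauer algebras. Conjugation by u = k₂k₁ moves
the dual strand to the other end. There r₃ becomes r₁, and with the contraction e = t₂l₂ the two
elements become y + r₁er₁ and r₁yr₁ - r₁ + e. -/
theorem jucysMurphy_dual_commute {r₁ r₃ k₁ k₂ l₁ l₂ t₁ t₂ j y : A} (h1 : r₁ * r₁ = 1)
    (h3 : r₃ * r₃ = 1) (hk1 : k₁ * l₁ = 1) (hl1 : l₁ * k₁ = 1) (hk2 : k₂ * l₂ = 1)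
    (hl2 : l₂ * k₂ = 1) (hb : k₂ * k₁ * r₃ = r₁ * k₂ * k₁) (ht : t₁ * r₃ = j * k₁)
    (ht2 : r₁ * t₂ = k₂ * j) (htj : t₂ * j = t₂) (hyk : y * k₂ = k₂ * y) (hyt : y * t₂ = t₂ * y)
    (hy : y * (r₁ * y * r₁ - r₁) = (r₁ * y * r₁ - r₁) * y) :
    (l₁ * (y * k₁ + t₁)) * (r₃ * (l₁ * (y * k₁ + t₁)) * r₃ - r₃)
      = (r₃ * (l₁ * (y * k₁ + t₁)) * r₃ - r₃) * (l₁ * (y * k₁ + t₁)) := by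
  set e := t₂ * l₂ with he
  set u := k₂ * k₁ with hu
  set v := l₁ * l₂ with hv
  have huv : u * v = 1 := by
    calc u * v = k₂ * (k₁ * l₁) * l₂ := by rw [hu, hv]; noncomm_ring
      _ = 1 := by rw [hk1, mul_one, hk2]
  have hyl : l₂ * y = y * l₂ := by
    calc l₂ * y = l₂ * (y * k₂) * l₂ := by rw [mul_assoc, mul_assoc, hk2, mul_one]
      _ = (l₂ * k₂) * y * l₂ := by rw [hyk]; noncomm_ring
      _ = y * l₂ := by rw [hl2, one_mul]
  have hye : y * e = e * y := by
    rw [he, ← mul_assoc, hyt, mul_assoc, ← hyl, mul_assoc]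
  have hre : e * r₁ * e = e := by
    calc e * r₁ * e = t₂ * l₂ * (r₁ * t₂) * l₂ := by rw [he]; noncomm_ring
      _ = t₂ * (l₂ * k₂) * j * l₂ := by rw [ht2]; noncomm_ring
      _ = e := by rw [hl2, mul_one, htj, he]
  have hx1 : v * (r₁ * e * r₁) * u = l₁ * t₁ := by
    calc v * (r₁ * e * r₁) * u = v * (r₁ * t₂) * l₂ * (r₁ * u) := by rw [he]; noncomm_ring
      _ = v * k₂ * j * l₂ * (u * r₃) := by rw [ht2, hu, hb]; noncomm_ring
      _ = l₁ * (l₂ * k₂) * j * (l₂ * k₂) * k₁ * r₃ := by rw [hu, hv]; noncomm_ring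
      _ = l₁ * (j * k₁) * r₃ := by rw [hl2]; noncomm_ring
      _ = l₁ * t₁ * (r₃ * r₃) := by rw [← ht]; noncomm_ring
      _ = l₁ * t₁ := by rw [h3, mul_one]
  have hx2 : v * y * u = l₁ * (y * k₁) := by
    calc v * y * u = l₁ * (l₂ * y) * k₂ * k₁ := by rw [hu, hv]; noncomm_ring
      _ = l₁ * y * (l₂ * k₂) * k₁ := by rw [hyl]; noncomm_ring
      _ = l₁ * (y * k₁) := by rw [hl2]; noncomm_ring
  have hx : l₁ * (y * k₁ + t₁) = v * (y + r₁ * e * r₁) * u := by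
    rw [mul_add, ← hx1, ← hx2]; noncomm_ring
  have hr : r₃ = v * r₁ * u := by
    have : v * u = 1 := by
      calc v * u = l₁ * (l₂ * k₂) * k₁ := by rw [hu, hv]; noncomm_ring
        _ = 1 := by rw [hl2, mul_one, hl1]
    calc r₃ = (v * u) * r₃ := by rw [this, one_mul]
      _ = v * (k₂ * k₁ * r₃) := by rw [hu]; noncomm_ring
      _ = v * r₁ * u := by rw [hb, hu]; noncomm_ring
  -- After the conjugation only r₁² = 1, ye = ey, er₁e = e and the assumption on y are used.
  have key : (y + r₁ * e * r₁) * (r₁ * y * r₁ - r₁ + e)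
      = (r₁ * y * r₁ - r₁ + e) * (y + r₁ * e * r₁) := by
    have a1 : r₁ * e * r₁ * (r₁ * y * r₁ - r₁) = r₁ * (e * y) * r₁ - r₁ * e := by
      calc _ = r₁ * e * (r₁ * r₁) * y * r₁ - r₁ * e * (r₁ * r₁) := by noncomm_ring
        _ = _ := by rw [h1]; noncomm_ring
    have a2 : (r₁ * y * r₁ - r₁) * (r₁ * e * r₁) = r₁ * (e * y) * r₁ - e * r₁ := by
      calc _ = r₁ * y * (r₁ * r₁) * e * r₁ - (r₁ * r₁) * e * r₁ := by noncomm_ring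
        _ = r₁ * (y * e) * r₁ - e * r₁ := by rw [h1]; noncomm_ring
        _ = _ := by rw [hye]
    have a3 : r₁ * e * r₁ * e = r₁ * e := by rw [mul_assoc, mul_assoc, ← mul_assoc e, hre]
    have a4 : e * (r₁ * e * r₁) = e * r₁ := by rw [← mul_assoc, ← mul_assoc, hre]
    calc _ = y * (r₁ * y * r₁ - r₁) + y * e + r₁ * e * r₁ * (r₁ * y * r₁ - r₁)
          + r₁ * e * r₁ * e := by noncomm_ring
      _ = (r₁ * y * r₁ - r₁) * y + e * y + (r₁ * y * r₁ - r₁) * (r₁ * e * r₁)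
          + e * (r₁ * e * r₁) := by rw [hy, hye, a1, a2, a3, a4]; abel
      _ = _ := by noncomm_ring
  have hz : r₃ * (l₁ * (y * k₁ + t₁)) * r₃ - r₃ = v * (r₁ * y * r₁ - r₁ + e) * u := by
    rw [hx, hr]
    calc _ = v * r₁ * (u * v) * (y + r₁ * e * r₁) * (u * v) * r₁ * u - v * r₁ * u := by
          noncomm_ring
      _ = v * (r₁ * y * r₁ + (r₁ * r₁) * e * (r₁ * r₁) - r₁) * u := by rw [huv]; noncomm_ring
      _ = _ := by rw [h1]; noncomm_ring
  rw [hz, hx]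
  calc _ = v * (y + r₁ * e * r₁) * (u * v) * (r₁ * y * r₁ - r₁ + e) * u := by noncomm_ring
    _ = v * ((y + r₁ * e * r₁) * (r₁ * y * r₁ - r₁ + e)) * u := by rw [huv]; noncomm_ring
    _ = v * (r₁ * y * r₁ - r₁ + e) * (u * v) * (y + r₁ * e * r₁) * u := by
        rw [key, huv]; noncomm_ring
    _ = _ := by noncomm_ring

end Abstract

end

end HDiff

/-! ### The exchange homomorphisms ρ and its dual -/

namespace HDiff

noncomputable section

open Matrix

variable {k : Type*} [CommRing k] {n : ℕ} {S : Type*} [Ring S] [Algebra k S]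

theorem spec3_map (c : Ubar k n →ₐ[k] S)
    (F : Fin n → Matrix (Fin n × Fin n) (Fin n × Fin n) (Ubar k n)) :
    (spec3 F).map c = spec3 fun i => (F i).map c := by
  ext r x; simp only [spec3, map_apply]; split_ifs <;> simp

theorem spec2_map (c : Ubar k n →ₐ[k] S)
    (F : Fin n → Matrix (Fin n × Fin n) (Fin n × Fin n) (Ubar k n)) :
    (spec2 F).map c = spec2 fun i => (F i).map c := by
  ext r x; simp only [spec2, map_apply]; split_ifs <;> simp

theorem spec2_add (F G : Fin n → Matrix (Fin n × Fin n) (Fin n × Fin n) S) :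
    spec2 F + spec2 G = spec2 fun i => F i + G i := by
  ext r x; simp only [spec2, Matrix.add_apply]; split_ifs <;> simp

theorem spec2_sub (F G : Fin n → Matrix (Fin n × Fin n) (Fin n × Fin n) S) :
    spec2 F - spec2 G = spec2 fun i => F i - G i := by
  ext r x; simp only [spec2, Matrix.sub_apply]; split_ifs <;> simp

theorem spec3_sub (F G : Fin n → Matrix (Fin n × Fin n) (Fin n × Fin n) S) :
    spec3 F - spec3 G = spec3 fun i => F i - G i := by
  ext r x; simp only [spec3, Matrix.sub_apply]; split_ifs <;> simp

/-- The map `p ↦ diag(p[w₁], …, p[wₙ])`. -/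
def diagC (c : Ubar k n →ₐ[k] S) (w : Fin n → Fin n → ℤ) :
    Ubar k n →ₐ[k] Matrix (Fin n) (Fin n) S :=
  (Matrix.diagonalAlgHom k).comp (AlgHom.pi fun i => c.comp (trans k (w i)))

theorem diagC_apply (c : Ubar k n →ₐ[k] S) (w : Fin n → Fin n → ℤ) (p : Ubar k n) :
    diagC c w p = Matrix.diagonal fun i => c (trans k (w i) p) := rfl

/-- The blocks of a matrix indexed by pairs. -/
def blockL (X : Matrix (Fin n × Fin n) (Fin n × Fin n) S) (m a : Fin n) :
    Matrix (Fin n) (Fin n) S := fun d l => X (a, d) (m, l)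

theorem compRingEquiv_mR (c : Ubar k n →ₐ[k] S) (w : Fin n → Fin n → ℤ) :
    Matrix.compRingEquiv (Fin n × Fin n) (Fin n) S (mR (diagC c w))
      = spec3 fun i => ((matR k n).map (trans k (w i))).map c := by
  ext ⟨r, i⟩ ⟨x, j⟩
  simp only [Matrix.compRingEquiv_apply, Matrix.comp_apply, mR, map_apply, diagC_apply, spec3,
    Matrix.diagonal_apply]

theorem compRingEquiv_mL (X : Matrix (Fin n × Fin n) (Fin n × Fin n) S) :
    Matrix.compRingEquiv (Fin n × Fin n) (Fin n) S (mL (blockL X)) = spec2 fun _ => X := by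
  ext ⟨⟨a, b⟩, d⟩ ⟨⟨m, b'⟩, l⟩
  simp only [Matrix.compRingEquiv_apply, Matrix.comp_apply, mL, spec2]
  split_ifs <;> rfl

/-- A matrix with entries in n × n matrices over S is a matrix over S with a third index. The
relations for the blocks thus become operator identities on three slots, where the third index
affects R̂ only through a translation. -/
theorem isRedSys_blockL (c : Ubar k n →ₐ[k] S) (w : Fin n → Fin n → ℤ)
    (X : Matrix (Fin n × Fin n) (Fin n × Fin n) S)
    (hX : HasWeight c (fun r => ew r.1 - w r.2) X) {R Y : Matrix (I3 n) (I3 n) S}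
    (hR : (spec3 fun i => ((matR k n).map (trans k (w i))).map c) = R)
    (hY : (spec2 fun _ => X) = Y) (h : Y * (R * Y * R - R) = (R * Y * R - R) * Y) :
    IsRedSys (diagC c w) (blockL X) := by
  constructor
  · intro p m a
    ext d l
    rw [diagC_apply, diagC_apply, Matrix.diagonal_mul, Matrix.mul_diagonal]
    simp only [blockL]
    rw [hX, trans_trans, trans_trans]
    refine congrArg (fun v => X (a, d) (m, l) * c (trans k v p)) ?_
    dsimp only
    abel
  · apply (Matrix.compRingEquiv (Fin n × Fin n) (Fin n) S).injective
    simp only [mY, map_mul, map_sub, compRingEquiv_mR, compRingEquiv_mL, hR, hY]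
    exact h

variable {c : Ubar k n →ₐ[k] S} {L : Fin n → Fin n → S}

theorem spec2_swap_mL_apply (i j l : Fin n) (x : I3 n) (M : Matrix (I3 n) (I3 n) S) :
    ((spec2 fun _ => (mL L).submatrix Prod.swap Prod.swap) * M) ((j, l), i) x
      = ∑ a, L a i * M ((j, l), a) x := by
  rw [spec2_mul_apply]
  simp [mL]

theorem mul_spec2_swap_mL_apply (i j l : Fin n) (x : I3 n) (M : Matrix (I3 n) (I3 n) S) :
    (M * (spec2 fun _ => (mL L).submatrix Prod.swap Prod.swap)) x ((j, l), i)
      = ∑ a, M x ((j, l), a) * L i a := by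
  simp only [Matrix.mul_apply, Fintype.sum_prod_type, mL, spec2, submatrix_apply, Prod.swap]
  simp only [mul_ite, mul_zero, Finset.sum_ite_irrel, Finset.sum_const_zero, Finset.sum_ite_eq',
    Finset.mem_univ, if_true]

theorem spec3_mL_mul_apply (i j l : Fin n) (x : I3 n) (M : Matrix (I3 n) (I3 n) S) :
    ((spec3 fun _ => mL L) * M) ((i, j), l) x = ∑ a, L a i * M ((a, j), l) x := by
  rw [spec3_mul_apply]
  simp [mL]

theorem mul_spec3_mL_apply (i j l : Fin n) (x : I3 n) (M : Matrix (I3 n) (I3 n) S) :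
    (M * (spec3 fun _ => mL L)) x ((i, j), l) = ∑ a, M x ((a, j), l) * L i a := by
  simp only [Matrix.mul_apply, Fintype.sum_prod_type, mL, spec3]
  simp

/-- L changes the index of the first strand, and with it the translation of R̂ on the other two;
this is exactly the change of a coefficient that moves past L. The same reason gives
`IsRedSys.spec3_commute`. -/
theorem IsRedSys.spec2_commute (h : IsRedSys c L) :
    (spec2 fun _ => (mL L).submatrix Prod.swap Prod.swap) * (matR2 k n).map c
      = (matR2 k n).map c * spec2 fun _ => (mL L).submatrix Prod.swap Prod.swap := by
  ext ⟨⟨j, l⟩, i⟩ ⟨⟨j', l'⟩, i'⟩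
  rw [spec2_swap_mL_apply, mul_spec2_swap_mL_apply]
  simp only [matR2, map_apply, apply_ite c, map_zero, mul_ite, mul_zero, ite_mul, zero_mul,
    Finset.sum_ite_eq, Finset.sum_ite_eq', Finset.mem_univ, if_true]
  rw [h.weight, trans_trans]
  congr 3; abel_nf

theorem IsRedSys.spec3_commute (h : IsRedSys c L)
    (M : Matrix (Fin n × Fin n) (Fin n × Fin n) (Ubar k n)) :
    (spec3 fun _ => mL L) * (spec1 fun i => M.map (trans k (-ew i))).map c
      = (spec1 fun i => M.map (trans k (-ew i))).map c * spec3 fun _ => mL L := by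
  ext ⟨⟨i, j⟩, l⟩ ⟨⟨i', j'⟩, l'⟩
  rw [spec3_mL_mul_apply, mul_spec3_mL_apply]
  simp only [spec1, map_apply, apply_ite c, map_zero, mul_ite, mul_zero, ite_mul, zero_mul,
    Finset.sum_ite_eq, Finset.sum_ite_eq', Finset.mem_univ, if_true]
  rw [h.weight, trans_trans]
  congr 3; abel_nf

theorem map_mul_comp {I : Type*} [Fintype I] (c : Ubar k n →ₐ[k] S) (M N : Matrix I I (Ubar k n)) :
    M.map c * N.map c = (M * N).map c := (Matrix.map_mul (f := c.toRingHom)).symm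

theorem matT2_eq : matT2 k n = spec1 fun i => (matT k n).map (trans k (-ew i)) := by
  have : ∀ i : Fin n, (matT k n).map (trans k (-ew i)) = matT k n := by
    intro i; ext r x; simp only [matT, map_apply]; split_ifs <;> simp
  simp only [this]; rfl

theorem spec2_swap_mY : (spec2 fun _ => (mY c L).submatrix Prod.swap Prod.swap)
    = (matR1 k n).map c * (spec2 fun _ => (mL L).submatrix Prod.swap Prod.swap)
      * (matR1 k n).map c - (matR1 k n).map c := by
  have e : ∀ A B : Matrix (Fin n × Fin n) (Fin n × Fin n) S,
      A.submatrix Prod.swap Prod.swap * B.submatrix Prod.swap Prod.swap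
        = (A * B).submatrix Prod.swap Prod.swap :=
    fun A B => Matrix.submatrix_mul_equiv A B _ (Equiv.prodComm _ _) _
  rw [matR1_eq, spec2_map]
  simp only [← Matrix.submatrix_map]
  rw [spec2_mul, spec2_mul, spec2_sub]
  simp only [e]
  rfl

/-- An instance of `jucysMurphy_commute`, with y the matrix L on the first strand. The second
identity is the reflection equation for Y, so that L ↦ Y extends to ρ; the first one is the case of
a generator L in `rho_rho`. -/
theorem IsRedSys.third (h : IsRedSys c L) :
    (matR1 k n).map c * ((matR2 k n).map c * (spec2 fun _ => (mY c L).submatrix Prod.swap Prod.swap)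
      * (matR2 k n).map c - (matR2 k n).map c)
    = ((matR2 k n).map c * (spec2 fun _ => (mY c L).submatrix Prod.swap Prod.swap)
      * (matR2 k n).map c - (matR2 k n).map c) * (matR1 k n).map c ∧
    (spec2 fun _ => (mY c L).submatrix Prod.swap Prod.swap) *
      ((matR2 k n).map c * (spec2 fun _ => (mY c L).submatrix Prod.swap Prod.swap)
      * (matR2 k n).map c - (matR2 k n).map c)
    = ((matR2 k n).map c * (spec2 fun _ => (mY c L).submatrix Prod.swap Prod.swap)
      * (matR2 k n).map c - (matR2 k n).map c) *
      (spec2 fun _ => (mY c L).submatrix Prod.swap Prod.swap) := by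
  have e : ∀ A B : Matrix (Fin n × Fin n) (Fin n × Fin n) S,
      A.submatrix Prod.swap Prod.swap * B.submatrix Prod.swap Prod.swap
        = (A * B).submatrix Prod.swap Prod.swap :=
    fun A B => Matrix.submatrix_mul_equiv A B _ (Equiv.prodComm _ _) _
  have hy : (spec2 fun _ => (mL L).submatrix Prod.swap Prod.swap) *
      (spec2 fun _ => (mY c L).submatrix Prod.swap Prod.swap)
      = (spec2 fun _ => (mY c L).submatrix Prod.swap Prod.swap) *
        (spec2 fun _ : Fin n => (mL L).submatrix Prod.swap Prod.swap) := by
    rw [spec2_mul, spec2_mul]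
    simp only [e, h.reflection]
  rw [spec2_swap_mY] at hy ⊢
  refine jucysMurphy_commute (mapMatrix_trans_comp c (matR1_sq k)) ?_ h.spec2_commute hy
  simp only [map_mul_comp, matR_braid]

theorem IsRedSys.isRedSys_rho (h : IsRedSys c L) : IsRedSys (diagC c fun i => -ew i)
    (blockL ((mY c L).submatrix Prod.swap Prod.swap)) := by
  refine isRedSys_blockL c _ _ ?_ (R := (matR2 k n).map c) ?_ rfl h.third.2
  · rintro p ⟨a, d⟩ ⟨m, l⟩
    have := h.hasWeight_mY p (d, a) (l, m)
    simp only [submatrix_apply, Prod.swap]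
    rw [this]
    congr 3; simp only [wtVV]; abel_nf
  · rw [matR2_eq, spec3_map]

/-- The rotated matrix `K⁻¹ (L₁ K + T)`. -/
def mX (c : Ubar k n →ₐ[k] S) (L : Fin n → Fin n → S) :
    Matrix (Fin n × Fin n) (Fin n × Fin n) S :=
  (matKi k n).map c * (mL L * (matK k n).map c + (matT k n).map c)

theorem spec3_mL_eq : (spec3 fun _ => mL L) = (spec2 fun _ => mL L) := by
  ext ⟨⟨a, b⟩, d⟩ ⟨⟨a', b'⟩, d'⟩
  simp only [spec3, spec2, mL]
  split_ifs <;> rfl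

/-- An instance of `jucysMurphy_dual_commute`: y is L on the vector strand, the k's are rotated
crossings, the t's are cap-cup pairs, and `matJ` is the slid one. -/
theorem IsRedSys.isRedSys_rhoDual (h : IsRedSys c L) : IsRedSys (diagC c ew)
    (blockL (mX c L)) := by
  have e3 : (spec2 fun _ : Fin n => mX c L) = (matKi1 k n).map c *
      ((spec3 fun _ => mL L) * (matK1 k n).map c + (matT1 k n).map c) := by
    rw [spec3_mL_eq, matKi1, matK1, matT1, spec2_map, spec2_map, spec2_map, spec2_mul, spec2_add,
      spec2_mul]
    rfl
  refine isRedSys_blockL c _ _ ?_ (R := (matE3 k n).map c) ?_ e3 ?_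
  · exact (hasWeight_matKi c).mul (((h.hasWeight_mL fun i j l => by simp [wtVD]).mul
      (hasWeight_matK c)).add (hasWeight_matT c))
  · rw [matE3, spec3_map]
  · have hy : (spec3 fun _ => mL L) * ((matE1 k n).map c * (spec3 fun _ => mL L) * (matE1 k n).map c
        - (matE1 k n).map c) = ((matE1 k n).map c * (spec3 fun _ => mL L) * (matE1 k n).map c
        - (matE1 k n).map c) * (spec3 fun _ : Fin n => mL L) := by
      have := h.reflection
      rw [matE1, spec3_map, spec3_mul, spec3_mul, spec3_sub, spec3_mul, spec3_mul]
      exact congrArg spec3 (funext fun _ => this)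
    refine jucysMurphy_dual_commute (j := (matJ k n).map c) (k₂ := (matK2 k n).map c)
      (l₂ := (matKi2 k n).map c) (t₂ := (matT2 k n).map c)
      (mapMatrix_trans_comp c (matE1_sq k n)) (mapMatrix_trans_comp c (matE3_sq k n))
      (mapMatrix_trans_comp c (matK1_mul_matKi1 k n))
      (mapMatrix_trans_comp c (matKi1_mul_matK1 k n))
      (mapMatrix_trans_comp c (matK2_mul_matKi2 k n))
      (mapMatrix_trans_comp c (matKi2_mul_matK2 k n)) ?_ ?_ ?_ ?_ ?_ ?_ hy
    · simp only [map_mul_comp, matK_braid]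
    · simp only [map_mul_comp, matT1_mul_matE3]
    · simp only [map_mul_comp, matE1_mul_matT2]
    · simp only [map_mul_comp, matT2_mul_matJ]
    · exact h.spec3_commute (matK k n)
    · rw [matT2_eq]; exact h.spec3_commute (matT k n)

variable (k n) in
/-- The exchange homomorphism `ρ`: moving `Z` from left to right, `Zⁱ x = ∑ ρ(x)ⁱₐ Zᵃ`. -/
def rho : Red k n →ₐ[k] Matrix (Fin n) (Fin n) (Red k n) :=
  redLift _ _ (isRedSys_red k n).isRedSys_rho

variable (k n) in
/-- The exchange homomorphism for the inverse matrix of `Z`. -/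
def rhoDual : Red k n →ₐ[k] Matrix (Fin n) (Fin n) (Red k n) :=
  redLift _ _ (isRedSys_red k n).isRedSys_rhoDual

theorem rho_rC (p : Ubar k n) (i a : Fin n) :
    rho k n (rC k n p) i a = if i = a then rC k n (trans k (-ew i) p) else 0 := by
  rw [rho, redLift_rC, diagC_apply, Matrix.diagonal_apply]

theorem rho_rL (l j i d : Fin n) :
    rho k n (rL k n l j) i d = mY (rC k n) (rL k n) (i, j) (d, l) := by
  rw [rho, redLift_rL]; rfl

theorem rhoDual_rC (p : Ubar k n) (i a : Fin n) :
    rhoDual k n (rC k n p) i a = if i = a then rC k n (trans k (ew i) p) else 0 := by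
  rw [rhoDual, redLift_rC, diagC_apply, Matrix.diagonal_apply]

theorem rhoDual_rL (m a d l : Fin n) :
    rhoDual k n (rL k n m a) d l = mX (rC k n) (rL k n) (a, d) (m, l) := by
  rw [rhoDual, redLift_rL]; rfl

end

end HDiff

/-! ### Mutual inversion of the exchange homomorphisms, and the R̂-relation for ρ applied twice -/

namespace HDiff

noncomputable section

open Matrix

variable {k : Type*} [CommRing k] {n : ℕ} {S : Type*} [Ring S] [Algebra k S]

theorem trans_matK (j p a d : Fin n) (w : Fin n → ℤ) :
    trans k w (matK k n (j, p) (a, d)) = trans k (w + ew d) (Rhat k n d j a p) := by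
  simp only [matK, trans_trans]

theorem mL_mul_matK_add_matT_apply (c : Ubar k n →ₐ[k] S) (L : Fin n → Fin n → S)
    (q p m a : Fin n) : (mL L * (matK k n).map c + (matT k n).map c) (q, p) (m, a)
      = ∑ t, L t q * c (matK k n (t, p) (m, a)) + if q = p ∧ m = a then 1 else 0 := by
  rw [Matrix.add_apply, mL_mul_apply]
  simp only [map_apply, matT, apply_ite c, map_one, map_zero]

theorem mR_mul_mY (c : Ubar k n →ₐ[k] S) (L : Fin n → Fin n → S) :
    mY c L * mR c = mR c * mL L - 1 := by
  rw [mY, sub_mul, mul_assoc, mR_sq, mul_one]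

theorem matK_mul_mX (c : Ubar k n →ₐ[k] S) (L : Fin n → Fin n → S) :
    (matK k n).map c * mX c L = mL L * (matK k n).map c + (matT k n).map c := by
  rw [mX, ← mul_assoc, mapMatrix_trans_comp c (matK_mul_matKi k n), one_mul]

/-- In the image of KX = L₁K + T under ρ, the identity YR̂ = R̂L₁ - 1 makes T cancel. What is left
is R̂L₁, whose R̂ is a translate of K and cancels the factor K⁻¹ of X. -/
theorem rho_rhoDual_rL (m b j i : Fin n) :
    ∑ a, rho k n (rhoDual k n (rL k n m b) j a) i a = if i = j then rL k n m b else 0 := by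
  have hG : ∀ q p, ∑ a, rho k n ((mL (rL k n) * (matK k n).map (rC k n) + (matT k n).map (rC k n))
      (q, p) (m, a)) i a = ∑ x, rC k n (Rhat k n i q x p) * rL k n m x := by
    intro q p
    have e1 : ∀ a, rho k n ((mL (rL k n) * (matK k n).map (rC k n) + (matT k n).map (rC k n))
        (q, p) (m, a)) i a = ∑ t, mY (rC k n) (rL k n) (i, q) (a, t) * rC k n (Rhat k n a t m p)
          + if i = a then if q = p ∧ m = a then 1 else 0 else 0 := by
      intro a
      rw [mL_mul_matK_add_matT_apply, map_add, map_sum, Matrix.add_apply, Matrix.sum_apply]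
      congr 1
      · refine Finset.sum_congr rfl fun t _ => ?_
        rw [map_mul, Matrix.mul_apply]
        simp only [rho_rC, rho_rL, mul_ite, mul_zero, Finset.sum_ite_eq', Finset.mem_univ, if_true]
        rw [trans_matK, neg_add_cancel, trans_zero]
      · split_ifs <;> simp_all
    simp only [e1, Finset.sum_add_distrib, Finset.sum_ite_eq, Finset.mem_univ, if_true]
    have e2 := congrFun (congrFun (mR_mul_mY (rC k n) (rL k n)) (i, q)) (m, p)
    rw [Matrix.mul_apply, Fintype.sum_prod_type, Matrix.sub_apply, mul_mL_apply] at e2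
    simp only [mR, matR, map_apply] at e2 ⊢
    rw [e2, Matrix.one_apply, sub_add]
    simp only [Prod.mk.injEq]
    rw [sub_eq_self, sub_eq_zero]
    congr 1
    simp only [eq_iff_iff]; constructor <;> rintro ⟨rfl, rfl⟩ <;> exact ⟨rfl, rfl⟩
  have e1 : ∀ a, rho k n (rhoDual k n (rL k n m b) j a) i a = ∑ q, ∑ p,
      rC k n (trans k (-ew i) (matKi k n (b, j) (q, p))) *
      rho k n ((mL (rL k n) * (matK k n).map (rC k n) + (matT k n).map (rC k n))
        (q, p) (m, a)) i a := by
    intro a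
    rw [rhoDual_rL, mX, Matrix.mul_apply, Fintype.sum_prod_type]
    simp only [map_sum, map_mul, Matrix.sum_apply, Matrix.mul_apply (M := rho k n _), map_apply,
      rho_rC, ite_mul, zero_mul, Finset.sum_ite_eq, Finset.mem_univ, if_true]
  simp only [e1]
  rw [Finset.sum_comm, Finset.sum_congr rfl fun q _ => Finset.sum_comm]
  simp only [← Finset.mul_sum, hG]
  have e2 : ∀ x, ∑ q, ∑ p, rC k n (trans k (-ew i) (matKi k n (b, j) (q, p))) *
      rC k n (Rhat k n i q x p) = if b = x ∧ j = i then 1 else 0 := by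
    intro x
    have := congrArg (fun M => rC k n (trans k (-ew i) (M (b, j) (x, i)))) (matKi_mul_matK k n)
    simp only [Matrix.mul_apply, Fintype.sum_prod_type, map_sum, map_mul, trans_matK,
      neg_add_cancel, trans_zero, Matrix.one_apply, apply_ite (trans k (-ew i)),
      apply_ite (rC k n), map_one, map_zero, Prod.mk.injEq] at this
    exact this
  simp only [Finset.mul_sum, ← mul_assoc]
  rw [Finset.sum_congr rfl fun q _ => Finset.sum_comm, Finset.sum_comm]
  simp only [← Finset.sum_mul, e2]
  by_cases h : i = j
  · simp [h]
  · simp [h, Ne.symm h]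

/-- Here the factor R̂ on the left of Y = R̂L₁R̂ - R̂ meets X as K does, and KX = L₁K + T applies.
The term T cancels -R̂, and R̂² = 1 finishes. -/
theorem rhoDual_rho_rL (m b a l : Fin n) :
    ∑ i, rhoDual k n (rho k n (rL k n m b) i a) i l = if a = l then rL k n m b else 0 := by
  have e1 : ∀ i, rhoDual k n (rho k n (rL k n m b) i a) i l = ∑ t, ∑ y, (∑ x,
      rC k n (matK k n (b, y) (x, i)) * mX (rC k n) (rL k n) (x, i) (t, l)) *
        rC k n (trans k (ew l) (Rhat k n t y a m)) -
      if i = l then rC k n (trans k (ew i) (Rhat k n i b a m)) else 0 := by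
    intro i
    rw [rho_rL, mY, mul_assoc, Matrix.sub_apply, map_sub, Matrix.sub_apply]
    congr 1
    · rw [Matrix.mul_apply, Fintype.sum_prod_type]
      simp only [mL_mul_apply, Finset.mul_sum, Finset.sum_mul, map_sum, map_mul, Matrix.sum_apply,
        mR, map_apply, matR]
      simp only [Matrix.mul_apply, rhoDual_rC, rhoDual_rL, ite_mul, zero_mul,
        mul_ite, mul_zero, Finset.sum_ite_eq, Finset.sum_ite_eq', Finset.mem_univ, if_true, matK,
        mul_assoc]
      rw [Finset.sum_congr rfl fun x _ => Finset.sum_comm, Finset.sum_comm]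
      exact Finset.sum_congr rfl fun t _ => Finset.sum_comm
    · simp only [mR, map_apply, matR, rhoDual_rC]
  simp only [e1, Finset.sum_sub_distrib, Finset.sum_ite_eq', Finset.mem_univ, if_true]
  rw [Finset.sum_comm, Finset.sum_congr rfl fun t _ => Finset.sum_comm]
  simp only [← Finset.sum_mul]
  have e2 : ∀ t y, ∑ i, ∑ x, rC k n (matK k n (b, y) (x, i)) * mX (rC k n) (rL k n) (x, i) (t, l)
      = ∑ z, rL k n z b * rC k n (matK k n (z, y) (t, l)) + if b = y ∧ t = l then 1 else 0 := by
    intro t y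
    have := congrFun (congrFun (matK_mul_mX (rC k n) (rL k n)) (b, y)) (t, l)
    rw [mL_mul_matK_add_matT_apply, Matrix.mul_apply, Fintype.sum_prod_type,
      Finset.sum_comm] at this
    exact this
  simp only [e2, add_mul, Finset.sum_add_distrib, ite_mul, zero_mul, one_mul, ite_and,
    Finset.sum_ite_eq, Finset.mem_univ, if_true, Finset.sum_ite_eq', add_sub_cancel_right]
  have e3 : ∀ z, ∑ t, ∑ y, rC k n (matK k n (z, y) (t, l)) *
      rC k n (trans k (ew l) (Rhat k n t y a m)) = if l = a ∧ z = m then 1 else 0 := by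
    intro z
    have := congrArg (fun M => rC k n (trans k (ew l) (M (l, z) (a, m)))) (matR_sq k (n := n))
    simp only [Matrix.mul_apply, Fintype.sum_prod_type, map_sum, map_mul,
      Matrix.one_apply, apply_ite (trans k (ew l)),
      apply_ite (rC k n), map_one, map_zero, Prod.mk.injEq] at this
    exact this
  simp only [Finset.sum_mul, mul_assoc]
  rw [Finset.sum_congr rfl fun q _ => Finset.sum_comm, Finset.sum_comm]
  simp only [← Finset.mul_sum, e3]
  by_cases h : a = l
  · simp [h]
  · simp [h, Ne.symm h]

/-- For a product the two inner sums collapse one after the other, because both maps are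
homomorphisms. It is therefore enough to treat generators. -/
theorem rho_rhoDual (x : Red k n) (j i : Fin n) :
    ∑ a, rho k n (rhoDual k n x j a) i a = if i = j then x else 0 := by
  induction x using red_induction generalizing i j with
  | coef p =>
    have : ∀ a, rho k n (rhoDual k n (rC k n p) j a) i a = if j = a then if i = a then rC k n p
        else 0 else 0 := by
      intro a
      rw [rhoDual_rC]
      split_ifs with h1 h2
      · subst h1 h2; rw [rho_rC, if_pos rfl, trans_trans, neg_add_cancel, trans_zero]
      · rw [rho_rC, if_neg h2]
      · rw [map_zero, Matrix.zero_apply]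
    simp only [this, Finset.sum_ite_eq, Finset.mem_univ, if_true]
  | L m b => exact rho_rhoDual_rL m b j i
  | add x y hx hy =>
    simp only [map_add, Matrix.add_apply, Finset.sum_add_distrib, hx, hy]
    split_ifs <;> simp
  | mul x y hx hy =>
    simp only [map_mul, Matrix.mul_apply, map_sum, Matrix.sum_apply]
    rw [Finset.sum_comm]
    have : ∀ l, ∑ a, ∑ b, rho k n (rhoDual k n x j l) i b * rho k n (rhoDual k n y l a) b a
        = rho k n (rhoDual k n x j l) i l * y := by
      intro l
      rw [Finset.sum_comm]
      simp only [← Finset.mul_sum, hy]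
      simp
    simp only [this, ← Finset.sum_mul, hx]
    split_ifs <;> simp

theorem rhoDual_rho (x : Red k n) (a l : Fin n) :
    ∑ i, rhoDual k n (rho k n x i a) i l = if a = l then x else 0 := by
  induction x using red_induction generalizing a l with
  | coef p =>
    have : ∀ i, rhoDual k n (rho k n (rC k n p) i a) i l = if i = a then if i = l then rC k n p
        else 0 else 0 := by
      intro i
      rw [rho_rC]
      split_ifs with h1 h2
      · subst h1 h2; rw [rhoDual_rC, if_pos rfl, trans_trans, add_neg_cancel, trans_zero]
      · rw [rhoDual_rC, if_neg h2]
      · rw [map_zero, Matrix.zero_apply]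
    simp only [this, Finset.sum_ite_eq', Finset.mem_univ, if_true]
  | L m b => exact rhoDual_rho_rL m b a l
  | add x y hx hy =>
    simp only [map_add, Matrix.add_apply, Finset.sum_add_distrib, hx, hy]
    split_ifs <;> simp
  | mul x y hx hy =>
    simp only [map_mul, Matrix.mul_apply, map_sum, Matrix.sum_apply]
    rw [Finset.sum_comm]
    have : ∀ b, ∑ i, ∑ m, rhoDual k n (rho k n x i b) i m * rhoDual k n (rho k n y b a) m l
        = x * rhoDual k n (rho k n y b a) b l := by
      intro b
      rw [Finset.sum_comm]
      simp only [← Finset.sum_mul, hx]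
      simp
    simp only [this, ← Finset.mul_sum, hy]
    split_ifs <;> simp

/-- The elements for which ρ applied twice commutes with R̂ are closed under sums and products.
Coefficients belong to them by conservation of weight, and L does by the first identity of
`IsRedSys.third`. -/
theorem rho_rho (x : Red k n) (i j a b : Fin n) :
    ∑ u, ∑ v, rC k n (Rhat k n i j u v) * rho k n (rho k n x v b) u a
      = ∑ u, ∑ v, rho k n (rho k n x j v) i u * rC k n (Rhat k n u v a b) := by
  let ρ₂ : Red k n →+* Matrix (Fin n × Fin n) (Fin n × Fin n) (Red k n) :=
    ((Matrix.compRingEquiv (Fin n) (Fin n) (Red k n)).toRingHom.comp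
      (rho k n).toRingHom.mapMatrix).comp (rho k n).toRingHom
  have hρ : ∀ x j i b a, ρ₂ x (j, i) (b, a) = rho k n (rho k n x j b) i a := fun _ _ _ _ _ => rfl
  let R : Matrix (Fin n × Fin n) (Fin n × Fin n) (Red k n) :=
    (mR (rC k n)).submatrix Prod.swap Prod.swap
  have key : R * ρ₂ x = ρ₂ x * R := by
    induction x using red_induction with
    | coef p =>
      ext ⟨j, i⟩ ⟨b, a⟩
      have e : ∀ j i b a, ρ₂ (rC k n p) (j, i) (b, a)
          = if b = j ∧ a = i then rC k n (trans k (-ew i - ew j) p) else 0 := by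
        intro j i b a
        rw [hρ, rho_rC]
        by_cases h1 : b = j
        · subst h1; simp only [if_true, rho_rC, trans_trans, true_and, eq_comm, ← sub_eq_add_neg]
        · simp [h1, Ne.symm h1]
      rw [Matrix.mul_apply, Matrix.mul_apply, Fintype.sum_prod_type, Fintype.sum_prod_type]
      simp only [e, R, submatrix_apply, Prod.swap, mR, map_apply, matR, ite_and, mul_ite, mul_zero,
        ite_mul, zero_mul, Finset.sum_ite_eq, Finset.sum_ite_eq', Finset.mem_univ, if_true,
        Finset.sum_ite_irrel, Finset.sum_const_zero]
      rw [← map_mul, ← map_mul]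
      by_cases hw : ew i + ew j = ew a + ew b
      · have : -ew a - ew b = -ew i - ew j := by linear_combination hw
        rw [this, mul_comm]
      · simp [Rhat_weight k hw]
    | L l m =>
      -- Since ρ is a homomorphism, it sends the entries of Y to the same expression in the images
      -- of R̂ and L. This makes the second iterate of L the third Jucys-Murphy element.
      have hz : ∀ j i b a, ρ₂ (rL k n l m) (j, i) (b, a) =
          ((matR2 k n).map (rC k n) * (spec2 fun _ => (mY (rC k n) (rL k n)).submatrix Prod.swap
            Prod.swap) * (matR2 k n).map (rC k n) - (matR2 k n).map (rC k n)) ((j, m), i)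
            ((b, l), a) := by
        intro j i b a
        have e1 : (rho k n).toRingHom.mapMatrix (mY (rC k n) (rL k n))
            = mY (diagC (rC k n) fun i => -ew i)
              (blockL ((mY (rC k n) (rL k n)).submatrix Prod.swap Prod.swap)) := by
          have e2 : (rho k n).toRingHom.mapMatrix (mR (rC k n))
              = mR (diagC (rC k n) fun i => -ew i) := by
            refine Matrix.ext fun r x => ?_
            exact redLift_rC _ _ _ _
          have e3 : (rho k n).toRingHom.mapMatrix (mL (rL k n))
              = mL (blockL ((mY (rC k n) (rL k n)).submatrix Prod.swap Prod.swap)) := by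
            refine Matrix.ext fun r x => ?_
            simp only [RingHom.mapMatrix_apply, map_apply, mL]
            split_ifs
            · exact redLift_rL _ _ _ _ _
            · exact map_zero _
          simp only [mY, map_sub, map_mul, e2, e3]
        have e4 := congrArg (Matrix.compRingEquiv (Fin n × Fin n) (Fin n) (Red k n))
          (e1.trans (mY.eq_1 _ _))
        rw [map_sub (Matrix.compRingEquiv _ _ _), map_mul (Matrix.compRingEquiv _ _ _),
          map_mul (Matrix.compRingEquiv _ _ _), compRingEquiv_mR, compRingEquiv_mL] at e4
        have e5 := congrFun (congrFun e4 ((j, m), i)) ((b, l), a)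
        rw [matR2_eq, spec3_map, ← e5, hρ, rho_rL]
        rfl
      have h := (isRedSys_red k n).third.1
      ext ⟨j, i⟩ ⟨b, a⟩
      have h' := congrFun (congrFun h ((j, m), i)) ((b, l), a)
      rw [matR1_eq, spec2_map, spec2_mul_apply, Matrix.mul_apply (N := spec2 _),
        Fintype.sum_prod_type, Fintype.sum_prod_type] at h'
      simp only [← hz, spec2, mul_ite, mul_zero, Finset.sum_ite_irrel, Finset.sum_const_zero,
        Finset.sum_ite_eq', Finset.mem_univ, if_true] at h'
      rw [Matrix.mul_apply, Matrix.mul_apply, Fintype.sum_prod_type, Fintype.sum_prod_type]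
      exact h'
    | add x y hx hy => rw [map_add, mul_add, add_mul, hx, hy]
    | mul x y hx hy => rw [map_mul, ← mul_assoc, hx, mul_assoc, hy, mul_assoc]
  have := congrFun (congrFun key (j, i)) (b, a)
  rw [Matrix.mul_apply, Matrix.mul_apply, Fintype.sum_prod_type, Fintype.sum_prod_type,
    Finset.sum_comm, Finset.sum_comm (f := fun x y => ρ₂ _ _ (x, y) * _)] at this
  exact this

end

end HDiff

/-! ### The presentation of Diff_h(n,N), and the homomorphism τ -/

namespace HDiff

noncomputable section

open Matrix

variable {k : Type*} [CommRing k] {n N : ℕ} {S : Type*} [Ring S] [Algebra k S]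

/-- The data of a homomorphism from the ring of `h`-deformed differential operators. -/
structure IsDiffSys (c : Ubar k n →ₐ[k] S) (Z d : Fin n → Fin N → S) : Prop where
  weight_Z : ∀ p j α, c p * Z j α = Z j α * c (trans k (ew j) p)
  weight_d : ∀ p j α, c p * d j α = d j α * c (trans k (-ew j) p)
  Z_Z : ∀ i j α β, Z i α * Z j β = ∑ a, ∑ b, c (Rhat k n i j a b) * (Z a β * Z b α)
  d_d : ∀ i j α β, d i α * d j β = ∑ a, ∑ b, d a β * d b α * c (Rhat k n b a j i)
  Z_d : ∀ i j α β, Z i α * d j β = (∑ a, ∑ b, d a β * (c (Rhat k n a i b j) * Z b α))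
    - if α = β ∧ i = j then 1 else 0

section DiffAlgebra

variable (k n N) in
/-- The homomorphism from `Ū(h)` to the ring of `h`-deformed differential operators. -/
def dC : Ubar k n →ₐ[k] Diff k n N where
  toFun := dCoef k n N
  map_one' := by
    have := RingQuot.mkAlgHom_rel k (DiffRel.coef_scalar (k := k) (n := n) (N := N) 1)
    simpa [dCoef] using this
  map_mul' p q := by
    have := RingQuot.mkAlgHom_rel k (DiffRel.coef_mul (k := k) (n := n) (N := N) p q)
    simpa [dCoef] using this
  map_zero' := by
    have := RingQuot.mkAlgHom_rel k (DiffRel.coef_scalar (k := k) (n := n) (N := N) 0)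
    simpa [dCoef] using this
  map_add' p q := by
    have := RingQuot.mkAlgHom_rel k (DiffRel.coef_add (k := k) (n := n) (N := N) p q)
    simpa [dCoef] using this
  commutes' a := by
    have := RingQuot.mkAlgHom_rel k (DiffRel.coef_scalar (k := k) (n := n) (N := N) a)
    simpa only [dCoef, AlgHom.commutes] using this

theorem dC_apply (p : Ubar k n) : dC k n N p = dCoef k n N p := rfl

theorem diff_induction {P : Diff k n N → Prop} (coef : ∀ p, P (dC k n N p))
    (Z : ∀ i α, P (dZ k n N i α)) (d : ∀ i α, P (dd k n N i α))
    (add : ∀ x y, P x → P y → P (x + y)) (mul : ∀ x y, P x → P y → P (x * y)) (x : Diff k n N) :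
    P x := by
  obtain ⟨y, rfl⟩ := RingQuot.mkAlgHom_surjective k (DiffRel k n N) x
  induction y using FreeAlgebra.induction with
  | grade0 r =>
    rw [AlgHom.commutes, ← (dC k n N).commutes]
    exact coef _
  | grade1 x => cases x with
    | coef p => exact coef p
    | Z i α => exact Z i α
    | d i α => exact d i α
  | mul a b ha hb => rw [map_mul]; exact mul _ _ ha hb
  | add a b ha hb => rw [map_add]; exact add _ _ ha hb

theorem diff_algHom_ext {f g : Diff k n N →ₐ[k] S} (hC : ∀ p, f (dC k n N p) = g (dC k n N p))
    (hZ : ∀ i α, f (dZ k n N i α) = g (dZ k n N i α))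
    (hd : ∀ i α, f (dd k n N i α) = g (dd k n N i α)) : f = g :=
  AlgHom.ext <| diff_induction hC hZ hd (fun x y hx hy => by rw [map_add, map_add, hx, hy])
    (fun x y hx hy => by rw [map_mul, map_mul, hx, hy])

theorem coef_mul_d_d {c : Ubar k n →ₐ[k] S} {d : Fin n → Fin N → S}
    (weight_d : ∀ p j α, c p * d j α = d j α * c (trans k (-ew j) p)) (i j a b : Fin n)
    (α β : Fin N) :
    c (Rhat k n b a j i) * d a β * d b α = d a β * d b α * c (Rhat k n b a j i) := by
  rw [weight_d, mul_assoc, weight_d, trans_trans, ← mul_assoc]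
  have := trans_Rhat_weight k 0 b a j i
  rw [trans_zero, zero_sub] at this
  rw [← sub_eq_add_neg, this]

theorem coef_mul_d {c : Ubar k n →ₐ[k] S} {d : Fin n → Fin N → S}
    (weight_d : ∀ p j α, c p * d j α = d j α * c (trans k (-ew j) p)) (p : Ubar k n) (a : Fin n)
    (β : Fin N) : c (shift k n a p) * d a β = d a β * c p := by
  rw [weight_d, shift_eq_trans, trans_trans, neg_add_cancel, trans_zero]

variable (k n N) in
theorem isDiffSys_diff : IsDiffSys (dC k n N) (dZ k n N) (dd k n N) := by
  have weight_Z : ∀ p j α, dC k n N p * dZ k n N j α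
      = dZ k n N j α * dC k n N (trans k (ew j) p) := by
    intro p j α
    refine ubar_intertwine (dC k n N) ((dC k n N).comp (trans k (ew j))) _ (fun m => ?_) p
    have := RingQuot.mkAlgHom_rel k (DiffRel.weight_Z (k := k) (n := n) (N := N) m j α)
    simp only [map_mul, map_add, apply_ite (RingQuot.mkAlgHom k (DiffRel k n N)), map_one,
      map_zero] at this
    rw [AlgHom.comp_apply, trans_hh, map_add, map_intCast]
    refine Eq.trans this ?_
    change dZ k n N j α * (dC k n N (hh k n m) + _) = _
    congr 2
    simp [Pi.single_apply]
  have weight_d : ∀ p j α, dC k n N p * dd k n N j α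
      = dd k n N j α * dC k n N (trans k (-ew j) p) := by
    intro p j α
    refine ubar_intertwine (dC k n N) ((dC k n N).comp (trans k (-ew j))) _ (fun m => ?_) p
    have := RingQuot.mkAlgHom_rel k (DiffRel.weight_d (k := k) (n := n) (N := N) m j α)
    simp only [map_mul, map_sub, apply_ite (RingQuot.mkAlgHom k (DiffRel k n N)), map_one,
      map_zero] at this
    rw [AlgHom.comp_apply, trans_hh, map_add, map_intCast]
    refine Eq.trans this ?_
    rw [sub_eq_add_neg]
    change dd k n N j α * (dC k n N (hh k n m) + _) = _
    congr 2
    simp only [Pi.neg_apply, Pi.single_apply]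
    split_ifs <;> simp
  refine ⟨weight_Z, weight_d, fun i j α β => ?_, fun i j α β => ?_, fun i j α β => ?_⟩
  · have := RingQuot.mkAlgHom_rel k (DiffRel.Z_Z (k := k) (n := n) (N := N) i j α β)
    simp only [map_mul, map_sum, mul_assoc] at this
    exact this
  · have := RingQuot.mkAlgHom_rel k (DiffRel.d_d (k := k) (n := n) (N := N) i j α β)
    simp only [map_mul, map_sum] at this
    refine Eq.trans this (Finset.sum_congr rfl fun a _ => Finset.sum_congr rfl fun b _ => ?_)
    exact coef_mul_d_d weight_d i j a b α β
  · have := RingQuot.mkAlgHom_rel k (DiffRel.Z_d (k := k) (n := n) (N := N) i j α β)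
    simp only [map_mul, map_sum, map_sub, apply_ite (RingQuot.mkAlgHom k (DiffRel k n N)), map_one,
      map_zero] at this
    refine Eq.trans this (congrArg (· - _)
      (Finset.sum_congr rfl fun a _ => Finset.sum_congr rfl fun b _ => ?_))
    rw [← mul_assoc]
    exact congrArg (· * dZ k n N b α) (coef_mul_d weight_d _ a β)

/-- The homomorphism from the ring of `h`-deformed differential operators given by a solution of
its relations. -/
def diffLift (c : Ubar k n →ₐ[k] S) (Z d : Fin n → Fin N → S) (h : IsDiffSys c Z d) :
    Diff k n N →ₐ[k] S :=
  RingQuot.liftAlgHom k ⟨FreeAlgebra.lift k (fun g => match g with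
    | DiffGen.coef p => c p
    | DiffGen.Z i α => Z i α
    | DiffGen.d i α => d i α), by
    let f : DiffFree k n N →ₐ[k] S := FreeAlgebra.lift k (fun g => match g with
      | DiffGen.coef p => c p
      | DiffGen.Z i α => Z i α
      | DiffGen.d i α => d i α)
    have hc : ∀ p, f (fCoef k n N p) = c p := fun p => FreeAlgebra.lift_ι_apply _ _
    have hZ : ∀ i α, f (fZ k n N i α) = Z i α := fun i j => FreeAlgebra.lift_ι_apply _ _
    have hd : ∀ i α, f (fd k n N i α) = d i α := fun i j => FreeAlgebra.lift_ι_apply _ _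
    intro x y hxy
    change f x = f y
    cases hxy with
    | coef_add p q => simp only [map_add, hc]
    | coef_mul p q => simp only [map_mul, hc]
    | coef_scalar a => simp only [hc, AlgHom.commutes]
    | weight_Z i j α =>
      simp only [map_mul, map_add, hc, hZ, apply_ite f, map_one, map_zero, h.weight_Z, trans_hh]
      congr 2
      simp [Pi.single_apply]
    | weight_d i j α =>
      simp only [map_mul, map_add, map_sub, hc, hd, apply_ite f, map_one, map_zero, h.weight_d,
        trans_hh]
      rw [sub_eq_add_neg]
      congr 2
      simp only [Pi.neg_apply, Pi.single_apply]
      split_ifs <;> simp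
    | Z_Z i j α β =>
      rw [map_mul, hZ, hZ, h.Z_Z, map_sum]
      refine Finset.sum_congr rfl fun a _ => ?_
      rw [map_sum]
      refine Finset.sum_congr rfl fun b _ => ?_
      rw [map_mul, map_mul, hc, hZ, hZ, mul_assoc]
    | d_d i j α β =>
      rw [map_mul, hd, hd, h.d_d, map_sum]
      refine Finset.sum_congr rfl fun a _ => ?_
      rw [map_sum]
      refine Finset.sum_congr rfl fun b _ => ?_
      rw [map_mul, map_mul, hc, hd, hd, coef_mul_d_d h.weight_d]
    | Z_d i j α β =>
      simp only [map_mul, map_sum, map_sub, apply_ite f, map_one, map_zero, hc, hd, hZ]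
      rw [h.Z_d]
      refine congrArg (· - _) (Finset.sum_congr rfl fun a _ => Finset.sum_congr rfl fun b _ => ?_)
      rw [coef_mul_d h.weight_d, mul_assoc]⟩

@[simp] theorem diffLift_dC (c : Ubar k n →ₐ[k] S) (Z d : Fin n → Fin N → S)
    (h : IsDiffSys c Z d) (p : Ubar k n) : diffLift c Z d h (dC k n N p) = c p :=
  (RingQuot.liftAlgHom_mkAlgHom_apply k _ _ _).trans (FreeAlgebra.lift_ι_apply _ _)

@[simp] theorem diffLift_dZ (c : Ubar k n →ₐ[k] S) (Z d : Fin n → Fin N → S)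
    (h : IsDiffSys c Z d) (i : Fin n) (α : Fin N) : diffLift c Z d h (dZ k n N i α) = Z i α :=
  (RingQuot.liftAlgHom_mkAlgHom_apply k _ _ _).trans (FreeAlgebra.lift_ι_apply _ _)

@[simp] theorem diffLift_dd (c : Ubar k n →ₐ[k] S) (Z d : Fin n → Fin N → S)
    (h : IsDiffSys c Z d) (i : Fin n) (α : Fin N) : diffLift c Z d h (dd k n N i α) = d i α :=
  (RingQuot.liftAlgHom_mkAlgHom_apply k _ _ _).trans (FreeAlgebra.lift_ι_apply _ _)

end DiffAlgebra

section Tau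

variable {c : Ubar k n →ₐ[k] S} {Z d : Fin n → Fin N → S}

theorem sum_rotate {A B C : Type*} [Fintype A] [Fintype B] [Fintype C] (F : A → B → C → S) :
    ∑ a, ∑ b, ∑ x, F a b x = ∑ x, ∑ a, ∑ b, F a b x := by
  rw [Finset.sum_congr rfl fun a _ => Finset.sum_comm, Finset.sum_comm]

/-- The elements `∑_α Z^{j,α} ∂_{i,α}`. -/
def sumZd (Z d : Fin n → Fin N → S) (i j : Fin n) : S := ∑ α, Z j α * d i α

theorem mY_apply (c : Ubar k n →ₐ[k] S) (L : Fin n → Fin n → S) (i j x l : Fin n) :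
    mY c L (i, j) (x, l) = (∑ a, ∑ b, c (Rhat k n i j a b) * ∑ p, L p a * c (Rhat k n p b x l))
      - c (Rhat k n i j x l) := by
  rw [mY, mul_assoc, Matrix.sub_apply, Matrix.mul_apply, Fintype.sum_prod_type]
  simp only [mL_mul_apply, mR, map_apply, matR]

theorem mY_apply' (c : Ubar k n →ₐ[k] S) (L : Fin n → Fin n → S) (i j x l : Fin n) :
    mY c L (i, j) (x, l) = (∑ a, ∑ b, (∑ p, c (Rhat k n i j p b) * L a p) * c (Rhat k n a b x l))
      - c (Rhat k n i j x l) := by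
  rw [mY, Matrix.sub_apply, Matrix.mul_apply, Fintype.sum_prod_type]
  simp only [mul_mL_apply, mR, map_apply, matR]

/-- Z^i passes Z^j by one factor R̂ and ∂_l by another. The quadratic part of the mixed relation
produces R̂L₁R̂, and its constant term produces -R̂. -/
theorem IsDiffSys.Z_mul_sumZd (h : IsDiffSys c Z d) (i j l : Fin n) (α : Fin N) :
    Z i α * sumZd Z d l j = ∑ x, mY c (sumZd Z d) (i, j) (x, l) * Z x α := by
  have e1 : ∀ a b, ∑ β, Z a β * (Z b α * d l β) = ∑ x, ∑ p, sumZd Z d p a *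
      (c (Rhat k n p b x l) * Z x α) - if b = l then Z a α else 0 := by
    intro a b
    simp only [h.Z_d, mul_sub, Finset.sum_sub_distrib, Finset.mul_sum]
    congr 1
    · simp only [sumZd, Finset.sum_mul, mul_assoc]
      rw [sum_rotate]
      exact Finset.sum_congr rfl fun β _ => Finset.sum_comm
    · simp only [ite_and, mul_ite, mul_one, mul_zero, Finset.sum_ite_eq, Finset.mem_univ, if_true]
  calc Z i α * sumZd Z d l j = ∑ a, ∑ b, c (Rhat k n i j a b) * ∑ β, Z a β * (Z b α * d l β) := by
        simp only [sumZd, Finset.mul_sum, ← mul_assoc, h.Z_Z i j, Finset.sum_mul]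
        rw [Finset.sum_comm]
        exact Finset.sum_congr rfl fun a _ => Finset.sum_comm
    _ = _ := by
      simp only [e1, mY_apply, sub_mul, mul_sub, Finset.sum_sub_distrib]
      congr 1
      · simp only [Finset.sum_mul (s := Finset.univ (α := Fin n))]
        rw [← sum_rotate fun a b x => c (Rhat k n i j a b) *
          (∑ p, sumZd Z d p a * c (Rhat k n p b x l)) * Z x α]
        refine Finset.sum_congr rfl fun a _ => Finset.sum_congr rfl fun b _ => ?_
        simp only [Finset.sum_mul, Finset.mul_sum, mul_assoc]
      · simp

theorem IsDiffSys.sumZd_mul_d (h : IsDiffSys c Z d) (j l m : Fin n) (α : Fin N) :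
    sumZd Z d m j * d l α = ∑ x, d x α * mY c (sumZd Z d) (x, j) (l, m) := by
  have e1 : ∀ a b, ∑ β, Z j β * d a α * d b β = ∑ x, ∑ p, d x α * (c (Rhat k n x j p a) *
      sumZd Z d b p) - if j = a then d b α else 0 := by
    intro a b
    simp only [h.Z_d, sub_mul, Finset.sum_sub_distrib, Finset.sum_mul]
    congr 1
    · simp only [sumZd, Finset.mul_sum, mul_assoc]
      exact (sum_rotate (A := Fin n) (B := Fin n) (C := Fin N) _).symm
    · simp only [ite_and, ite_mul, one_mul, zero_mul, Finset.sum_ite_eq', Finset.mem_univ, if_true]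
  calc sumZd Z d m j * d l α = ∑ a, ∑ b, (∑ β, Z j β * d a α * d b β) * c (Rhat k n b a l m) := by
        simp only [sumZd, Finset.sum_mul, mul_assoc, h.d_d m l, Finset.mul_sum]
        rw [Finset.sum_comm]
        exact Finset.sum_congr rfl fun a _ => Finset.sum_comm
    _ = _ := by
      simp only [e1, mY_apply', sub_mul, mul_sub, Finset.sum_sub_distrib]
      congr 1
      · simp only [Finset.mul_sum (s := Finset.univ (α := Fin n))]
        rw [Finset.sum_comm, ← sum_rotate fun b a x => d x α * ((∑ p, c (Rhat k n x j p a) * sumZd Z d b p) *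
          c (Rhat k n b a l m))]
        refine Finset.sum_congr rfl fun a _ => Finset.sum_congr rfl fun b _ => ?_
        simp only [Finset.sum_mul, Finset.mul_sum, mul_assoc]
      · simp

/-- The two sides of L₁Y = YL₁ are the two ways to bracket Z^i · L_m^j · ∂_l, summed over α. -/
theorem IsDiffSys.isRedSys (h : IsDiffSys c Z d) : IsRedSys c (sumZd Z d) := by
  constructor
  · intro p i j
    simp only [sumZd, Finset.mul_sum, Finset.sum_mul]
    refine Finset.sum_congr rfl fun α _ => ?_
    rw [← mul_assoc, h.weight_Z, mul_assoc, h.weight_d, trans_trans, mul_assoc]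
    congr 4; abel_nf
  · ext ⟨i, j⟩ ⟨l, m⟩
    rw [mL_mul_apply, mul_mL_apply]
    have e1 : ∑ x, sumZd Z d x i * mY c (sumZd Z d) (x, j) (l, m)
        = ∑ α, Z i α * (sumZd Z d m j * d l α) := by
      simp only [sumZd_mul_d h j, Finset.mul_sum, ← mul_assoc]
      rw [Finset.sum_comm]
      simp only [sumZd, Finset.sum_mul]
    have e2 : ∑ x, mY c (sumZd Z d) (i, j) (x, m) * sumZd Z d l x
        = ∑ α, Z i α * sumZd Z d m j * d l α := by
      simp only [h.Z_mul_sumZd, Finset.sum_mul, mul_assoc]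
      rw [Finset.sum_comm]
      simp only [sumZd, Finset.mul_sum]
    rw [e1, e2]
    simp only [mul_assoc]

variable (k n N) in
/-- The homomorphism `τ`. -/
def tau : Red k n →ₐ[k] Diff k n N := redLift _ _ (isDiffSys_diff k n N).isRedSys

theorem isTau_tau : IsTau k n N (tau k n N) :=
  ⟨fun p => redLift_rC _ _ (isDiffSys_diff k n N).isRedSys p,
    fun i j => redLift_rL _ _ (isDiffSys_diff k n N).isRedSys i j⟩

theorem IsTau.eq_tau {τ : Red k n →ₐ[k] Diff k n N} (h : IsTau k n N τ) : τ = tau k n N :=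
  red_algHom_ext (fun p => (h.coef p).trans (isTau_tau.coef p).symm)
    fun i j => (h.L i j).trans (isTau_tau.L i j).symm

end Tau

end

end HDiff

/-! ### Normalized generators, with relations symmetric under permutations -/

namespace HDiff

noncomputable section

open Matrix

section Normalization

variable (k : Type*) [CommRing k] {n : ℕ}

/-- The factor `∏_{a < j} h̃ⱼₐ`. -/
def vph (j : Fin n) : Ubar k n := ∏ a ∈ Finset.Iio j, hd k n j a

/-- The inverse of `vph`. -/
def vphi (j : Fin n) : Ubar k n := ∏ a ∈ Finset.Iio j, hinv k j a 0

theorem hd_mul_hinv {i j : Fin n} (hij : i ≠ j) : hd k n i j * hinv k i j 0 = 1 := by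
  simpa using mul_hinv k hij 0

theorem vph_mul_vphi (j : Fin n) : vph k j * vphi k j = 1 := by
  rw [vph, vphi, ← Finset.prod_mul_distrib]
  exact Finset.prod_eq_one fun a ha => hd_mul_hinv k (Finset.mem_Iio.mp ha).ne'

theorem vphi_mul_vph (j : Fin n) : vphi k j * vph k j = 1 := by rw [mul_comm, vph_mul_vphi]

theorem trans_vph {i j : Fin n} (hij : i ≠ j) (m : ℤ) : trans k (m • ew j) (vph k i)
    = vph k i * if j < i then 1 - (m : Ubar k n) * rf k i j else 1 := by
  have h : ∀ a ∈ Finset.Iio i, trans k (m • ew j) (hd k n i a)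
      = hd k n i a * if j = a then 1 - (m : Ubar k n) * rf k i j else 1 := by
    intro a _
    rw [trans_hd]
    by_cases hja : j = a
    · subst hja
      have := hd_mul_hinv k hij
      simp only [rf, if_neg hij, Pi.smul_apply, Pi.single_apply, if_true]
      push_cast
      simp
      linear_combination (m : Ubar k n) * this
    · simp [hij, hja, Ne.symm hja]
  rw [vph, map_prod, Finset.prod_congr rfl h, Finset.prod_mul_distrib, Finset.prod_ite_eq]
  simp only [Finset.mem_Iio]

theorem trans_ew_vph {i j : Fin n} (hij : i ≠ j) : trans k (ew j) (vph k i)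
    = vph k i * if j < i then 1 - rf k i j else 1 := by
  simpa using trans_vph k hij 1

theorem trans_neg_ew_vph {i j : Fin n} (hij : i ≠ j) : trans k (-ew j) (vph k i)
    = vph k i * if j < i then 1 + rf k i j else 1 := by
  have := trans_vph k hij (-1)
  rw [neg_one_zsmul] at this
  rw [this]
  split_ifs
  · push_cast; ring
  · rfl

/-- The reason for the choice of φ. Moving φ_i past Z^j translates it by εⱼ, which only matters for
j < i, and the resulting factor turns the asymmetric entry into 1 - 1/h̃_{ij} for either order of
the indices. -/
theorem rg_mul_vph (i j : Fin n) : rg k i j * (trans k (ew j) (vph k i) * vph k j)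
    = (1 - rf k i j) * (trans k (ew i) (vph k j) * vph k i) := by
  by_cases hij : i = j
  · subst hij; simp
  rw [trans_ew_vph k hij, trans_ew_vph k (Ne.symm hij), rg]
  have h1 := hd_mul_hinv k hij
  rcases lt_or_gt_of_ne hij with h | h
  · rw [rf_swap k j i, rf, if_neg hij]
    simp only [h, h.not_gt, if_true, if_false]
    linear_combination (vph k i * vph k j) * (hd k n i j * hinv k i j 0 + 1) * h1
  · simp only [h, h.not_gt, if_true, if_false]
    ring

/-- The counterpart for the mixed relation, where both orders of the indices lead to the coefficient
h̃_{ij}/(h̃_{ij} - 1). -/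
theorem rg_mul_vphi {i j : Fin n} (hij : i ≠ j) :
    trans k (-ew i) (vph k i * vphi k j) * trans k (ew j) (rg k j i)
      = hd k n i j * hinv k i j (-1) * (vphi k j * trans k (ew j) (trans k (-ew i) (vph k i))) := by
  have e : trans k (ew j) (trans k (-ew i) (vph k i)) = trans k (-ew i) (vph k i) *
      if j < i then 1 - hinv k i j (-1) else 1 := by
    rw [trans_trans, add_comm, ← trans_trans, trans_ew_vph k hij, map_mul, apply_ite (trans k _),
      map_sub, map_one, trans_rf, if_neg hij]
    simp [Ne.symm hij]
  rw [e, map_mul]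
  have h1 := mul_hinv k hij (-1)
  have h2 : trans k (-ew i) (vphi k j) * trans k (-ew i) (vph k j) = 1 := by
    rw [← map_mul, vphi_mul_vph, map_one]
  have h3 := vphi_mul_vph k j
  have h4 : hinv k j i 1 = -hinv k i j (-1) := hinv_swap k (Ne.symm hij) 1
  have h5 := hd_mul_hinv k hij
  rw [trans_neg_ew_vph k (Ne.symm hij)] at h2
  rw [trans_rg]
  push_cast at h1
  rcases lt_or_gt_of_ne hij with h | h
  · simp only [h, h.not_gt, if_true, if_false] at h2 ⊢
    rw [rf_swap, rf, if_neg hij] at h2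
    have h6 : vph k j * (1 - hinv k i j 0) * (vphi k j * (hd k n i j * hinv k i j (-1))) = 1 := by
      linear_combination h1 + (1 - hinv k i j 0) * hd k n i j * hinv k i j (-1) * h3
        - hinv k i j (-1) * h5
    linear_combination (-trans k (-ew i) (vphi k j) * trans k (-ew i) (vph k i)) * h6
      + trans k (-ew i) (vph k i) * (vphi k j * (hd k n i j * hinv k i j (-1))) * h2
  · simp only [h, h.not_gt, if_true, if_false, mul_one] at h2 ⊢
    have h6 : trans k (-ew i) (vphi k j) = vphi k j := by
      linear_combination vphi k j * h2 - trans k (-ew i) (vphi k j) * h3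
    have e1 : ((ew j : Fin n → ℤ) j - (ew j : Fin n → ℤ) i) = 1 := by
      simp [hij]
    rw [h6, e1, h4, hd_swap k j i]
    push_cast
    linear_combination (trans k (-ew i) (vph k i) * vphi k j * hd k n i j * hinv k i j (-1)) * h1

theorem perm_rf (g : Equiv.Perm (Fin n)) (i j : Fin n) : perm k g (rf k i j) = rf k (g i) (g j) := by
  unfold rf
  by_cases h : i = j
  · simp [h]
  · rw [if_neg h, if_neg (fun e => h (g.injective e)), perm_hinv k g h]

theorem perm_cauchy (g : Equiv.Perm (Fin n)) (i j : Fin n) :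
    perm k g (cauchy k n i j) = cauchy k n (g i) (g j) := by
  unfold cauchy
  by_cases h : j = i
  · simp [h]
  · rw [if_neg h, if_neg (fun e => h (g.injective e)), perm_hinv k g h]

end Normalization

variable {k : Type*} [CommRing k] {n N : ℕ} {S : Type*} [Ring S] [Algebra k S]

/-- The relations of the normalized generators, invariant under permutations of indices. -/
structure IsNormSys (c : Ubar k n →ₐ[k] S) (Z d : Fin n → Fin N → S) : Prop where
  weight_Z : ∀ p j α, c p * Z j α = Z j α * c (trans k (ew j) p)
  weight_d : ∀ p j α, c p * d j α = d j α * c (trans k (-ew j) p)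
  Z_Z : ∀ i j α β, Z i α * Z j β
    = c (rf k i j) * (Z i β * Z j α) + c (1 - rf k i j) * (Z j β * Z i α)
  d_d : ∀ i j α β, d i α * d j β
    = c (rf k j i) * (d i β * d j α) + c (1 - rf k i j) * (d j β * d i α)
  Z_d : ∀ i j α β, i ≠ j → Z i α * d j β = c (hd k n i j * hinv k i j (-1)) * (d j β * Z i α)
  Z_d_self : ∀ i α β, Z i α * d i β
    = ∑ a, c (cauchy k n i a) * (d a β * Z a α) - if α = β then 1 else 0

/-- The normalized coordinates. -/
def normZ (c : Ubar k n →ₐ[k] S) (Z : Fin n → Fin N → S) (j : Fin n) (α : Fin N) : S :=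
  Z j α * c (vph k j)

/-- The normalized derivatives. -/
def normD (c : Ubar k n →ₐ[k] S) (d : Fin n → Fin N → S) (j : Fin n) (α : Fin N) : S :=
  c (vphi k j) * d j α

variable {c : Ubar k n →ₐ[k] S} {Z d : Fin n → Fin N → S}

theorem isUnit_map_vph (c : Ubar k n →ₐ[k] S) (w : Fin n → ℤ) (j : Fin n) :
    IsUnit (c (trans k w (vph k j))) :=
  ((IsUnit.of_mul_eq_one _ (vph_mul_vphi k j)).map (trans k w)).map c

theorem isUnit_map_vphi (c : Ubar k n →ₐ[k] S) (w : Fin n → ℤ) (j : Fin n) :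
    IsUnit (c (trans k w (vphi k j))) :=
  ((IsUnit.of_mul_eq_one _ (vphi_mul_vph k j)).map (trans k w)).map c

theorem weight_normZ_iff (j : Fin n) (α : Fin N) :
    (∀ p, c p * normZ c Z j α = normZ c Z j α * c (trans k (ew j) p))
      ↔ ∀ p, c p * Z j α = Z j α * c (trans k (ew j) p) := by
  refine forall_congr' fun p => ?_
  have hu := isUnit_map_vph c 0 j
  rw [trans_zero] at hu
  rw [normZ, ← mul_assoc, mul_assoc (Z j α), ← map_mul, mul_comm, map_mul, ← mul_assoc]
  exact hu.mul_left_inj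

theorem weight_normD_iff (j : Fin n) (α : Fin N) :
    (∀ p, c p * normD c d j α = normD c d j α * c (trans k (-ew j) p))
      ↔ ∀ p, c p * d j α = d j α * c (trans k (-ew j) p) := by
  refine forall_congr' fun p => ?_
  have hu := isUnit_map_vphi c 0 j
  rw [trans_zero] at hu
  rw [normD, ← mul_assoc, ← map_mul, mul_comm, map_mul, mul_assoc, mul_assoc]
  exact hu.mul_right_inj

theorem sum_Rhat_mixed (i j : Fin n) (x y : Fin n → S) :
    ∑ a, ∑ b, x a * (c (Rhat k n a i b j) * y b) = (if i = j then ∑ a, x a * (c (rf k a i) * y a)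
      else 0) + x j * (c (rg k j i) * y i) := by
  simp only [Rhat_eq, map_add, add_mul, mul_add, Finset.sum_add_distrib, apply_ite c, map_zero,
    ite_mul, zero_mul, mul_ite, mul_zero, ite_and]
  congr 1
  · by_cases h : i = j
    · simp [h]
    · simp [h, Ne.symm h]
  · simp

theorem Z_mul_coef (weight_Z : ∀ p j α, c p * Z j α = Z j α * c (trans k (ew j) p)) (p : Ubar k n)
    (j : Fin n) (α : Fin N) : Z j α * c p = c (trans k (-ew j) p) * Z j α := by
  rw [weight_Z, trans_trans, add_neg_cancel, trans_zero]

theorem d_mul_coef (weight_d : ∀ p j α, c p * d j α = d j α * c (trans k (-ew j) p)) (p : Ubar k n)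
    (j : Fin n) (α : Fin N) : d j α * c p = c (trans k (ew j) p) * d j α := by
  rw [weight_d, trans_trans, neg_add_cancel, trans_zero]

theorem normZ_mul_normZ (weight_Z : ∀ p j α, c p * Z j α = Z j α * c (trans k (ew j) p))
    (i j : Fin n) (α β : Fin N) : normZ c Z i α * normZ c Z j β
      = Z i α * Z j β * c (trans k (ew j) (vph k i) * vph k j) := by
  rw [normZ, normZ, mul_assoc, ← mul_assoc (c _), weight_Z, map_mul]
  simp only [mul_assoc]

theorem normD_mul_normD (weight_d : ∀ p j α, c p * d j α = d j α * c (trans k (-ew j) p))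
    (i j : Fin n) (α β : Fin N) : normD c d i α * normD c d j β
      = c (vphi k i * trans k (ew i) (vphi k j)) * (d i α * d j β) := by
  rw [normD, normD, mul_assoc, ← mul_assoc (d i α), d_mul_coef weight_d, map_mul]
  simp only [mul_assoc]

theorem trans_pair_rf (i j : Fin n) : trans k (ew i + ew j) (rf k i j) = rf k i j := by
  by_cases h : i = j
  · subst h; simp
  · exact trans_rf_self k (by simp [h, Ne.symm h])

theorem trans_pair_rg (i j : Fin n) : trans k (ew i + ew j) (rg k i j) = rg k i j := by
  by_cases h : i = j
  · subst h; simp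
  · exact trans_rg_self k (by simp [h, Ne.symm h])

/-- The normalized relation is the original one multiplied on the right by a unit. The relations
below with i ≠ j, and those among the derivatives, are treated in the same way. -/
theorem Z_Z_norm_iff (weight_Z : ∀ p j α, c p * Z j α = Z j α * c (trans k (ew j) p))
    (i j : Fin n) (α β : Fin N) :
    (normZ c Z i α * normZ c Z j β = c (rf k i j) * (normZ c Z i β * normZ c Z j α)
      + c (1 - rf k i j) * (normZ c Z j β * normZ c Z i α))
      ↔ Z i α * Z j β = ∑ a, ∑ b, c (Rhat k n i j a b) * (Z a β * Z b α) := by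
  have hu : IsUnit (c (trans k (ew j) (vph k i) * vph k j)) := by
    have := isUnit_map_vph c 0 j
    rw [trans_zero] at this
    rw [map_mul]
    exact (isUnit_map_vph c _ i).mul this
  have e1 : ∑ a, ∑ b, c (Rhat k n i j a b) * (Z a β * Z b α) = c (rf k i j) * (Z i β * Z j α)
      + c (rg k i j) * (Z j β * Z i α) := sum_Rhat_left k i j (c : Ubar k n →+* S) _
  have e2 : ∀ p, trans k (ew i + ew j) p = p →
      ∀ α β, c p * (Z j β * Z i α) = Z j β * Z i α * c p := by
    intro p hp α β
    rw [← mul_assoc, weight_Z, mul_assoc, weight_Z, trans_trans, hp, mul_assoc]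
  refine Iff.trans ?_ hu.mul_left_inj
  rw [e1, normZ_mul_normZ weight_Z, normZ_mul_normZ weight_Z, normZ_mul_normZ weight_Z, add_mul, mul_assoc (c _), mul_assoc (c _), ← mul_assoc (c (1 - rf k i j)),
    ← mul_assoc (c (rg k i j)), e2, e2, mul_assoc _ (c (1 - rf k i j)),
    mul_assoc _ (c (rg k i j)), ← map_mul c (1 - rf k i j), ← map_mul c (rg k i j), rg_mul_vph]
  · exact trans_pair_rg i j
  · rw [map_sub, map_one, trans_pair_rf]

theorem d_d_norm_iff (weight_d : ∀ p j α, c p * d j α = d j α * c (trans k (-ew j) p))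
    (i j : Fin n) (α β : Fin N) :
    (normD c d i α * normD c d j β = c (rf k j i) * (normD c d i β * normD c d j α)
      + c (1 - rf k i j) * (normD c d j β * normD c d i α))
      ↔ d i α * d j β = ∑ a, ∑ b, d a β * d b α * c (Rhat k n b a j i) := by
  have hu : IsUnit (c (vphi k i * trans k (ew i) (vphi k j))) := by
    have := isUnit_map_vphi c 0 i
    rw [trans_zero] at this
    rw [map_mul]
    exact this.mul (isUnit_map_vphi c _ j)
  have e1 : ∑ a, ∑ b, d a β * d b α * c (Rhat k n b a j i) = d i β * d j α * c (rf k j i)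
      + d j β * d i α * c (rg k i j) := by
    rw [Finset.sum_comm]
    exact sum_Rhat_right k j i (c : Ubar k n →+* S) fun b a => d a β * d b α
  have e2 : ∀ p, trans k (ew i + ew j) p = p →
      ∀ α β, d i β * d j α * c p = c p * (d i β * d j α) := by
    intro p hp α β
    rw [mul_assoc, d_mul_coef weight_d, ← mul_assoc, d_mul_coef weight_d, trans_trans, hp,
      mul_assoc]
  have e3 : ∀ p, trans k (ew i + ew j) p = p →
      ∀ α β, d j β * d i α * c p = c p * (d j β * d i α) := by
    intro p hp α β
    rw [mul_assoc, d_mul_coef weight_d, ← mul_assoc, d_mul_coef weight_d, trans_trans,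
      add_comm (ew j), hp, mul_assoc]
  have e4 : vphi k i * trans k (ew i) (vphi k j) * rg k i j
      = (1 - rf k i j) * (vphi k j * trans k (ew j) (vphi k i)) := by
    have h1 := rg_mul_vph k i j
    have h2 := vphi_mul_vph k i
    have h3 := vphi_mul_vph k j
    have h4 : trans k (ew j) (vphi k i) * trans k (ew j) (vph k i) = 1 := by
      rw [← map_mul, vphi_mul_vph, map_one]
    have h5 : trans k (ew i) (vphi k j) * trans k (ew i) (vph k j) = 1 := by
      rw [← map_mul, vphi_mul_vph, map_one]
    generalize trans k (ew j) (vphi k i) = a at *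
    generalize trans k (ew j) (vph k i) = a' at *
    generalize trans k (ew i) (vphi k j) = b at *
    generalize trans k (ew i) (vph k j) = b' at *
    have h6 : vphi k j * a * (a' * vph k j) = 1 := by
      linear_combination h3 + vphi k j * vph k j * h4
    have h7 : vphi k i * b * (b' * vph k i) = 1 := by
      linear_combination h2 + vphi k i * vph k i * h5
    linear_combination (vphi k i * b * vphi k j * a) * h1 - vphi k i * b * rg k i j * h6
      + (1 - rf k i j) * (vphi k j * a) * h7
  have e5 : trans k (ew i + ew j) (rf k j i) = rf k j i := by
    rw [add_comm]; exact trans_pair_rf j i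
  refine Iff.trans ?_ hu.mul_right_inj
  rw [e1, normD_mul_normD weight_d, normD_mul_normD weight_d, normD_mul_normD weight_d, mul_add, ← mul_assoc (c (1 - rf k i j)), ← map_mul c (1 - rf k i j), ← e4,
    e2 _ e5, e3 _ (trans_pair_rg i j), ← mul_assoc (c (rf k j i)), ← map_mul,
    mul_comm (rf k j i), map_mul c _ (rf k j i), map_mul c _ (rg k i j)]
  simp only [mul_assoc]

theorem Z_d_norm_iff (weight_Z : ∀ p j α, c p * Z j α = Z j α * c (trans k (ew j) p))
    (weight_d : ∀ p j α, c p * d j α = d j α * c (trans k (-ew j) p)) {i j : Fin n} (hij : i ≠ j)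
    (α β : Fin N) :
    (normZ c Z i α * normD c d j β
      = c (hd k n i j * hinv k i j (-1)) * (normD c d j β * normZ c Z i α))
      ↔ Z i α * d j β = (∑ a, ∑ b, d a β * (c (Rhat k n a i b j) * Z b α))
        - if α = β ∧ i = j then 1 else 0 := by
  have hu : IsUnit (c (trans k (-ew i) (vph k i * vphi k j))) := by
    rw [map_mul, map_mul]
    exact (isUnit_map_vph c _ i).mul (isUnit_map_vphi c _ j)
  rw [sum_Rhat_mixed i j (fun a => d a β) fun b => Z b α, if_neg hij, zero_add,
    if_neg (fun h => hij h.2), sub_zero]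
  refine Iff.trans ?_ hu.mul_right_inj
  have e1 : normZ c Z i α * normD c d j β
      = c (trans k (-ew i) (vph k i * vphi k j)) * (Z i α * d j β) := by
    rw [normZ, normD, mul_assoc, ← mul_assoc (c _), ← map_mul, ← mul_assoc, Z_mul_coef weight_Z,
      mul_assoc]
  have e2 : normD c d j β * normZ c Z i α
      = c (vphi k j * trans k (ew j) (trans k (-ew i) (vph k i))) * (d j β * Z i α) := by
    rw [normZ, normD, Z_mul_coef weight_Z, mul_assoc, ← mul_assoc (d j β), d_mul_coef weight_d,
      map_mul]
    simp only [mul_assoc]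
  rw [e1, e2, ← mul_assoc (c (hd k n i j * hinv k i j (-1))), ← map_mul, ← rg_mul_vphi k hij, ← mul_assoc (d j β),
    d_mul_coef weight_d, map_mul c _ (trans k (ew j) (rg k j i))]
  simp only [mul_assoc]

/-- The products Z^i∂_i and ∂_aZ^a do not change under normalization. Moving the coefficient
1/h̃_{ai} to the left of ∂_a translates it to the Cauchy entry 1/(h̃_{ai} + 1). -/
theorem Z_d_self_norm_iff (weight_Z : ∀ p j α, c p * Z j α = Z j α * c (trans k (ew j) p))
    (weight_d : ∀ p j α, c p * d j α = d j α * c (trans k (-ew j) p)) (i : Fin n)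
    (α β : Fin N) :
    (normZ c Z i α * normD c d i β = ∑ a, c (cauchy k n i a) * (normD c d a β * normZ c Z a α)
        - if α = β then 1 else 0)
      ↔ Z i α * d i β = (∑ a, ∑ b, d a β * (c (Rhat k n a i b i) * Z b α))
        - if α = β ∧ i = i then 1 else 0 := by
  have e1 : normZ c Z i α * normD c d i β = Z i α * d i β := by
    rw [normZ, normD, mul_assoc, ← mul_assoc (c _), ← map_mul, vph_mul_vphi, map_one, one_mul]
  have e2 : ∀ a, normD c d a β * normZ c Z a α = d a β * Z a α := by
    intro a
    rw [normZ, normD, Z_mul_coef weight_Z, mul_assoc, ← mul_assoc (d a β), d_mul_coef weight_d,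
      trans_trans, add_neg_cancel, trans_zero, mul_assoc, ← mul_assoc, ← map_mul, vphi_mul_vph,
      map_one, one_mul]
  have e3 : ∀ a, c (cauchy k n i a) * (d a β * Z a α) = d a β * (c (rf k a i) * Z a α)
      + if i = a then d a β * Z a α else 0 := by
    intro a
    rw [← mul_assoc (d a β), d_mul_coef weight_d, mul_assoc]
    by_cases h : a = i
    · subst h; simp [cauchy]
    · rw [cauchy, if_neg h, if_neg (Ne.symm h), trans_rf, if_neg h, add_zero]
      simp [Ne.symm h]
  rw [e1, sum_Rhat_mixed i i (fun a => d a β) fun b => Z b α, if_pos rfl, rg_self, map_one, one_mul]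
  simp only [e2, e3, Finset.sum_add_distrib, Finset.sum_ite_eq, Finset.mem_univ, if_true, and_true]

/-- The forward direction supplies relations for the normalized generators of Diff; the backward one
turns permuted generators into a homomorphism from Diff. -/
theorem isDiffSys_iff_isNormSys : IsDiffSys c Z d ↔ IsNormSys c (normZ c Z) (normD c d) := by
  constructor
  · intro h
    exact ⟨fun p j α => (weight_normZ_iff j α).mpr (fun p => h.weight_Z p j α) p,
      fun p j α => (weight_normD_iff j α).mpr (fun p => h.weight_d p j α) p,
      fun i j α β => (Z_Z_norm_iff h.weight_Z i j α β).mpr (h.Z_Z i j α β),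
      fun i j α β => (d_d_norm_iff h.weight_d i j α β).mpr (h.d_d i j α β),
      fun i j α β hij => (Z_d_norm_iff h.weight_Z h.weight_d hij α β).mpr (h.Z_d i j α β),
      fun i α β => (Z_d_self_norm_iff h.weight_Z h.weight_d i α β).mpr (h.Z_d i i α β)⟩
  · intro h
    have hZ : ∀ p j α, c p * Z j α = Z j α * c (trans k (ew j) p) := fun p j α =>
      (weight_normZ_iff j α).mp (fun p => h.weight_Z p j α) p
    have hd : ∀ p j α, c p * d j α = d j α * c (trans k (-ew j) p) := fun p j α =>
      (weight_normD_iff j α).mp (fun p => h.weight_d p j α) p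
    refine ⟨hZ, hd, fun i j α β => (Z_Z_norm_iff hZ i j α β).mp (h.Z_Z i j α β),
      fun i j α β => (d_d_norm_iff hd i j α β).mp (h.d_d i j α β), fun i j α β => ?_⟩
    by_cases hij : i = j
    · subst hij; exact (Z_d_self_norm_iff hZ hd i α β).mp (h.Z_d_self i α β)
    · exact (Z_d_norm_iff hZ hd hij α β).mp (h.Z_d i j α β hij)

theorem ew_comp_symm (g : Equiv.Perm (Fin n)) (j : Fin n) :
    (fun i => (ew j : Fin n → ℤ) (g.symm i)) = ew (g j) := by
  funext i
  simp only [Pi.single_apply, Equiv.symm_apply_eq]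

theorem neg_ew_comp_symm (g : Equiv.Perm (Fin n)) (j : Fin n) :
    (fun i => (-ew j : Fin n → ℤ) (g.symm i)) = -ew (g j) := by
  funext i
  simp only [Pi.neg_apply, Pi.single_apply, Equiv.symm_apply_eq]

theorem IsNormSys.permute (h : IsNormSys c Z d) (g : Equiv.Perm (Fin n)) :
    IsNormSys (c.comp (perm k g)) (fun j => Z (g j)) (fun j => d (g j)) := by
  refine ⟨fun p j α => ?_, fun p j α => ?_, fun i j α β => ?_, fun i j α β => ?_,
    fun i j α β hij => ?_, fun i α β => ?_⟩ <;> simp only [AlgHom.comp_apply]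
  · rw [perm_trans, ew_comp_symm, h.weight_Z]
  · rw [perm_trans, neg_ew_comp_symm, h.weight_d]
  · rw [map_sub, map_one, perm_rf, h.Z_Z]
  · rw [map_sub, map_one, perm_rf, perm_rf, h.d_d]
  · rw [map_mul, perm_hd, perm_hinv k g hij, h.Z_d _ _ _ _ fun e => hij (g.injective e)]
  · simp only [perm_cauchy]
    rw [h.Z_d_self, ← Equiv.sum_comp g]

end

end HDiff

/-! ### The action of S_n on Diff_h(n,N), the image of τ, and the transfer to D(gl_n) -/

namespace HDiff

noncomputable section

open Matrix

variable {k : Type*} [CommRing k] {n N : ℕ} {S : Type*} [Ring S] [Algebra k S]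

section Action

theorem map_vph_mul_vphi (c : Ubar k n →ₐ[k] S) (j : Fin n) : c (vph k j) * c (vphi k j) = 1 := by
  rw [← map_mul, vph_mul_vphi, map_one]

theorem map_vphi_mul_vph (c : Ubar k n →ₐ[k] S) (j : Fin n) : c (vphi k j) * c (vph k j) = 1 := by
  rw [← map_mul, vphi_mul_vph, map_one]

theorem normZ_mul_vphi (c : Ubar k n →ₐ[k] S) (Z : Fin n → Fin N → S) :
    (normZ c fun j α => Z j α * c (vphi k j)) = Z := by
  funext j α
  rw [normZ, mul_assoc, map_vphi_mul_vph, mul_one]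

theorem normD_vph_mul (c : Ubar k n →ₐ[k] S) (d : Fin n → Fin N → S) :
    (normD c fun j α => c (vph k j) * d j α) = d := by
  funext j α
  rw [normD, ← mul_assoc, map_vphi_mul_vph, one_mul]

variable (k n N) in
/-- The normalized coordinate generators. -/
def nZ : Fin n → Fin N → Diff k n N := normZ (dC k n N) (dZ k n N)

variable (k n N) in
/-- The normalized derivative generators. -/
def nD : Fin n → Fin N → Diff k n N := normD (dC k n N) (dd k n N)

theorem dZ_eq (j : Fin n) (α : Fin N) : dZ k n N j α = nZ k n N j α * dC k n N (vphi k j) := by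
  rw [nZ, normZ, mul_assoc, map_vph_mul_vphi, mul_one]

theorem dd_eq (j : Fin n) (α : Fin N) : dd k n N j α = dC k n N (vph k j) * nD k n N j α := by
  rw [nD, normD, ← mul_assoc, map_vph_mul_vphi, one_mul]

theorem diff_algHom_ext_norm {f g : Diff k n N →ₐ[k] S}
    (hC : ∀ i, f (dC k n N (hh k n i)) = g (dC k n N (hh k n i)))
    (hZ : ∀ i α, f (nZ k n N i α) = g (nZ k n N i α))
    (hd : ∀ i α, f (nD k n N i α) = g (nD k n N i α)) : f = g := by
  have hC' : ∀ p, f (dC k n N p) = g (dC k n N p) := fun p =>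
    DFunLike.congr_fun (ubar_algHom_ext (c₁ := f.comp (dC k n N)) (c₂ := g.comp (dC k n N)) hC) p
  refine diff_algHom_ext hC' (fun i α => ?_) fun i α => ?_
  · rw [dZ_eq, map_mul, map_mul, hZ, hC']
  · rw [dd_eq, map_mul, map_mul, hd, hC']

theorem isDiffSys_permute (g : Equiv.Perm (Fin n)) :
    IsDiffSys ((dC k n N).comp (perm k g))
      (fun j α => nZ k n N (g j) α * (dC k n N).comp (perm k g) (vphi k j))
      (fun j α => (dC k n N).comp (perm k g) (vph k j) * nD k n N (g j) α) := by
  rw [isDiffSys_iff_isNormSys, normZ_mul_vphi, normD_vph_mul]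
  exact ((isDiffSys_iff_isNormSys.mp (isDiffSys_diff k n N)).permute g)

variable (k n N) in
/-- The automorphism of the ring of `h`-deformed differential operators given by a permutation. -/
def permHom (g : Equiv.Perm (Fin n)) : Diff k n N →ₐ[k] Diff k n N :=
  diffLift _ _ _ (isDiffSys_permute g)

theorem permHom_dC (g : Equiv.Perm (Fin n)) (p : Ubar k n) :
    permHom k n N g (dC k n N p) = dC k n N (perm k g p) := diffLift_dC _ _ _ _ _

theorem permHom_nZ (g : Equiv.Perm (Fin n)) (j : Fin n) (α : Fin N) :
    permHom k n N g (nZ k n N j α) = nZ k n N (g j) α := by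
  rw [nZ, normZ, map_mul, permHom_dC, permHom, diffLift_dZ]
  exact congrFun (congrFun (normZ_mul_vphi ((dC k n N).comp (perm k g)) fun j => nZ k n N (g j)) j) α

theorem permHom_nD (g : Equiv.Perm (Fin n)) (j : Fin n) (α : Fin N) :
    permHom k n N g (nD k n N j α) = nD k n N (g j) α := by
  rw [nD, normD, map_mul, permHom_dC, permHom, diffLift_dd]
  exact congrFun (congrFun (normD_vph_mul ((dC k n N).comp (perm k g)) fun j => nD k n N (g j)) j) α

theorem permHom_mul (g g' : Equiv.Perm (Fin n)) :
    permHom k n N (g * g') = (permHom k n N g).comp (permHom k n N g') :=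
  diff_algHom_ext_norm (fun i => by simp [permHom_dC]) (fun i α => by simp [permHom_nZ])
    (fun i α => by simp [permHom_nD])

theorem permHom_one : permHom k n N 1 = AlgHom.id k _ :=
  diff_algHom_ext_norm (fun i => by simp [permHom_dC]) (fun i α => by simp [permHom_nZ])
    (fun i α => by simp [permHom_nD])

variable (k n N) in
/-- The action of the symmetric group on the ring of `h`-deformed differential operators. -/
def permAction : Equiv.Perm (Fin n) →* (Diff k n N ≃ₐ[k] Diff k n N) where
  toFun g := AlgEquiv.ofAlgHom (permHom k n N g) (permHom k n N g⁻¹)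
    (by rw [← permHom_mul, mul_inv_cancel, permHom_one])
    (by rw [← permHom_mul, inv_mul_cancel, permHom_one])
  map_one' := AlgEquiv.ext fun x => DFunLike.congr_fun permHom_one x
  map_mul' g g' := AlgEquiv.ext fun x => DFunLike.congr_fun (permHom_mul g g') x

theorem permAction_apply (g : Equiv.Perm (Fin n)) (x : Diff k n N) :
    permAction k n N g x = permHom k n N g x := rfl

theorem permHom_dZ (g : Equiv.Perm (Fin n)) (j : Fin n) (α : Fin N) :
    permHom k n N g (dZ k n N j α)
      = dZ k n N (g j) α * dC k n N (vph k (g j) * perm k g (vphi k j)) := by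
  rw [dZ_eq, map_mul, permHom_nZ, permHom_dC, nZ, normZ, map_mul, mul_assoc]

theorem permHom_dd (g : Equiv.Perm (Fin n)) (j : Fin n) (α : Fin N) :
    permHom k n N g (dd k n N j α)
      = dC k n N (perm k g (vph k j) * vphi k (g j)) * dd k n N (g j) α := by
  rw [dd_eq, map_mul, permHom_nD, permHom_dC, nD, normD, map_mul, mul_assoc]

/-- The indices below b are a and those below a. The latter are fixed by the transposition, so φ_b
has just one additional factor. -/
theorem perm_swap_vph_left {a b : Fin n} (h : (b : ℕ) = a + 1) :
    perm k (Equiv.swap a b) (vph k a) * hd k n b a = vph k b := by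
  have hI : Finset.Iio b = insert a (Finset.Iio a) := by
    ext x; simp only [Finset.mem_Iio, Finset.mem_insert, Fin.lt_def, Fin.ext_iff]; omega
  rw [vph, vph, hI, Finset.prod_insert (by simp), map_prod, mul_comm]
  refine congrArg _ (Finset.prod_congr rfl fun x hx => ?_)
  have hx := Finset.mem_Iio.mp hx
  rw [perm_hd, Equiv.swap_apply_left, Equiv.swap_apply_of_ne_of_ne hx.ne
    (fun e => by rw [e, Fin.lt_def] at hx; omega)]

theorem perm_swap_vph_right {a b : Fin n} (h : (b : ℕ) = a + 1) :
    perm k (Equiv.swap a b) (vph k b) = vph k a * hd k n a b := by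
  have := congrArg (perm k (Equiv.swap a b)) (perm_swap_vph_left (k := k) h)
  rw [map_mul, perm_perm, Equiv.swap_mul_self, perm_one, perm_hd, Equiv.swap_apply_left,
    Equiv.swap_apply_right] at this
  exact this.symm

/-- Since a and b are neighbours different from j, either both or neither of them lie below j, and
the product is only reindexed. -/
theorem perm_swap_vph_other {a b j : Fin n} (h : (b : ℕ) = a + 1) (ha : j ≠ a) (hb : j ≠ b) :
    perm k (Equiv.swap a b) (vph k j) = vph k j := by
  rw [vph, map_prod]
  refine Finset.prod_equiv (Equiv.swap a b) (fun x => ?_) fun x _ => ?_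
  · have hj : (j : ℕ) ≠ a := fun e => ha (Fin.ext e)
    have hj' : (j : ℕ) ≠ b := fun e => hb (Fin.ext e)
    simp only [Finset.mem_Iio, Fin.lt_def]
    by_cases hxa : x = a
    · subst hxa; rw [Equiv.swap_apply_left]; omega
    by_cases hxb : x = b
    · subst hxb; rw [Equiv.swap_apply_right]; omega
    rw [Equiv.swap_apply_of_ne_of_ne hxa hxb]
  · rw [perm_hd, Equiv.swap_apply_of_ne_of_ne ha hb]

theorem perm_vph_mul_vphi (g : Equiv.Perm (Fin n)) (j : Fin n) :
    perm k g (vph k j) * perm k g (vphi k j) = 1 := by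
  rw [← map_mul, vph_mul_vphi, map_one]

theorem isDiffAction_permAction : IsDiffAction k n N (permAction k n N) := by
  intro a b h
  have hab : a ≠ b := fun e => by rw [e] at h; omega
  have h1 := perm_swap_vph_left (k := k) h
  have h2 := perm_swap_vph_right (k := k) h
  have h3 := perm_vph_mul_vphi (k := k) (Equiv.swap a b) a
  have h4 := perm_vph_mul_vphi (k := k) (Equiv.swap a b) b
  have h5 := vph_mul_vphi k a
  have h6 := vph_mul_vphi k b
  have h7 := hd_mul_hdInv k n hab
  have h8 := hd_swap k a b
  constructor
  · intro α
    rw [permAction_apply, permHom_dZ, Equiv.swap_apply_left]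
    refine Eq.trans ?_ (mul_neg (dZ k n N b α) (dCoef k n N (hd k n a b)))
    rw [← dC_apply, ← map_neg]
    congr 2
    linear_combination (-perm k (Equiv.swap a b) (vphi k a)) * h1 + h8 + hd k n b a * h3
  · intro α
    rw [permAction_apply, permHom_dZ, Equiv.swap_apply_right, ← dC_apply]
    congr 2
    rw [h2] at h4
    linear_combination hdInv k n a b * h4
      - vph k a * perm k (Equiv.swap a b) (vphi k b) * h7
  · intro j α ha hb
    rw [permAction_apply, permHom_dZ, Equiv.swap_apply_of_ne_of_ne ha hb]
    have h9 := perm_swap_vph_other (k := k) h ha hb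
    have h10 := perm_vph_mul_vphi (k := k) (Equiv.swap a b) j
    rw [h9] at h10
    rw [h10, map_one, mul_one]
  · intro α
    rw [permAction_apply, permHom_dd, Equiv.swap_apply_left]
    refine Eq.trans ?_ (neg_mul (dCoef k n N (hdInv k n a b)) (dd k n N b α))
    rw [← dC_apply, ← map_neg]
    congr 2
    linear_combination (-hdInv k n a b) * h6 + (hdInv k n a b * vphi k b) * (-h1)
      + perm k (Equiv.swap a b) (vph k a) * vphi k b * (hdInv k n a b * h8 - h7)
  · intro α
    rw [permAction_apply, permHom_dd, Equiv.swap_apply_right, ← dC_apply]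
    congr 2
    rw [h2]
    linear_combination hd k n a b * h5
  · intro j α ha hb
    rw [permAction_apply, permHom_dd, Equiv.swap_apply_of_ne_of_ne ha hb,
      perm_swap_vph_other h ha hb, vph_mul_vphi, map_one, one_mul]
  · intro j
    rw [permAction_apply, ← dC_apply, permHom_dC, perm_hh, dC_apply]

theorem IsSimpleAut.unique {a b : Fin n} {s t : Diff k n N ≃ₐ[k] Diff k n N}
    (hs : IsSimpleAut k n N a b s) (ht : IsSimpleAut k n N a b t) : s = t := by
  have : (s : Diff k n N →ₐ[k] Diff k n N) = t := by
    refine diff_algHom_ext (fun p => ?_) (fun j α => ?_) fun j α => ?_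
    · exact DFunLike.congr_fun (ubar_algHom_ext
        (c₁ := (s : Diff k n N →ₐ[k] Diff k n N).comp (dC k n N))
        (c₂ := (t : Diff k n N →ₐ[k] Diff k n N).comp (dC k n N))
        fun i => (hs.h_perm i).trans (ht.h_perm i).symm) p
    · by_cases ha : j = a
      · subst ha; exact (hs.Z_left α).trans (ht.Z_left α).symm
      by_cases hb : j = b
      · subst hb; exact (hs.Z_right α).trans (ht.Z_right α).symm
      exact (hs.Z_other j α ha hb).trans (ht.Z_other j α ha hb).symm
    · by_cases ha : j = a
      · subst ha; exact (hs.d_left α).trans (ht.d_left α).symm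
      by_cases hb : j = b
      · subst hb; exact (hs.d_right α).trans (ht.d_right α).symm
      exact (hs.d_other j α ha hb).trans (ht.d_other j α ha hb).symm
  exact AlgEquiv.ext fun x => DFunLike.congr_fun this x

theorem IsDiffAction.eq_permAction {A : Equiv.Perm (Fin n) →* (Diff k n N ≃ₐ[k] Diff k n N)}
    (h : IsDiffAction k n N A) : A = permAction k n N := by
  -- Simple transpositions generate the symmetric group; for n = 0 the group is trivial.
  cases n with
  | zero =>
    refine MonoidHom.ext fun g => ?_
    rw [Subsingleton.elim g 1, map_one, map_one]
  | succ n =>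
    refine MonoidHom.eq_of_eqOn_denseM (Equiv.Perm.mclosure_swap_castSucc_succ n) ?_
    rintro _ ⟨i, rfl⟩
    exact (h _ _ (by simp)).unique (isDiffAction_permAction _ _ (by simp))

end Action

section Image

/-- The factor relating `∑ Z^{j,α} ∂_{i,α}` to its normalized version. -/
def normFactor (k : Type*) [CommRing k] {n : ℕ} (i j : Fin n) : Ubar k n :=
  trans k (-ew j) (vphi k j * vph k i)

/-- The inverse of `normFactor`. -/
def normFactorInv (k : Type*) [CommRing k] {n : ℕ} (i j : Fin n) : Ubar k n :=
  trans k (-ew j) (vph k j * vphi k i)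

theorem normFactorInv_mul (i j : Fin n) : normFactorInv k i j * normFactor k i j = 1 := by
  rw [normFactor, normFactorInv, ← map_mul]
  refine (congrArg _ ?_).trans (map_one _)
  linear_combination vphi k i * vph k i * vph_mul_vphi k j + vphi_mul_vph k i

theorem sumZd_eq (i j : Fin n) : sumZd (dZ k n N) (dd k n N) i j
    = dC k n N (normFactor k i j) * sumZd (nZ k n N) (nD k n N) i j := by
  have hw := (isDiffSys_iff_isNormSys.mp (isDiffSys_diff k n N)).weight_Z
  simp only [sumZd, Finset.mul_sum]
  refine Finset.sum_congr rfl fun α _ => ?_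
  rw [dZ_eq, dd_eq, mul_assoc, ← mul_assoc (dC k n N _), ← map_mul, ← mul_assoc]
  rw [nZ, Z_mul_coef hw, mul_assoc]
  rfl

/-- The normalized sums are permuted without factors. Passing to them and back costs an element of
Ū(h), which also lies in the image of τ. -/
theorem permHom_sumZd (g : Equiv.Perm (Fin n)) (i j : Fin n) :
    permHom k n N g (sumZd (dZ k n N) (dd k n N) i j)
      = dC k n N (perm k g (normFactor k i j) * normFactorInv k (g i) (g j))
        * sumZd (dZ k n N) (dd k n N) (g i) (g j) := by
  rw [sumZd_eq, sumZd_eq, map_mul, permHom_dC, ← mul_assoc, ← map_mul, mul_assoc,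
    normFactorInv_mul, mul_one]
  simp only [sumZd, map_sum, map_mul, permHom_nZ, permHom_nD]

variable (k n) in
/-- The images of the generators `L` under a permutation. -/
def permL (g : Equiv.Perm (Fin n)) (i j : Fin n) : Red k n :=
  rC k n (perm k g (normFactor k i j) * normFactorInv k (g i) (g j)) * rL k n (g i) (g j)

theorem tau_rC (p : Ubar k n) : tau k n N (rC k n p) = dC k n N p := isTau_tau.coef p

theorem tau_rL (i j : Fin n) : tau k n N (rL k n i j) = sumZd (dZ k n N) (dd k n N) i j :=
  isTau_tau.L i j

theorem tau_permL (g : Equiv.Perm (Fin n)) (i j : Fin n) :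
    tau k n N (permL k n g i j) = permHom k n N g (tau k n N (rL k n i j)) := by
  rw [permL, map_mul, tau_rC, tau_rL, tau_rL, permHom_sumZd]

theorem permHom_tau_mem (g : Equiv.Perm (Fin n)) (x : Red k n) :
    permHom k n N g (tau k n N x) ∈ (tau k n N).range := by
  induction x using red_induction with
  | coef p => exact ⟨rC k n (perm k g p), by
      rw [tau_rC, permHom_dC]; exact tau_rC _⟩
  | L i j => exact ⟨permL k n g i j, tau_permL g i j⟩
  | add x y hx hy => rw [map_add, map_add]; exact add_mem hx hy
  | mul x y hx hy => rw [map_mul, map_mul]; exact mul_mem hx hy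

theorem map_range_tau (g : Equiv.Perm (Fin n)) :
    (tau k n N).range.map (permAction k n N g : Diff k n N →ₐ[k] Diff k n N)
      = (tau k n N).range := by
  refine le_antisymm ?_ ?_
  · rintro _ ⟨_, ⟨x, rfl⟩, rfl⟩
    exact permHom_tau_mem g x
  · rintro _ ⟨x, rfl⟩
    refine ⟨permHom k n N g⁻¹ (tau k n N x), permHom_tau_mem g⁻¹ x, ?_⟩
    change permHom k n N g (permHom k n N g⁻¹ (tau k n N x)) = tau k n N x
    rw [← AlgHom.comp_apply, ← permHom_mul, mul_inv_cancel, permHom_one, AlgHom.id_apply]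

section Transfer

variable {T : Type*} [Ring T] [Algebra k T]

theorem mapMatrix_mL (f : S →ₐ[k] T) (L : Fin n → Fin n → S) :
    f.mapMatrix (mL L) = mL fun i j => f (L i j) := by
  refine Matrix.ext fun r x => ?_
  simp only [AlgHom.mapMatrix_apply, map_apply, mL, apply_ite f, map_zero]

theorem mapMatrix_mY (f : S →ₐ[k] T) (c : Ubar k n →ₐ[k] S) (L : Fin n → Fin n → S) :
    f.mapMatrix (mY c L) = mY (f.comp c) fun i j => f (L i j) := by
  rw [mY, map_sub, map_mul, map_mul, mapMatrix_mL]
  rfl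

theorem IsRedSys.map {c : Ubar k n →ₐ[k] S} {L : Fin n → Fin n → S} (h : IsRedSys c L)
    (f : S →ₐ[k] T) : IsRedSys (f.comp c) fun i j => f (L i j) := by
  constructor
  · intro p i j
    rw [AlgHom.comp_apply, ← map_mul, h.weight, map_mul, AlgHom.comp_apply]
  · rw [← mapMatrix_mL, ← mapMatrix_mY, ← map_mul, h.reflection, map_mul]

theorem IsRedSys.of_injective {c : Ubar k n →ₐ[k] S} {L : Fin n → Fin n → S} (f : S →ₐ[k] T)
    (hf : Function.Injective f) (h : IsRedSys (f.comp c) fun i j => f (L i j)) :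
    IsRedSys c L := by
  constructor
  · intro p i j
    apply hf
    rw [map_mul, map_mul]
    exact h.weight p i j
  · have hr := h.reflection
    rw [← mapMatrix_mL, ← mapMatrix_mY, ← map_mul, ← map_mul] at hr
    exact Matrix.map_injective hf hr

end Transfer

/-- Under τ_n the proposed images become the images of the L_i^j under an automorphism of Diff, so
the relations hold there; injectivity brings them back. -/
theorem isRedSys_permL (hinj : Function.Injective (tau k n n)) (g : Equiv.Perm (Fin n)) :
    IsRedSys ((rC k n).comp (perm k g)) (permL k n g) := by
  refine IsRedSys.of_injective (tau k n n) hinj ?_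
  have := (isRedSys_red k n).map ((permHom k n n g).comp (tau k n n))
  have e1 : (tau k n n).comp ((rC k n).comp (perm k g))
      = ((permHom k n n g).comp (tau k n n)).comp (rC k n) := AlgHom.ext fun p => by
    simp only [AlgHom.comp_apply, tau_rC, permHom_dC]
  rw [e1]
  simp only [tau_permL]
  exact this

/-- The endomorphism of the diagonal reduction algebra given by a permutation. -/
def redPermHom (hinj : Function.Injective (tau k n n)) (g : Equiv.Perm (Fin n)) :
    Red k n →ₐ[k] Red k n := redLift _ _ (isRedSys_permL hinj g)

/-- Injectivity for N = n is needed to define the endomorphism, but its values on generators are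
formulas independent of N. This gives compatibility for every N, including N < n. -/
theorem tau_redPermHom (hinj : Function.Injective (tau k n n)) (g : Equiv.Perm (Fin n))
    (x : Red k n) : tau k n N (redPermHom hinj g x) = permHom k n N g (tau k n N x) := by
  have : (tau k n N).comp (redPermHom hinj g) = (permHom k n N g).comp (tau k n N) := by
    refine red_algHom_ext (fun p => ?_) fun i j => ?_
    · rw [AlgHom.comp_apply, AlgHom.comp_apply, redPermHom, redLift_rC, AlgHom.comp_apply, tau_rC,
        tau_rC, permHom_dC]
    · rw [AlgHom.comp_apply, AlgHom.comp_apply, redPermHom, redLift_rL, tau_permL]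
  exact DFunLike.congr_fun this x

theorem redPermHom_mul (hinj : Function.Injective (tau k n n)) (g g' : Equiv.Perm (Fin n)) :
    redPermHom hinj (g * g') = (redPermHom hinj g).comp (redPermHom hinj g') :=
  AlgHom.ext fun x => hinj <| by
    rw [AlgHom.comp_apply, tau_redPermHom, tau_redPermHom, tau_redPermHom, permHom_mul,
      AlgHom.comp_apply]

theorem redPermHom_one (hinj : Function.Injective (tau k n n)) :
    redPermHom hinj 1 = AlgHom.id k (Red k n) :=
  AlgHom.ext fun x => hinj <| by rw [tau_redPermHom, permHom_one, AlgHom.id_apply, AlgHom.id_apply]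

/-- The action of the symmetric group on the diagonal reduction algebra. -/
def redPermAction (hinj : Function.Injective (tau k n n)) :
    Equiv.Perm (Fin n) →* (Red k n ≃ₐ[k] Red k n) where
  toFun g := AlgEquiv.ofAlgHom (redPermHom hinj g) (redPermHom hinj g⁻¹)
    (by rw [← redPermHom_mul, mul_inv_cancel, redPermHom_one])
    (by rw [← redPermHom_mul, inv_mul_cancel, redPermHom_one])
  map_one' := AlgEquiv.ext fun x => DFunLike.congr_fun (redPermHom_one hinj) x
  map_mul' g g' := AlgEquiv.ext fun x => DFunLike.congr_fun (redPermHom_mul hinj g g') x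

end Image

end

end HDiff

/-! ### Weyl operators, and rows with exchange relations -/

namespace HDiff

noncomputable section

open Matrix

section Weyl

variable {S ι : Type*} [Ring S] [DecidableEq ι]

/-- Commuting invertible elements `X` and Euler operators `θ` with `[θᵥ, X_w] = δ X_w`. -/
structure IsWeyl (X Xi θ : ι → S) : Prop where
  X_mul_Xi : ∀ v, X v * Xi v = 1
  Xi_mul_X : ∀ v, Xi v * X v = 1
  X_comm : ∀ v w, X v * X w = X w * X v
  θ_comm : ∀ v w, θ v * θ w = θ w * θ v
  θ_X : ∀ v w, θ v * X w = X w * θ v + if v = w then X w else 0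

namespace IsWeyl

variable {X Xi θ : ι → S} (h : IsWeyl X Xi θ)
include h

theorem Xi_X (v w : ι) : Xi v * X w = X w * Xi v := by
  calc Xi v * X w = Xi v * (X w * X v) * Xi v := by
        rw [mul_assoc, mul_assoc (X w), h.X_mul_Xi, mul_one]
    _ = X w * Xi v := by rw [h.X_comm, ← mul_assoc, h.Xi_mul_X, one_mul]

theorem Xi_comm (v w : ι) : Xi v * Xi w = Xi w * Xi v := by
  calc Xi v * Xi w = Xi w * (X w * Xi v) * Xi w := by
        rw [← mul_assoc, h.Xi_mul_X, one_mul]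
    _ = Xi w * Xi v := by rw [← h.Xi_X, mul_assoc, mul_assoc, h.X_mul_Xi, mul_one]

theorem θ_Xi (v w : ι) : θ v * Xi w = Xi w * θ v - if v = w then Xi w else 0 := by
  have h1 : Xi w * (θ v * X w) * Xi w = θ v * Xi w + if v = w then Xi w else 0 := by
    rw [h.θ_X, mul_add, ← mul_assoc, h.Xi_mul_X, one_mul, add_mul]
    split_ifs
    · rw [h.Xi_mul_X, one_mul]
    · rw [mul_zero, zero_mul]
  rw [eq_sub_iff_add_eq, ← h1, mul_assoc, mul_assoc, h.X_mul_Xi, mul_one]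

theorem X_θ_of_ne {v w : ι} (hvw : v ≠ w) : Commute (X v) (θ w) := by
  have := h.θ_X w v
  rw [if_neg (Ne.symm hvw), add_zero] at this
  exact this.symm

theorem Xi_θ_of_ne {v w : ι} (hvw : v ≠ w) : Commute (Xi v) (θ w) := by
  have := h.θ_Xi w v
  rw [if_neg (Ne.symm hvw), sub_zero] at this
  exact this.symm

theorem P_X (v w : ι) : Xi v * θ v * X w = X w * (Xi v * θ v) + if v = w then 1 else 0 := by
  rw [mul_assoc, h.θ_X, mul_add, ← mul_assoc, h.Xi_X, mul_assoc]
  split_ifs with e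
  · subst e; rw [h.Xi_mul_X]
  · rw [mul_zero]

theorem θ_P (v w : ι) :
    θ v * (Xi w * θ w) = Xi w * θ w * θ v - if v = w then Xi w * θ w else 0 := by
  rw [← mul_assoc, h.θ_Xi, sub_mul, mul_assoc, h.θ_comm v, mul_assoc]
  split_ifs <;> simp

theorem P_comm (v w : ι) : Xi v * θ v * (Xi w * θ w) = Xi w * θ w * (Xi v * θ v) := by
  by_cases e : v = w
  · rw [e]
  · rw [mul_assoc, h.θ_P, if_neg e, sub_zero, mul_assoc (Xi w), h.θ_comm w v, ← mul_assoc,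
      ← mul_assoc, h.Xi_comm, mul_assoc (Xi w), mul_assoc (Xi w), mul_assoc (Xi w), mul_assoc,
      ← mul_assoc (θ w), h.θ_Xi, if_neg (Ne.symm e), sub_zero]
    simp only [mul_assoc, h.θ_comm w v]

end IsWeyl

end Weyl

section Row

variable {S : Type*} [Ring S] {m : ℕ}

/-- The factor relating rows of consecutive sizes. -/
def rowStep (x P : Fin (m + 1) → S) (Θ u : S) (α : Fin (m + 1)) (j : Fin (m + 2)) : S :=
  Fin.lastCases (motive := fun _ => S) (if α = Fin.last m then u - Θ else -P α)
    (fun j => if α = Fin.last m then x j else if α = j then 1 else 0) j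

theorem rowStep_last (x P : Fin (m + 1) → S) (Θ u : S) (α : Fin (m + 1)) :
    rowStep x P Θ u α (Fin.last (m + 1)) = if α = Fin.last m then u - Θ else -P α :=
  Fin.lastCases_last

theorem rowStep_castSucc (x P : Fin (m + 1) → S) (Θ u : S) (α j : Fin (m + 1)) :
    rowStep x P Θ u α j.castSucc = if α = Fin.last m then x j else if α = j then 1 else 0 :=
  Fin.lastCases_castSucc _

/-- A relation of RTT type for a matrix of degree at most one in the spectral parameter u, verified
entry by entry from the Heisenberg relations; Θ is the Euler operator, under which x and P have
degrees 1 and -1. -/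
theorem rowStep_commutator {x P : Fin (m + 1) → S} {Θ u v : S} (hxx : ∀ i j, x i * x j = x j * x i)
    (hPP : ∀ i j, P i * P j = P j * P i)
    (hPx : ∀ i j, P i * x j = x j * P i + if i = j then 1 else 0)
    (hΘx : ∀ j, Θ * x j = x j * Θ + x j) (hΘP : ∀ j, Θ * P j = P j * Θ - P j)
    (huv : u * v = v * u) (hux : ∀ j, u * x j = x j * u) (hvx : ∀ j, v * x j = x j * v)
    (huP : ∀ j, u * P j = P j * u) (hvP : ∀ j, v * P j = P j * v) (huΘ : u * Θ = Θ * u)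
    (hvΘ : v * Θ = Θ * v) (α β : Fin (m + 1)) (j l : Fin (m + 2)) :
    (u - v) * (rowStep x P Θ u α j * rowStep x P Θ v β l
        - rowStep x P Θ v β l * rowStep x P Θ u α j)
      = rowStep x P Θ u α l * rowStep x P Θ v β j
        - rowStep x P Θ v α l * rowStep x P Θ u β j := by
  induction j using Fin.lastCases with
  | last =>
    induction l using Fin.lastCases with
    | last =>
      simp only [rowStep_last]
      split_ifs
      · have e : (u - Θ) * (v - Θ) = (v - Θ) * (u - Θ) := by
          simp only [sub_mul, mul_sub, huv, huΘ, hvΘ]; abel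
        rw [e, sub_self, mul_zero]
      · have e : (u - Θ) * -P β - -P β * (u - Θ) = -P β := by
          simp only [sub_mul, mul_sub, mul_neg, neg_mul, huP, hΘP]; abel
        rw [e, ← sub_mul]; congr 1; abel
      · have e : -P α * (v - Θ) - (v - Θ) * -P α = P α := by
          simp only [sub_mul, mul_sub, mul_neg, neg_mul, hvP, hΘP]; abel
        rw [e]; simp only [sub_mul, mul_sub, neg_mul, huP, hvP]; abel
      · rw [neg_mul_neg, neg_mul_neg, hPP, sub_self, mul_zero]
    | cast l =>
      simp only [rowStep_last, rowStep_castSucc]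
      split_ifs with h1 h2 h3 h4 h5
      · have e : (u - Θ) * x l - x l * (u - Θ) = -x l := by
          simp only [sub_mul, mul_sub, hux, hΘx]; abel
        rw [e]; simp only [sub_mul, mul_sub, mul_neg, hux, hvx]; abel
      · simp
      · simp
      · have e : -P α * x l - x l * -P α = -1 := by
          simp only [neg_mul, mul_neg, hPx, if_pos h5]; abel
        rw [e]; simp
      · have e : -P α * x l - x l * -P α = 0 := by
          simp only [neg_mul, mul_neg, hPx, if_neg h5]; abel
        rw [e]; simp
      all_goals simp
  | cast j =>
    induction l using Fin.lastCases with
    | last =>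
      simp only [rowStep_last, rowStep_castSucc]
      split_ifs with h1 h2 h3 h4
      · have e : x j * (v - Θ) - (v - Θ) * x j = x j := by
          simp only [sub_mul, mul_sub, hvx, hΘx]; abel
        rw [e]; simp only [sub_mul]; abel
      · have e : x j * -P β - -P β * x j = 1 := by
          simp only [neg_mul, mul_neg, hPx, if_pos h3]; abel
        rw [e]; simp
      · have e : x j * -P β - -P β * x j = 0 := by
          simp only [neg_mul, mul_neg, hPx, if_neg h3]; abel
        rw [e]; simp
      all_goals simp
    | cast l =>
      simp only [rowStep_castSucc]
      split_ifs <;> simp [hxx]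

/-- As with coproducts of Yangians: a row with the exchange relation, multiplied by a matrix with
the RTT relation whose entries commute with the row, again has the exchange relation. -/
theorem rowStep_exchange {u v : S} {a b : Fin (m + 1) → S} {t t' : Fin (m + 1) → Fin (m + 2) → S}
    (hab : ∀ α β, (u - v) * (a α * b β) = a β * b α + (u - v - 1) * (b β * a α))
    (hua : ∀ α, u * a α = a α * u) (hub : ∀ α, u * b α = b α * u)
    (hva : ∀ α, v * a α = a α * v) (hvb : ∀ α, v * b α = b α * v)
    (htb : ∀ α j β, t α j * b β = b β * t α j)
    (hta' : ∀ α j β, t' α j * a β = a β * t' α j)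
    (htt : ∀ α β j l, (u - v) * (t α j * t' β l - t' β l * t α j)
      = t α l * t' β j - t' α l * t β j) (j l : Fin (m + 2)) :
    (u - v) * ((∑ α, a α * t α j) * ∑ β, b β * t' β l)
      = (∑ α, a α * t α l) * (∑ β, b β * t' β j)
        + (u - v - 1) * ((∑ β, b β * t' β l) * ∑ α, a α * t α j) := by
  have e1 : ∀ j l, (∑ α, a α * t α j) * (∑ β, b β * t' β l)
      = ∑ α, ∑ β, a α * b β * (t α j * t' β l) := by
    intro j l
    rw [Finset.sum_mul_sum]
    refine Finset.sum_congr rfl fun α _ => Finset.sum_congr rfl fun β _ => ?_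
    rw [mul_assoc, ← mul_assoc (t α j), htb]; simp only [mul_assoc]
  have e2 : (u - v - 1) * ((∑ β, b β * t' β l) * ∑ α, a α * t α j)
      = ∑ α, ∑ β, (u - v) * (a α * b β * (t' β l * t α j))
        - ∑ α, ∑ β, a α * b β * (t' α l * t β j) := by
    rw [Finset.sum_mul_sum, Finset.sum_comm, Finset.sum_comm (f := fun α β => a α * b β * _),
      ← Finset.sum_sub_distrib, Finset.mul_sum]
    refine Finset.sum_congr rfl fun α _ => ?_
    rw [← Finset.sum_sub_distrib, Finset.mul_sum]
    refine Finset.sum_congr rfl fun β _ => ?_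
    have e3 := hab α β
    rw [← sub_eq_iff_eq_add'] at e3
    rw [mul_assoc (b β), ← mul_assoc (t' β l), hta', mul_assoc (a α), ← mul_assoc (b β),
      ← mul_assoc, ← e3, sub_mul, mul_assoc]
  have e4 : ∀ α β, (u - v) * (a α * b β * (t α j * t' β l)) = a α * b β * (t α l * t' β j)
      + ((u - v) * (a α * b β * (t' β l * t α j)) - a α * b β * (t' α l * t β j)) := by
    intro α β
    have hc : (u - v) * (a α * b β) = a α * b β * (u - v) := by
      rw [sub_mul, mul_sub, ← mul_assoc, hua, mul_assoc, hub, ← mul_assoc v, hva, mul_assoc (a α) v,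
        hvb]
      simp only [mul_assoc]
    have e5 := congrArg (a α * b β * ·) (htt α β j l)
    rw [← mul_assoc (a α * b β) (u - v), ← hc, mul_sub ((u - v) * _), mul_sub (a α * b β),
      mul_assoc (u - v), mul_assoc (u - v)] at e5
    rw [sub_eq_iff_eq_add.mp e5]; abel
  rw [e1, e1, e2]
  simp only [Finset.mul_sum, e4, Finset.sum_add_distrib, Finset.sum_sub_distrib]

/-- The matrix with last row `(0, …, 0, 1)` and last column `(e, 1)`. -/
def bordered (E : Matrix (Fin m) (Fin m) S) (e : Fin m → S) :
    Matrix (Fin (m + 1)) (Fin (m + 1)) S := fun s j =>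
  Fin.lastCases (motive := fun _ => S)
    (Fin.lastCases (motive := fun _ => S) 1 (fun _ => 0) j)
    (fun s => Fin.lastCases (motive := fun _ => S) (e s) (fun j => E s j) j) s

section Bordered

variable (E F : Matrix (Fin m) (Fin m) S) (e f : Fin m → S) (s j : Fin m)

@[simp] theorem bordered_last_last : bordered E e (Fin.last m) (Fin.last m) = 1 := by
  simp [bordered]

@[simp] theorem bordered_last_castSucc : bordered E e (Fin.last m) j.castSucc = 0 := by
  simp [bordered]

@[simp] theorem bordered_castSucc_last : bordered E e s.castSucc (Fin.last m) = e s := by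
  simp [bordered]

@[simp] theorem bordered_castSucc : bordered E e s.castSucc j.castSucc = E s j := by
  simp [bordered]

theorem bordered_mul : bordered E e * bordered F f = bordered (E * F) (E *ᵥ f + e) := by
  refine Matrix.ext fun s j => ?_
  rw [Matrix.mul_apply, Fin.sum_univ_castSucc]
  induction s using Fin.lastCases <;> induction j using Fin.lastCases <;>
    simp [Matrix.mul_apply, Matrix.mulVec, dotProduct]

theorem bordered_one : bordered (1 : Matrix (Fin m) (Fin m) S) 0 = 1 := by
  refine Matrix.ext fun s j => ?_
  induction s using Fin.lastCases <;> induction j using Fin.lastCases <;>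
    simp [Matrix.one_apply, (Fin.castSucc_lt_last _).ne, (Fin.castSucc_lt_last _).ne']

end Bordered

/-- The row `(1, u, u², …) C`. -/
def row {m : ℕ} (C : Matrix (Fin m) (Fin m) S) (u : S) (α : Fin m) : S :=
  ∑ s : Fin m, u ^ (s : ℕ) * C s α

theorem commute_row {C : Matrix (Fin m) (Fin m) S} {y u : S} (hu : Commute y u)
    (hC : ∀ s α, Commute y (C s α)) (α : Fin m) : Commute y (row C u α) :=
  Commute.sum_right _ _ _ fun s _ => (hu.pow_right _).mul_right (hC s α)

/-- Induction on the length: the row of coefficient matrix C is multiplied by a `rowStep` in fresh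
variables of level m. The statement carries the corner entry 1, which is the leading coefficient of
the next last column, and the fact that only levels below m occur in C, so that the new factor
commutes with it. -/
theorem exists_row_succ {X Xi θ : ℕ × ℕ → S} (h : IsWeyl X Xi θ) (m : ℕ) :
    ∃ C Ci : Matrix (Fin (m + 1)) (Fin (m + 1)) S, C * Ci = 1 ∧ Ci * C = 1 ∧
      C (Fin.last m) (Fin.last m) = 1 ∧
      (∀ y, (∀ w : ℕ × ℕ, w.1 < m → Commute y (X w) ∧ Commute y (Xi w) ∧ Commute y (θ w)) →
        ∀ s α, Commute y (C s α)) ∧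
      ∀ u v, Commute u v → (∀ w, Commute u (X w) ∧ Commute u (Xi w) ∧ Commute u (θ w)) →
        (∀ w, Commute v (X w) ∧ Commute v (Xi w) ∧ Commute v (θ w)) → ∀ α β,
        (u - v) * (row C u α * row C v β)
          = row C u β * row C v α + (u - v - 1) * (row C v β * row C u α) := by
  induction m with
  | zero =>
    refine ⟨1, 1, one_mul 1, one_mul 1, by simp, fun y _ s α => ?_, fun u v _ _ _ α β => ?_⟩
    · rw [Matrix.one_apply]; split_ifs
      · exact Commute.one_right y
      · exact Commute.zero_right y
    · obtain rfl : α = 0 := Fin.fin_one_eq_zero α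
      obtain rfl : β = 0 := Fin.fin_one_eq_zero β
      simp [row]
  | succ m ih =>
    obtain ⟨C, Ci, h1, h2, h3, h4, h5⟩ := ih
    let x : Fin (m + 1) → S := fun j => X (m, j)
    let P : Fin (m + 1) → S := fun j => Xi (m, j) * θ (m, j)
    let Θ : S := ∑ j : Fin (m + 1), θ (m, j)
    let t₀ : Matrix (Fin (m + 1)) (Fin (m + 1)) S := fun α j =>
      if α = Fin.last m then x j else if α = j then 1 else 0
    -- The inverse of `t₀`. Solving for the last coordinate divides by X (m, m), which is why
    -- invertible coordinates are used.
    let t₁ : Matrix (Fin (m + 1)) (Fin (m + 1)) S := fun α j =>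
      if α = Fin.last m then (if j = Fin.last m then Xi (m, m) else -(Xi (m, m) * x j))
      else if α = j then 1 else 0
    let τ : Fin (m + 1) → S := fun α => if α = Fin.last m then -Θ else -P α
    -- Multiplication by u moves the coefficients of the last column of C up by one degree. The top
    -- one, in degree m + 1, is the corner entry 1.
    let c₀ : Fin (m + 2) → S := Fin.cases 0 fun s => C s (Fin.last m)
    let c' : Fin (m + 1) → S := fun s => c₀ s.castSucc
    have hne : ∀ j : Fin m, j.castSucc ≠ Fin.last m := fun j => (Fin.castSucc_lt_last j).ne
    have ht : t₀ * t₁ = 1 := by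
      refine Matrix.ext fun α j => ?_
      rw [Matrix.mul_apply, Fin.sum_univ_castSucc]
      induction α using Fin.lastCases with
      | last =>
        induction j using Fin.lastCases with
        | last => simp [t₀, t₁, hne, x, h.X_mul_Xi]
        | cast j => simp [t₀, t₁, hne, (hne _).symm, x, ← mul_assoc, h.X_mul_Xi]
      | cast α =>
        induction j using Fin.lastCases with
        | last => simp [t₀, t₁, hne]
        | cast j => simp [t₀, t₁, hne, Matrix.one_apply]
    have ht' : t₁ * t₀ = 1 := by
      refine Matrix.ext fun α j => ?_
      rw [Matrix.mul_apply, Fin.sum_univ_castSucc]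
      induction α using Fin.lastCases with
      | last =>
        induction j using Fin.lastCases with
        | last => simp [t₀, t₁, hne, x, h.Xi_mul_X]
        | cast j => simp [t₀, t₁, hne, (hne _).symm, x]
      | cast α =>
        induction j using Fin.lastCases with
        | last => simp [t₀, t₁, hne]
        | cast j => simp [t₀, t₁, hne, Matrix.one_apply]
    have hc : C * t₀ * (t₁ * Ci) = 1 := by
      rw [mul_assoc, ← mul_assoc t₀, ht, one_mul, h1]
    have hc' : t₁ * Ci * (C * t₀) = 1 := by
      rw [mul_assoc, ← mul_assoc Ci, h2, one_mul, ht']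
    refine ⟨bordered (C * t₀) (C *ᵥ τ + c'), bordered (t₁ * Ci) (-((t₁ * Ci) *ᵥ (C *ᵥ τ + c'))),
      ?_, ?_, by simp, ?_, ?_⟩
    · rw [bordered_mul, hc, Matrix.mulVec_neg, Matrix.mulVec_mulVec, hc, Matrix.one_mulVec,
        neg_add_cancel, bordered_one]
    · rw [bordered_mul, hc', add_neg_cancel, bordered_one]
    · intro y hy s α
      have hC := h4 y fun w hw => hy w (by omega)
      have hx : ∀ j, Commute y (x j) := fun j => (hy (m, j) (by simp)).1
      have hP : ∀ j, Commute y (P j) := fun j =>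
        (hy (m, j) (by simp)).2.1.mul_right (hy (m, j) (by simp)).2.2
      have hΘ : Commute y Θ := Commute.sum_right _ _ _ fun j _ => (hy (m, j) (by simp)).2.2
      have ht₀ : ∀ α j, Commute y (t₀ α j) := by
        intro α j
        simp only [t₀]; split_ifs
        exacts [hx j, Commute.one_right y, Commute.zero_right y]
      have hτ : ∀ α, Commute y (τ α) := by
        intro α
        simp only [τ]; split_ifs
        exacts [hΘ.neg_right, (hP α).neg_right]
      have hc₀ : ∀ s, Commute y (c₀ s) := by
        intro s
        induction s using Fin.cases
        exacts [Commute.zero_right y, hC _ _]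
      induction s using Fin.lastCases <;> induction α using Fin.lastCases <;>
        simp only [bordered_last_last, bordered_castSucc_last, bordered_last_castSucc,
          bordered_castSucc, Pi.add_apply, Matrix.mulVec, dotProduct, Matrix.mul_apply]
      · exact Commute.one_right y
      · exact Commute.zero_right y
      · exact (Commute.sum_right _ _ _ fun j _ => (hC _ _).mul_right (hτ j)).add_right (hc₀ _)
      · exact Commute.sum_right _ _ _ fun j _ => (hC _ _).mul_right (ht₀ j _)
    · have hrow : ∀ u, (∀ w, Commute u (X w) ∧ Commute u (Xi w) ∧ Commute u (θ w)) → ∀ j,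
          row (bordered (C * t₀) (C *ᵥ τ + c')) u j = ∑ α, row C u α * rowStep x P Θ u α j := by
        intro u hu j
        have hC := h4 u fun w _ => hu w
        rw [row, Fin.sum_univ_castSucc]
        induction j using Fin.lastCases with
        | last =>
          have hB : ∑ s : Fin (m + 1), u ^ (s : ℕ) * c' s + u ^ (m + 1)
              = row C u (Fin.last m) * u := by
            have e : ∑ s : Fin (m + 1), u ^ (s : ℕ) * c' s + u ^ (m + 1)
                = ∑ s : Fin (m + 2), u ^ (s : ℕ) * c₀ s := by
              rw [Fin.sum_univ_castSucc (n := m + 1)]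
              simp only [Fin.val_castSucc, Fin.val_last]
              rw [← Fin.succ_last, show c₀ (Fin.last m).succ = 1 from h3, mul_one]
            rw [e, Fin.sum_univ_succ, row, Finset.sum_mul]
            simp only [c₀, Fin.cases_zero, Fin.cases_succ, mul_zero, zero_add, Fin.val_succ]
            exact Finset.sum_congr rfl fun s _ => by
              rw [pow_succ, mul_assoc, mul_assoc, (hC s _).eq]
          have e2 : ∀ α, rowStep x P Θ u α (Fin.last (m + 1))
              = τ α + if α = Fin.last m then u else 0 := by
            intro α
            rw [rowStep_last]; simp only [τ]
            split_ifs
            · abel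
            · rw [add_zero]
          simp only [e2, mul_add, Finset.sum_add_distrib, mul_ite, mul_zero, Finset.sum_ite_eq',
            Finset.mem_univ, if_true, ← hB, bordered_castSucc_last, bordered_last_last, mul_one,
            Pi.add_apply, Fin.val_castSucc, Fin.val_last, ← add_assoc]
          congr 2
          simp only [Matrix.mulVec, dotProduct, Finset.mul_sum, row, Finset.sum_mul, mul_assoc]
          exact Finset.sum_comm
        | cast j =>
          simp only [bordered_castSucc, bordered_last_castSucc, mul_zero, add_zero,
            Fin.val_castSucc, rowStep_castSucc, row, Finset.sum_mul, mul_assoc]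
          rw [Finset.sum_comm]
          refine Finset.sum_congr rfl fun s _ => ?_
          rw [Matrix.mul_apply, Finset.mul_sum]
      intro u v huv hu hv j l
      have hCu := h4 u fun w _ => hu w
      have hCv := h4 v fun w _ => hv w
      have hne' : ∀ (i : Fin (m + 1)) (w : ℕ × ℕ), w.1 < m → (m, (i : ℕ)) ≠ w := by
        rintro i w hw rfl; exact lt_irrefl _ hw
      have hX : ∀ i s α, Commute (x i) (C s α) := fun i => h4 _ fun w hw =>
        ⟨h.X_comm _ _, (h.Xi_X _ _).symm, h.X_θ_of_ne (hne' i w hw)⟩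
      have hθ : ∀ (i : Fin (m + 1)) s α, Commute (θ (m, i)) (C s α) := fun i => h4 _ fun w hw =>
        ⟨(h.X_θ_of_ne (hne' i w hw).symm).symm, (h.Xi_θ_of_ne (hne' i w hw).symm).symm,
          h.θ_comm _ _⟩
      have hP : ∀ i s α, Commute (P i) (C s α) := fun i s α => Commute.mul_left
        (h4 _ (fun w hw => ⟨h.Xi_X _ _, h.Xi_comm _ _, h.Xi_θ_of_ne (hne' i w hw)⟩) s α) (hθ i s α)
      have hΘ : ∀ s α, Commute Θ (C s α) := fun s α => Commute.sum_left _ _ _ fun i _ => hθ i s α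
      have hstep : ∀ u, (∀ s α, Commute u (C s α)) → ∀ α j s β,
          Commute (rowStep x P Θ u α j) (C s β) := by
        intro u hu α j s β
        induction j using Fin.lastCases with
        | last =>
          rw [rowStep_last]; split_ifs
          exacts [(hu s β).sub_left (hΘ s β), (hP α s β).neg_left]
        | cast j =>
          rw [rowStep_castSucc]; split_ifs
          exacts [hX j s β, Commute.one_left _, Commute.zero_left _]
      have hcen : ∀ z u, Commute z u → (∀ w, Commute z (X w) ∧ Commute z (Xi w) ∧ Commute z (θ w)) →
          ∀ α j, Commute z (rowStep x P Θ u α j) := by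
        intro z u hzu hz α j
        have hzΘ : Commute z Θ := Commute.sum_right _ _ _ fun i _ => (hz _).2.2
        induction j using Fin.lastCases with
        | last =>
          rw [rowStep_last]; split_ifs
          exacts [hzu.sub_right hzΘ, ((hz _).2.1.mul_right (hz _).2.2).neg_right]
        | cast j =>
          rw [rowStep_castSucc]; split_ifs
          exacts [(hz _).1, Commute.one_right _, Commute.zero_right _]
      have hzΘ : ∀ z, (∀ w, Commute z (X w) ∧ Commute z (Xi w) ∧ Commute z (θ w)) → Commute z Θ :=
        fun z hz => Commute.sum_right _ _ _ fun i _ => (hz _).2.2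
      have hzP : ∀ z, (∀ w, Commute z (X w) ∧ Commute z (Xi w) ∧ Commute z (θ w)) →
        ∀ j, Commute z (P j) := fun z hz j => (hz _).2.1.mul_right (hz _).2.2
      rw [hrow u hu, hrow u hu, hrow v hv, hrow v hv]
      refine rowStep_exchange (h5 u v huv hu hv) (commute_row (Commute.refl u) hCu)
        (commute_row huv hCu) (commute_row huv.symm hCv) (commute_row (Commute.refl v) hCv)
        (fun α j => commute_row (hcen v u huv.symm hv α j).symm (hstep u hCu α j))
        (fun α j => commute_row (hcen u v huv hu α j).symm (hstep v hCv α j))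
        (rowStep_commutator (fun i j => h.X_comm _ _) (fun i j => h.P_comm _ _) (fun i j => ?_)
          (fun j => ?_) (fun j => ?_) huv (fun j => (hu _).1) (fun j => (hv _).1) (hzP u hu)
          (hzP v hv) (hzΘ u hu) (hzΘ v hv)) j l
      · refine (h.P_X _ _).trans ?_
        simp only [Prod.mk.injEq, true_and, Fin.ext_iff]
        rfl
      · simp only [Θ, x, Finset.sum_mul, h.θ_X, Finset.sum_add_distrib, Finset.mul_sum,
          Prod.mk.injEq, true_and, ← Fin.ext_iff, Finset.sum_ite_eq', Finset.mem_univ, if_true]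
      · simp only [Θ, P, Finset.sum_mul, h.θ_P, Finset.sum_sub_distrib, Finset.mul_sum,
          Prod.mk.injEq, true_and, ← Fin.ext_iff, Finset.sum_ite_eq', Finset.mem_univ, if_true]

theorem exists_row {X Xi θ : ℕ × ℕ → S} (h : IsWeyl X Xi θ) (m : ℕ) :
    ∃ C Ci : Matrix (Fin m) (Fin m) S, C * Ci = 1 ∧ Ci * C = 1 ∧
      (∀ y, (∀ w, Commute y (X w) ∧ Commute y (Xi w) ∧ Commute y (θ w)) →
        ∀ s α, Commute y (C s α)) ∧
      ∀ u v, Commute u v → (∀ w, Commute u (X w) ∧ Commute u (Xi w) ∧ Commute u (θ w)) →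
        (∀ w, Commute v (X w) ∧ Commute v (Xi w) ∧ Commute v (θ w)) → ∀ α β,
        (u - v) * (row C u α * row C v β)
          = row C u β * row C v α + (u - v - 1) * (row C v β * row C u α) := by
  cases m with
  | zero =>
    exact ⟨1, 1, one_mul 1, one_mul 1, fun _ _ s => s.elim0, fun _ _ _ _ _ α => α.elim0⟩
  | succ m =>
    obtain ⟨C, Ci, h1, h2, -, h4, h5⟩ := exists_row_succ h m
    exact ⟨C, Ci, h1, h2, fun y hy => h4 y fun w _ => hy w, h5⟩

end Row

end

end HDiff

/-! ### Frames: derivatives from an invertible matrix of coordinates -/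

namespace HDiff

noncomputable section

open Matrix

variable {k : Type*} [CommRing k] {n N : ℕ} {S : Type*} [Ring S] [Algebra k S]

/-- A square matrix `Z` of coordinates with inverse `W`, together with an action `L` of the
diagonal reduction algebra with which `Z` has the exchange relations of `∑ Z ∂`. -/
structure IsFrame (c : Ubar k n →ₐ[k] S) (L Z W : Fin n → Fin n → S) : Prop where
  red : IsRedSys c L
  weight_Z : ∀ p j α, c p * Z j α = Z j α * c (trans k (ew j) p)
  Z_Z : ∀ i j α β, Z i α * Z j β = ∑ a, ∑ b, c (Rhat k n i j a b) * (Z a β * Z b α)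
  Z_L : ∀ i j l α, Z i α * L l j = ∑ x, mY c L (i, j) (x, l) * Z x α
  Z_W : ∀ i j, ∑ α, Z i α * W j α = if i = j then 1 else 0
  W_Z : ∀ α β, ∑ i, W i α * Z i β = if α = β then 1 else 0

/-- The derivatives `∂ = Z⁻¹ L`. -/
def frameD (L W : Fin n → Fin n → S) (i α : Fin n) : S := ∑ l, W l α * L i l

namespace IsFrame

variable {c : Ubar k n →ₐ[k] S} {L Z W : Fin n → Fin n → S} (h : IsFrame c L Z W)
include h

theorem cancel {F G : Fin n → S} (e : ∀ s, ∑ β, Z s β * F β = ∑ β, Z s β * G β) : F = G := by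
  have key : ∀ F : Fin n → S, ∀ α, ∑ s, W s α * ∑ β, Z s β * F β = F α := by
    intro F α
    simp only [Finset.mul_sum, ← mul_assoc]
    rw [Finset.sum_comm]
    simp only [← Finset.sum_mul, h.W_Z, ite_mul, one_mul, zero_mul, Finset.sum_ite_eq,
      Finset.mem_univ, if_true]
  funext α
  rw [← key F, ← key G]
  simp only [e]

theorem sum_Z_W_mul (s a : Fin n) (y : S) : ∑ β, Z s β * (W a β * y) = if s = a then y else 0 := by
  simp only [← mul_assoc, ← Finset.sum_mul, h.Z_W, ite_mul, one_mul, zero_mul]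

theorem sum_Z_D (s a : Fin n) : ∑ β, Z s β * frameD L W a β = L a s := by
  simp only [frameD, Finset.mul_sum]
  rw [Finset.sum_comm]
  simp only [h.sum_Z_W_mul, Finset.sum_ite_eq, Finset.mem_univ, if_true]

theorem sum_Z_D_mul (s a : Fin n) (y : S) : ∑ β, Z s β * (frameD L W a β * y) = L a s * y := by
  simp only [← mul_assoc, ← Finset.sum_mul, h.sum_Z_D]

theorem weight_W (p : Ubar k n) (j α : Fin n) :
    c p * W j α = W j α * c (trans k (-ew j) p) := by
  refine congrFun (h.cancel (F := fun α => c p * W j α)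
    (G := fun α => W j α * c (trans k (-ew j) p)) fun s => ?_) α
  rw [h.sum_Z_W_mul]
  simp only [← mul_assoc, Z_mul_coef h.weight_Z]
  simp only [mul_assoc, ← Finset.mul_sum, h.Z_W]
  split_ifs with e
  · rw [e, mul_one]
  · rw [mul_zero]

theorem weight_D (p : Ubar k n) (j α : Fin n) :
    c p * frameD L W j α = frameD L W j α * c (trans k (-ew j) p) := by
  simp only [frameD, Finset.mul_sum, Finset.sum_mul]
  refine Finset.sum_congr rfl fun l _ => ?_
  rw [← mul_assoc, h.weight_W, mul_assoc, h.red.weight, trans_trans, mul_assoc]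
  congr 4; abel_nf

theorem sum_Z_Z_W (s i j γ : Fin n) (y : S) : ∑ δ, Z s δ * (Z i γ * (W j δ * y))
    = ∑ p, c (Rhat k n s i p j) * (Z p γ * y) := by
  have e : ∀ δ, Z s δ * (Z i γ * (W j δ * y))
      = ∑ p, ∑ q, c (Rhat k n s i p q) * (Z p γ * (Z q δ * (W j δ * y))) := by
    intro δ
    rw [← mul_assoc, h.Z_Z]
    simp only [Finset.sum_mul, mul_assoc]
  simp only [e]
  rw [← sum_rotate (A := Fin n) (B := Fin n)
    (fun p q δ => c (Rhat k n s i p q) * (Z p γ * (Z q δ * (W j δ * y))))]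
  simp only [← Finset.mul_sum, h.sum_Z_W_mul, mul_ite, mul_zero, Finset.sum_ite_eq',
    Finset.mem_univ, if_true]

theorem Z_W_exchange (i j γ δ : Fin n) :
    Z i γ * W j δ = ∑ a, ∑ b, W a δ * (c (Rhat k n a i b j) * Z b γ) := by
  refine congrFun (h.cancel (F := fun δ => Z i γ * W j δ)
    (G := fun δ => ∑ a, ∑ b, W a δ * (c (Rhat k n a i b j) * Z b γ)) fun s => ?_) δ
  have e := h.sum_Z_Z_W s i j γ 1
  simp only [mul_one] at e
  rw [e]
  simp only [Finset.mul_sum]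
  rw [← sum_rotate (A := Fin n) (B := Fin n)]
  simp only [h.sum_Z_W_mul]
  rw [Finset.sum_comm]
  simp

/-- After multiplication by Z on the left, which can be cancelled, the relation becomes R̂Y = L₁R̂ -
1. The -1 is the constant term of the mixed relation. -/
theorem Z_D_exchange (i j γ δ : Fin n) : Z i γ * frameD L W j δ
    = (∑ a, ∑ b, frameD L W a δ * (c (Rhat k n a i b j) * Z b γ))
      - if γ = δ ∧ i = j then 1 else 0 := by
  refine congrFun (h.cancel (F := fun δ => Z i γ * frameD L W j δ) (G := fun δ =>
    (∑ a, ∑ b, frameD L W a δ * (c (Rhat k n a i b j) * Z b γ))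
      - if γ = δ ∧ i = j then 1 else 0) fun s => ?_) δ
  have e1 : ∑ δ, Z s δ * (Z i γ * frameD L W j δ)
      = ∑ x, (mR c * mY c L) (s, i) (x, j) * Z x γ := by
    simp only [frameD, Finset.mul_sum]
    rw [Finset.sum_comm]
    simp only [h.sum_Z_Z_W, h.Z_L, Finset.mul_sum, Matrix.mul_apply, Fintype.sum_prod_type,
      Finset.sum_mul, mul_assoc, mR, map_apply, matR]
    rw [← sum_rotate (A := Fin n) (B := Fin n)]
    exact Finset.sum_comm
  have e2 : mR c * mY c L = mL L * mR c - 1 := by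
    rw [mY, mul_sub, ← mul_assoc, ← mul_assoc, mR_sq, one_mul]
  rw [e1, e2]
  simp only [Matrix.sub_apply, mL_mul_apply, sub_mul, Finset.sum_sub_distrib, mul_sub,
    Finset.mul_sum]
  congr 1
  · rw [← sum_rotate (A := Fin n) (B := Fin n)]
    simp only [h.sum_Z_D_mul, Finset.sum_mul, mul_assoc]
    rw [Finset.sum_comm]
    rfl
  · simp only [Matrix.one_apply, Prod.mk.injEq, ite_and, ite_mul, one_mul, zero_mul,
      Finset.sum_ite_eq, Finset.mem_univ, if_true, mul_ite, mul_one, mul_zero]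

/-- By the relation between the Z's, interchanging the plain indices of U and V multiplies the
matrix of ZZUV by R̂ on the left. -/
theorem sum_swap {U V : Fin n → Fin n → S}
    {G : Matrix (Fin n × Fin n) (Fin n × Fin n) S}
    (hG : ∀ s t i j, ∑ β, ∑ α, Z s β * (Z t α * (U i α * V j β)) = G (s, t) (j, i))
    (s t a b : Fin n) :
    ∑ β, ∑ α, Z s β * (Z t α * (U a β * V b α)) = (mR c * G) (s, t) (b, a) := by
  have e : ∀ β α, Z s β * (Z t α * (U a β * V b α))
      = ∑ p, ∑ q, c (Rhat k n s t p q) * (Z p α * (Z q β * (U a β * V b α))) := by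
    intro β α
    rw [← mul_assoc, h.Z_Z]
    simp only [Finset.sum_mul, mul_assoc]
  simp only [e, Matrix.mul_apply, Fintype.sum_prod_type, ← hG, mR, map_apply, matR,
    Finset.mul_sum]
  rw [Finset.sum_comm, Finset.sum_congr rfl fun α _ => (sum_rotate (A := Fin n) (B := Fin n)
    (fun p q β => c (Rhat k n s t p q) * (Z p α * (Z q β * (U a β * V b α))))).symm,
    ← sum_rotate (A := Fin n) (B := Fin n)]

theorem cancel₂ {F G : Fin n → Fin n → S} (e : ∀ s t, ∑ β, ∑ α, Z s β * (Z t α * F α β)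
    = ∑ β, ∑ α, Z s β * (Z t α * G α β)) (α β : Fin n) : F α β = G α β := by
  simp only [← Finset.mul_sum] at e
  have e1 : ∀ t β, ∑ α, Z t α * F α β = ∑ α, Z t α * G α β := fun t β =>
    congrFun (h.cancel fun s => e s t) β
  exact congrFun (h.cancel (F := fun α => F α β) (G := fun α => G α β) fun t => e1 t β) α

/-- Multiplication by two factors Z is injective and turns a quadratic relation into the matrix
identity G = R̂G'R̂ - (R̂G'R̂ - G), where K stands for the difference. The matrices for WW, WD, DW
and DD are 1, L₁, Y and YL₁. -/
theorem exchange {U V U' V' : Fin n → Fin n → S}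
    {G G' : Matrix (Fin n × Fin n) (Fin n × Fin n) S}
    (hG : ∀ s t i j, ∑ β, ∑ α, Z s β * (Z t α * (U i α * V j β)) = G (s, t) (j, i))
    (hG' : ∀ s t i j, ∑ β, ∑ α, Z s β * (Z t α * (U' i α * V' j β)) = G' (s, t) (j, i))
    {K : Fin n → Fin n → Fin n → Fin n → S}
    (hK : ∀ s t i j, ∑ β, ∑ α, Z s β * (Z t α * K i j α β)
      = (mR c * G' * mR c - G) (s, t) (j, i)) (i j α β : Fin n) :
    U i α * V j β = (∑ a, ∑ b, U' a β * V' b α * c (Rhat k n b a j i)) - K i j α β := by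
  refine h.cancel₂ (F := fun α β => U i α * V j β) (G := fun α β =>
    (∑ a, ∑ b, U' a β * V' b α * c (Rhat k n b a j i)) - K i j α β) (fun s t => ?_) α β
  simp only [mul_sub, Finset.sum_sub_distrib, hG, hK, Matrix.sub_apply]
  rw [eq_sub_iff_add_eq, ← add_sub_assoc, add_sub_cancel_left, Matrix.mul_apply,
    Fintype.sum_prod_type, Finset.sum_comm]
  have e : ∀ p q, (mR c * G') (s, t) (p, q) * mR c (p, q) (j, i)
      = ∑ β, ∑ α, Z s β * (Z t α * (U' q β * V' p α * c (Rhat k n p q j i))) := by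
    intro p q
    rw [← h.sum_swap hG']
    simp only [mR, map_apply, matR, Finset.sum_mul, mul_assoc]
  simp only [e, Finset.mul_sum]
  exact (sum_rotate (A := Fin n) (B := Fin n) _).trans
    (Finset.sum_congr rfl fun β _ => sum_rotate (A := Fin n) (B := Fin n) _)

theorem quad_W {V : Fin n → Fin n → S} {v : Fin n → Fin n → S}
    (hv : ∀ s j, ∑ β, Z s β * V j β = v j s) (s t i j : Fin n) :
    ∑ β, ∑ α, Z s β * (Z t α * (W i α * V j β)) = if t = i then v j s else 0 := by
  simp only [← Finset.mul_sum, h.sum_Z_W_mul]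
  split_ifs
  · exact hv s j
  · simp

theorem quad_D {V : Fin n → Fin n → S} {v : Fin n → Fin n → S}
    (hv : ∀ s j, ∑ β, Z s β * V j β = v j s) (s t i j : Fin n) :
    ∑ β, ∑ α, Z s β * (Z t α * (frameD L W i α * V j β))
      = ∑ x, mY c L (s, t) (x, i) * v j x := by
  simp only [← Finset.mul_sum, h.sum_Z_D_mul]
  simp only [← mul_assoc, h.Z_L, Finset.sum_mul]
  rw [Finset.sum_comm]
  simp only [mul_assoc, ← Finset.mul_sum, hv]

theorem quad_W_W (s t i j : Fin n) : ∑ β, ∑ α, Z s β * (Z t α * (W i α * W j β))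
    = (1 : Matrix (Fin n × Fin n) (Fin n × Fin n) S) (s, t) (j, i) := by
  rw [h.quad_W (v := fun j s => if s = j then 1 else 0) h.Z_W, Matrix.one_apply]
  simp only [Prod.mk.injEq, ← ite_and]
  congr 1
  rw [and_comm]

theorem quad_W_D (s t i j : Fin n) : ∑ β, ∑ α, Z s β * (Z t α * (W i α * frameD L W j β))
    = mL L (s, t) (j, i) := h.quad_W (v := L) h.sum_Z_D s t i j

theorem quad_D_W (s t i j : Fin n) : ∑ β, ∑ α, Z s β * (Z t α * (frameD L W i α * W j β))
    = mY c L (s, t) (j, i) := by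
  rw [h.quad_D (v := fun j s => if s = j then 1 else 0) h.Z_W]
  simp

theorem quad_D_D (s t i j : Fin n) : ∑ β, ∑ α, Z s β * (Z t α * (frameD L W i α * frameD L W j β))
    = (mY c L * mL L) (s, t) (j, i) := by
  rw [h.quad_D (v := L) h.sum_Z_D, mul_mL_apply]

theorem W_W (i j α β : Fin n) :
    W i α * W j β = ∑ a, ∑ b, W a β * W b α * c (Rhat k n b a j i) := by
  rw [h.exchange (K := fun _ _ _ _ => 0) h.quad_W_W h.quad_W_W (fun s t i j => by
    simp [mR_sq]) i j, sub_zero]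

/-- Only here does the quadratic part of the proof use the reflection equation: R̂YL₁R̂ = (L₁R̂ -
1)L₁R̂ = L₁Y = YL₁. -/
theorem D_D (i j α β : Fin n) : frameD L W i α * frameD L W j β
    = ∑ a, ∑ b, frameD L W a β * frameD L W b α * c (Rhat k n b a j i) := by
  rw [h.exchange (K := fun _ _ _ _ => 0) h.quad_D_D h.quad_D_D (fun s t i j => ?_) i j, sub_zero]
  have e : mR c * (mY c L * mL L) * mR c - mY c L * mL L = 0 := by
    have e1 : mR c * mY c L = mL L * mR c - 1 := by
      rw [mY, mul_sub, ← mul_assoc, ← mul_assoc, mR_sq, one_mul]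
    rw [← mul_assoc, e1, ← h.red.reflection, mY, sub_mul, sub_mul, mul_sub, one_mul]
    simp only [mul_assoc, sub_self]
  rw [e]; simp

/-- The correction WW comes from the summand -R̂ of Y. This relation and `W_D` are needed because
the extended derivatives mix D and W. -/
theorem D_W (i j α β : Fin n) : frameD L W i α * W j β
    = (∑ a, ∑ b, W a β * frameD L W b α * c (Rhat k n b a j i)) - W i β * W j α := by
  refine h.exchange (K := fun i j α β => W i β * W j α) h.quad_D_W h.quad_W_D
    (fun s t i j => ?_) i j α β
  rw [h.sum_swap h.quad_W_W, mul_one, mY, sub_sub_cancel]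

theorem W_D (i j α β : Fin n) : W i α * frameD L W j β
    = (∑ a, ∑ b, frameD L W a β * W b α * c (Rhat k n b a j i)) + W i β * W j α := by
  rw [h.exchange (K := fun i j α β => -(W i β * W j α)) h.quad_W_D h.quad_D_W
    (fun s t i j => ?_) i j α β, sub_neg_eq_add]
  simp only [mul_neg, Finset.sum_neg_distrib]
  rw [h.sum_swap h.quad_W_W, mul_one]
  have e : mR c * mY c L * mR c - mL L = -mR c := by
    rw [mY, mul_sub, ← mul_assoc, ← mul_assoc, mR_sq, one_mul, sub_mul, mul_assoc, mR_sq, mul_one,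
      one_mul, sub_sub_cancel_left]
  rw [e]; rfl

end IsFrame

end

end HDiff

/-! ### Extending a frame to more columns -/

namespace HDiff

noncomputable section

open Matrix

variable {k : Type*} [CommRing k] {n N : ℕ} {S : Type*} [Ring S] [Algebra k S]

/-- `y` commutes with all entries of a frame. -/
structure IsScalarFor (c : Ubar k n →ₐ[k] S) (L Z W : Fin n → Fin n → S) (y : S) : Prop where
  c : ∀ p, Commute y (c p)
  L : ∀ i j, Commute y (L i j)
  Z : ∀ i α, Commute y (Z i α)
  W : ∀ i α, Commute y (W i α)

theorem IsScalarFor.D {c : Ubar k n →ₐ[k] S} {L Z W : Fin n → Fin n → S} {y : S}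
    (h : IsScalarFor c L Z W y) (i α : Fin n) : Commute y (frameD L W i α) :=
  Commute.sum_right _ _ _ fun l _ => (h.W l α).mul_right (h.L i l)

/-- The data that extend a frame with `n` columns to `N` columns. -/
structure IsExtension (c : Ubar k n →ₐ[k] S) (L Z W : Fin n → Fin n → S)
    (X : Fin n → Fin N → S) (E Q : Fin N → Fin n → S) : Prop where
  scalar_X : ∀ γ α, IsScalarFor c L Z W (X γ α)
  scalar_Q : ∀ α γ, IsScalarFor c L Z W (Q α γ)
  central_E : ∀ α γ y, Commute (E α γ) y
  X_X : ∀ γ α δ β, Commute (X γ α) (X δ β)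
  Q_X : ∀ β δ γ α, Q β δ * X γ α = X γ α * Q β δ
    + if γ = δ then (if α = β then 1 else 0) - ∑ μ, E β μ * X μ α else 0
  Q_Q : ∀ α γ β δ, Q α γ * Q β δ = Q β δ * Q α γ + E α δ * Q β γ - E β γ * Q α δ
  sum_X_E : ∀ γ δ, ∑ α, X γ α * E α δ = if γ = δ then 1 else 0
  sum_X_Q : ∀ γ δ, ∑ α, X γ α * Q α δ = 0

/-- The coordinates of the extended frame. -/
def extZ (Z : Fin n → Fin n → S) (X : Fin n → Fin N → S) (i : Fin n) (α : Fin N) : S :=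
  ∑ γ, X γ α * Z i γ

/-- The derivatives of the extended frame. -/
def extD (L W : Fin n → Fin n → S) (E Q : Fin N → Fin n → S) (j : Fin n) (β : Fin N) : S :=
  ∑ δ, E β δ * frameD L W j δ + ∑ δ, Q β δ * W j δ

theorem sum_mul_sum_comm {A B U V : Fin n → S} (hB : ∀ δ γ, Commute (U γ) (B δ)) :
    (∑ γ, A γ * U γ) * (∑ δ, B δ * V δ) = ∑ γ, ∑ δ, A γ * B δ * (U γ * V δ) := by
  rw [Finset.sum_mul_sum]
  refine Finset.sum_congr rfl fun γ _ => Finset.sum_congr rfl fun δ _ => ?_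
  rw [mul_assoc, ← mul_assoc (U γ), (hB δ γ).eq, mul_assoc, mul_assoc]

theorem sum_twist {A B : Fin n → S} {U' V' : Fin n → Fin n → S}
    (hB : ∀ δ γ b, Commute (U' b γ) (B δ)) (r : Fin n → Fin n → S) :
    ∑ a, ∑ b, (∑ δ, A δ * U' a δ) * (∑ γ, B γ * V' b γ) * r a b
      = ∑ γ, ∑ δ, A δ * B γ * ∑ a, ∑ b, U' a δ * V' b γ * r a b := by
  simp only [fun a b => sum_mul_sum_comm (A := A) (B := B) (U := U' a) (V := V' b)
    fun δ γ => hB δ γ a, Finset.sum_mul, Finset.mul_sum, mul_assoc]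
  have e (F : Fin n → Fin n → Fin n → Fin n → S) :
      ∑ a, ∑ b, ∑ δ, ∑ γ, F a b δ γ = ∑ γ, ∑ δ, ∑ a, ∑ b, F a b δ γ := by
    rw [sum_rotate (A := Fin n) (B := Fin n) (C := Fin n), Finset.sum_congr rfl fun δ _ =>
      sum_rotate (A := Fin n) (B := Fin n) (C := Fin n) fun a b γ => F a b δ γ, Finset.sum_comm]
  exact e _

namespace IsExtension

variable {c : Ubar k n →ₐ[k] S} {L Z W : Fin n → Fin n → S} {X : Fin n → Fin N → S}
  {E Q : Fin N → Fin n → S} (hF : IsFrame c L Z W) (h : IsExtension c L Z W X E Q)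
include h

theorem scalar_E (α : Fin N) (γ : Fin n) : IsScalarFor c L Z W (E α γ) :=
  ⟨fun _ => h.central_E _ _ _, fun _ _ => h.central_E _ _ _, fun _ _ => h.central_E _ _ _,
    fun _ _ => h.central_E _ _ _⟩

include hF

theorem weight_Z (p : Ubar k n) (j : Fin n) (α : Fin N) :
    c p * extZ Z X j α = extZ Z X j α * c (trans k (ew j) p) := by
  simp only [extZ, Finset.mul_sum, Finset.sum_mul]
  refine Finset.sum_congr rfl fun γ _ => ?_
  rw [← mul_assoc, ← ((h.scalar_X γ α).c p).eq, mul_assoc, hF.weight_Z, mul_assoc]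

theorem weight_d (p : Ubar k n) (j : Fin n) (α : Fin N) :
    c p * extD L W E Q j α = extD L W E Q j α * c (trans k (-ew j) p) := by
  simp only [extD, mul_add, add_mul, Finset.mul_sum, Finset.sum_mul]
  congr 1 <;> refine Finset.sum_congr rfl fun γ _ => ?_
  · rw [← mul_assoc, ← ((h.scalar_E α γ).c p).eq, mul_assoc, hF.weight_D, mul_assoc]
  · rw [← mul_assoc, ← ((h.scalar_Q α γ).c p).eq, mul_assoc, hF.weight_W, mul_assoc]

theorem Z_Z (i j : Fin n) (α β : Fin N) : extZ Z X i α * extZ Z X j β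
    = ∑ a, ∑ b, c (Rhat k n i j a b) * (extZ Z X a β * extZ Z X b α) := by
  have e1 : ∀ i j α β, extZ Z X i α * extZ Z X j β
      = ∑ γ, ∑ δ, X γ α * X δ β * (Z i γ * Z j δ) := fun i j α β =>
    sum_mul_sum_comm fun δ γ => ((h.scalar_X δ β).Z i γ).symm
  simp only [e1]
  rw [Finset.sum_comm]
  simp only [Finset.mul_sum]
  rw [sum_rotate (A := Fin n) (B := Fin n), Finset.sum_congr rfl fun γ _ =>
    sum_rotate (A := Fin n) (B := Fin n) _]
  refine Finset.sum_congr rfl fun δ _ => Finset.sum_congr rfl fun γ _ => ?_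
  rw [hF.Z_Z]
  simp only [Finset.mul_sum]
  refine Finset.sum_congr rfl fun a _ => Finset.sum_congr rfl fun b _ => ?_
  rw [(h.X_X γ α δ β).eq, ← mul_assoc, ← mul_assoc (c _),
    (((h.scalar_X δ β).c _).mul_left ((h.scalar_X γ α).c _)).eq]

/-- Exchanging D with W leaves corrections WW; the commutator prescribed for the Q's is the one that
cancels them. -/
theorem d_d (i j : Fin n) (α β : Fin N) : extD L W E Q i α * extD L W E Q j β
    = ∑ a, ∑ b, extD L W E Q a β * extD L W E Q b α * c (Rhat k n b a j i) := by
  have hE : ∀ β δ (y : S), Commute y (E β δ) := fun β δ y => (h.central_E β δ y).symm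
  have hDQ : ∀ i γ β δ, Commute (frameD L W i γ) (Q β δ) :=
    fun i γ β δ => ((h.scalar_Q β δ).D i γ).symm
  have hWQ : ∀ i γ β δ, Commute (W i γ) (Q β δ) := fun i γ β δ => ((h.scalar_Q β δ).W i γ).symm
  have dW : ∀ i j γ δ, ∑ a, ∑ b, W a δ * frameD L W b γ * c (Rhat k n b a j i)
      = frameD L W i γ * W j δ + W i δ * W j γ := fun i j γ δ => by
    rw [hF.D_W, sub_add_cancel]
  have wD : ∀ i j γ δ, ∑ a, ∑ b, frameD L W a δ * W b γ * c (Rhat k n b a j i)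
      = W i γ * frameD L W j δ - W i δ * W j γ := fun i j γ δ => by
    rw [hF.W_D, add_sub_cancel_right]
  simp only [extD, add_mul, mul_add, Finset.sum_add_distrib]
  rw [sum_twist fun δ γ b => hE _ _ _, sum_twist fun δ γ b => hE _ _ _,
    sum_twist fun δ γ b => hDQ _ _ _ _, sum_twist fun δ γ b => hWQ _ _ _ _,
    sum_mul_sum_comm fun δ γ => hE _ _ _, sum_mul_sum_comm fun δ γ => hE _ _ _,
    sum_mul_sum_comm fun δ γ => hDQ _ _ _ _, sum_mul_sum_comm fun δ γ => hWQ _ _ _ _]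
  simp only [dW, wD, ← hF.D_D, ← hF.W_W, h.Q_Q α, mul_sub, mul_add, add_mul, sub_mul,
    Finset.sum_add_distrib, Finset.sum_sub_distrib]
  have e1 : ∑ γ, ∑ δ, E α δ * Q β γ * (W i γ * W j δ)
      = ∑ γ, ∑ δ, Q β δ * E α γ * (W i δ * W j γ) := by
    rw [Finset.sum_comm]
    exact Finset.sum_congr rfl fun γ _ => Finset.sum_congr rfl fun δ _ => by
      rw [(h.central_E α γ _).eq]
  have e2 : ∑ γ, ∑ δ, E β γ * Q α δ * (W i γ * W j δ)
      = ∑ γ, ∑ δ, E β δ * Q α γ * (W i δ * W j γ) := Finset.sum_comm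
  rw [e1, e2]
  simp only [(h.central_E α _ _).eq, (h.central_E β _ (Q _ _)).eq]
  abel

/-- The D-part only contributes the constant EX, which has entries (EX)_{βα}. The commutator of Q
with X supplies the missing δ - EX, multiplied by ∑ ZW. -/
theorem Z_d (i j : Fin n) (α β : Fin N) : extZ Z X i α * extD L W E Q j β
    = (∑ a, ∑ b, extD L W E Q a β * (c (Rhat k n a i b j) * extZ Z X b α))
      - if α = β ∧ i = j then 1 else 0 := by
  have hcX : ∀ p b, c p * extZ Z X b α = ∑ γ, X γ α * (c p * Z b γ) := by
    intro p b
    simp only [extZ, Finset.mul_sum]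
    refine Finset.sum_congr rfl fun γ _ => ?_
    rw [← mul_assoc, ← ((h.scalar_X γ α).c p).eq, mul_assoc]
  have e1 : ∀ (A : Fin n → S) (U : Fin n → Fin n → S) (_ : ∀ a δ γ, Commute (U a δ) (X γ α)),
      ∑ a, ∑ b, (∑ δ, A δ * U a δ) * (c (Rhat k n a i b j) * extZ Z X b α)
      = ∑ γ, ∑ δ, A δ * X γ α * ∑ a, ∑ b, U a δ * (c (Rhat k n a i b j) * Z b γ) := by
    intro A U hU
    simp only [hcX, fun a b => sum_mul_sum_comm (A := A) (B := fun γ => X γ α) (U := U a)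
      (V := fun γ => c (Rhat k n a i b j) * Z b γ) fun γ δ => hU a δ γ, Finset.mul_sum]
    rw [sum_rotate (A := Fin n) (B := Fin n), Finset.sum_congr rfl fun γ _ =>
      sum_rotate (A := Fin n) (B := Fin n) _, Finset.sum_comm]
  have zd : ∀ γ δ, ∑ a, ∑ b, frameD L W a δ * (c (Rhat k n a i b j) * Z b γ)
      = Z i γ * frameD L W j δ + if γ = δ ∧ i = j then 1 else 0 := fun γ δ => by
    rw [hF.Z_D_exchange, sub_add_cancel]
  simp only [extD, add_mul, Finset.sum_add_distrib]
  rw [e1 _ _ fun a δ γ => ((h.scalar_X γ α).D a δ).symm,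
    e1 _ _ fun a δ γ => ((h.scalar_X γ α).W a δ).symm]
  simp only [zd, ← hF.Z_W_exchange, h.Q_X, mul_add, add_mul, extZ, Finset.sum_add_distrib]
  rw [sum_mul_sum_comm fun δ γ => (h.central_E _ _ _).symm,
    sum_mul_sum_comm fun δ γ => ((h.scalar_Q _ _).Z _ _).symm]
  have e2 : ∑ γ, ∑ δ, E β δ * X γ α * (if γ = δ ∧ i = j then 1 else 0)
      = if i = j then ∑ μ, E β μ * X μ α else 0 := by
    split_ifs with hij
    · simp [hij]
    · simp [hij]
  have e3 : ∑ γ, ∑ δ, (if γ = δ then (if α = β then 1 else 0) - ∑ μ, E β μ * X μ α else 0)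
      * (Z i γ * W j δ) = ((if α = β then 1 else 0) - ∑ μ, E β μ * X μ α) *
        if i = j then 1 else 0 := by
    rw [← hF.Z_W]
    simp only [ite_mul, zero_mul, Finset.sum_ite_eq, Finset.mem_univ, if_true, Finset.mul_sum]
  rw [e2, e3]
  simp only [(h.central_E β _ (X _ α)).eq]
  by_cases hij : i = j <;> by_cases hαβ : α = β <;> simp [hij, hαβ] <;> abel

theorem isDiffSys : IsDiffSys c (extZ Z X) (extD L W E Q) :=
  ⟨h.weight_Z hF, h.weight_d hF, h.Z_Z hF, h.d_d hF, h.Z_d hF⟩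

/-- XE = 1 retains ∑ ZD = L, and XQ = 0 removes the terms with W. -/
theorem sumZd_ext (i j : Fin n) : sumZd (extZ Z X) (extD L W E Q) i j = L i j := by
  simp only [sumZd, extD, mul_add, Finset.sum_add_distrib]
  simp only [extZ, sum_mul_sum_comm fun (δ γ : Fin n) => (h.central_E _ δ (Z j γ)).symm,
    sum_mul_sum_comm fun (δ γ : Fin n) => ((h.scalar_Q _ δ).Z j γ).symm]
  have e (F : Fin N → Fin n → Fin n → S) :
      ∑ α, ∑ γ, ∑ δ, F α γ δ = ∑ γ, ∑ δ, ∑ α, F α γ δ := by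
    rw [Finset.sum_comm, Finset.sum_congr rfl fun _ _ => Finset.sum_comm]
  rw [e, e]
  simp only [← Finset.sum_mul, h.sum_X_E, h.sum_X_Q, zero_mul, Finset.sum_const_zero, add_zero,
    ite_mul, one_mul, Finset.sum_ite_eq, Finset.mem_univ, if_true]
  exact hF.sum_Z_D j i

end IsExtension

end

end HDiff

/-! ### Extension data from Heisenberg pairs -/

namespace HDiff

noncomputable section

open Matrix

section

variable {n r : ℕ} {S : Type*} [Ring S]

/-- The identity matrix, followed by `Y`. -/
def padX (Y : Fin n → Fin r → S) (γ : Fin n) (α : Fin (n + r)) : S :=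
  Fin.addCases (motive := fun _ => S) (fun i => if γ = i then 1 else 0) (fun j => Y γ j) α

/-- The identity matrix, followed by zeros. -/
def padE (S : Type*) [Ring S] (α : Fin (n + r)) (γ : Fin n) : S :=
  Fin.addCases (motive := fun _ => S) (fun i => if γ = i then 1 else 0) (fun _ => 0) α

/-- The operators dual to `padX`: minus the rotation fields, followed by `P`. -/
def padQ (Y : Fin n → Fin r → S) (P : Fin r → Fin n → S) (α : Fin (n + r)) (γ : Fin n) : S :=
  Fin.addCases (motive := fun _ => S) (fun i => -∑ j, Y i j * P j γ) (fun j => P j γ) α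

/-- The Heisenberg relations for a matrix of coordinates. -/
structure IsHeisenberg (Y : Fin n → Fin r → S) (P : Fin r → Fin n → S) : Prop where
  Y_Y : ∀ γ α δ β, Commute (Y γ α) (Y δ β)
  P_P : ∀ γ α δ β, Commute (P γ α) (P δ β)
  P_Y : ∀ β δ γ α, P β δ * Y γ α = Y γ α * P β δ + if γ = δ ∧ α = β then 1 else 0

namespace IsHeisenberg

variable {Y : Fin n → Fin r → S} {P : Fin r → Fin n → S} (h : IsHeisenberg Y P)
include h

theorem T_Y (i δ γ : Fin n) (α : Fin r) : (∑ j, Y i j * P j δ) * Y γ α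
    = Y γ α * ∑ j, Y i j * P j δ + if γ = δ then Y i α else 0 := by
  simp only [Finset.sum_mul, Finset.mul_sum, mul_assoc, h.P_Y, mul_add, Finset.sum_add_distrib]
  congr 1
  · refine Finset.sum_congr rfl fun j _ => ?_
    rw [← mul_assoc, (h.Y_Y _ _ _ _).eq, mul_assoc]
  · simp [ite_and]

theorem P_T (i δ γ : Fin n) (α : Fin r) : P α γ * ∑ j, Y i j * P j δ
    = (∑ j, Y i j * P j δ) * P α γ + if i = γ then P α δ else 0 := by
  simp only [Finset.sum_mul, Finset.mul_sum, ← mul_assoc, h.P_Y, add_mul, Finset.sum_add_distrib]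
  congr 1
  · refine Finset.sum_congr rfl fun j _ => ?_
    rw [mul_assoc, (h.P_P _ _ _ _).eq, mul_assoc]
  · simp [ite_and]

/-- The operators ∑ YP are the linear vector fields, so they satisfy the commutation relations of
matrix units in gl_n. -/
theorem T_T (i γ l δ : Fin n) : (∑ j, Y i j * P j γ) * ∑ j, Y l j * P j δ
    = (∑ j, Y l j * P j δ) * (∑ j, Y i j * P j γ) + (if l = γ then ∑ j, Y i j * P j δ else 0)
      - if i = δ then ∑ j, Y l j * P j γ else 0 := by
  rw [Finset.sum_mul]
  simp only [mul_assoc, h.P_T, mul_add, Finset.sum_add_distrib]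
  have e : ∀ j, Y i j * ((∑ m, Y l m * P m δ) * P j γ)
      = (∑ m, Y l m * P m δ) * (Y i j * P j γ) - if i = δ then Y l j * P j γ else 0 := by
    intro j
    have := h.T_Y l δ i j
    rw [← mul_assoc, ← mul_assoc, this, add_mul, ite_mul, zero_mul, add_sub_cancel_right]
  simp only [e, Finset.sum_sub_distrib, ← Finset.mul_sum]
  by_cases h1 : l = γ <;> by_cases h2 : i = δ <;>
    simp only [h1, h2, if_true, if_false, mul_zero, Finset.sum_const_zero] <;> abel

end IsHeisenberg

end

variable {k : Type*} [CommRing k] {n r : ℕ} {S : Type*} [Ring S] [Algebra k S]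

theorem IsScalarFor.zero (c : Ubar k n →ₐ[k] S) (L Z W : Fin n → Fin n → S) :
    IsScalarFor c L Z W 0 :=
  ⟨fun _ => Commute.zero_left _, fun _ _ => Commute.zero_left _, fun _ _ => Commute.zero_left _,
    fun _ _ => Commute.zero_left _⟩

/-- With X = (1 | Y) and E = (1 | 0)ᵗ, the condition XQ = 0 forces the upper block -YP of Q once its
lower block is P. The commutators follow from those of the vector fields YP. -/
theorem IsHeisenberg.isExtension {c : Ubar k n →ₐ[k] S} {L Z W : Fin n → Fin n → S}
    {Y : Fin n → Fin r → S} {P : Fin r → Fin n → S} (h : IsHeisenberg Y P)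
    (hY : ∀ i j, IsScalarFor c L Z W (Y i j)) (hP : ∀ i j, IsScalarFor c L Z W (P i j)) :
    IsExtension c L Z W (padX Y) (padE S) (padQ Y P) where
  scalar_X γ α := by
    refine Fin.addCases (fun i => ?_) (fun j => ?_) α
    · simp only [padX, Fin.addCases_left]
      split_ifs
      · exact ⟨fun _ => Commute.one_left _, fun _ _ => Commute.one_left _,
          fun _ _ => Commute.one_left _, fun _ _ => Commute.one_left _⟩
      · exact IsScalarFor.zero _ _ _ _
    · simpa only [padX, Fin.addCases_right] using hY γ j
  scalar_Q α γ := by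
    refine Fin.addCases (fun i => ?_) (fun j => ?_) α
    · simp only [padQ, Fin.addCases_left]
      exact ⟨fun p => (Commute.sum_left _ _ _ fun j _ => ((hY i j).c p).mul_left
          ((hP j γ).c p)).neg_left,
        fun a b => (Commute.sum_left _ _ _ fun j _ => ((hY i j).L a b).mul_left
          ((hP j γ).L a b)).neg_left,
        fun a b => (Commute.sum_left _ _ _ fun j _ => ((hY i j).Z a b).mul_left
          ((hP j γ).Z a b)).neg_left,
        fun a b => (Commute.sum_left _ _ _ fun j _ => ((hY i j).W a b).mul_left
          ((hP j γ).W a b)).neg_left⟩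
    · simpa only [padQ, Fin.addCases_right] using hP j γ
  central_E α γ y := by
    refine Fin.addCases (fun i => ?_) (fun j => ?_) α
    · simp only [padE, Fin.addCases_left]
      split_ifs
      exacts [Commute.one_left _, Commute.zero_left _]
    · simpa only [padE, Fin.addCases_right] using Commute.zero_left y
  X_X γ α δ β := by
    refine Fin.addCases (fun i => ?_) (fun j => ?_) α
    · simp only [padX, Fin.addCases_left]
      split_ifs
      exacts [Commute.one_left _, Commute.zero_left _]
    · refine Fin.addCases (fun i => ?_) (fun l => ?_) β
      · simp only [padX, Fin.addCases_left]
        split_ifs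
        exacts [Commute.one_right _, Commute.zero_right _]
      · simpa only [padX, Fin.addCases_right] using h.Y_Y _ _ _ _
  Q_X β δ γ α := by
    refine Fin.addCases (fun i => ?_) (fun j => ?_) β <;>
    refine Fin.addCases (fun l => ?_) (fun m => ?_) α <;>
    simp only [padX, padQ, padE, Fin.addCases_left, Fin.addCases_right]
    · simp only [mul_ite, ite_mul, mul_neg, mul_one, one_mul, mul_zero, zero_mul,
        Finset.sum_ite_eq', Finset.mem_univ, if_true, Fin.castAdd_inj, sub_self, ite_self,
        eq_comm (a := l)]
      split_ifs <;> simp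
    · have e : ¬ Fin.natAdd n m = Fin.castAdd r i := fun e => by
        have := congrArg Fin.val e
        simp at this; omega
      rw [neg_mul, h.T_Y]
      by_cases e' : γ = δ <;> simp [e, e', add_comm]
    · have e : ¬ Fin.castAdd r l = Fin.natAdd n j := fun e => by
        have := congrArg Fin.val e
        simp at this; omega
      by_cases e' : γ = l <;> simp [e, e']
    · simp [h.P_Y, ite_and]
  Q_Q α γ β δ := by
    refine Fin.addCases (fun i => ?_) (fun j => ?_) α <;>
    refine Fin.addCases (fun l => ?_) (fun m => ?_) β <;>
    simp only [padQ, padE, Fin.addCases_left, Fin.addCases_right]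
    · rw [neg_mul_neg, neg_mul_neg, h.T_T]
      simp only [eq_comm (a := δ), eq_comm (a := γ)]
      split_ifs <;> simp <;> abel
    · rw [neg_mul, mul_neg, h.P_T]
      simp only [eq_comm (a := δ)]
      split_ifs <;> simp
    · rw [neg_mul, mul_neg, h.P_T]
      simp only [eq_comm (a := γ)]
      split_ifs <;> simp
      abel
    · simpa using (h.P_P _ _ _ _).eq
  sum_X_E γ δ := by
    simp [padX, padE, Fin.sum_univ_add]
  sum_X_Q γ δ := by
    simp [padX, padQ, Fin.sum_univ_add]

end

end HDiff

/-! ### From a twist to a frame: the gauge matrix -/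

namespace HDiff

noncomputable section

open Matrix

theorem commute_inverse_matrix {ι S : Type*} [Fintype ι] [DecidableEq ι] [Ring S]
    {A B : Matrix ι ι S} (hAB : A * B = 1) (hBA : B * A = 1) {y : S}
    (h : ∀ i j, Commute y (A i j)) (i j : ι) : Commute y (B i j) := by
  have h1 : Commute (diagonal fun _ => y) A := by
    ext i j
    rw [diagonal_mul, mul_diagonal, (h i j).eq]
  have h2 : Commute (diagonal fun _ => y) B := by
    calc (diagonal fun _ => y) * B = B * (A * (diagonal fun _ => y)) * B := by
          rw [← mul_assoc, hBA, one_mul]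
      _ = B * diagonal fun _ => y := by
          rw [← h1.eq, mul_assoc, mul_assoc, hAB, mul_one]
  have := congrFun (congrFun h2.eq i) j
  rwa [diagonal_mul, mul_diagonal] at this

variable {k : Type*} [CommRing k] {n : ℕ} {S : Type*} [Ring S] [Algebra k S]

/-- An invertible matrix `T` intertwining the left action `c`, `L` of the diagonal reduction
algebra with a second action `r` of the coefficients. -/
structure IsTwist (c r : Ubar k n →ₐ[k] S) (L : Fin n → Fin n → S)
    (T : Matrix (Fin n) (Fin n) S) : Prop where
  red : IsRedSys c L
  r_c : ∀ p q, Commute (r p) (c q)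
  r_L : ∀ p i j, Commute (r p) (L i j)
  isUnit : IsUnit T
  c_T : ∀ p i a, c p * T i a = T i a * c (trans k (ew i) p)
  r_T : ∀ p i a, r p * T i a = T i a * r (trans k (ew a) p)
  T_L : ∀ i a l j, T i a * L l j = ∑ x, mY c L (i, j) (x, l) * T x a
  T_T : ∀ i j a b, ∑ u, ∑ v, c (Rhat k n i j u v) * (T u a * T v b)
    = ∑ u, ∑ v, r (Rhat k n u v a b) * (T i u * T j v)

namespace IsTwist

variable {c r : Ubar k n →ₐ[k] S} {L : Fin n → Fin n → S} {T : Matrix (Fin n) (Fin n) S}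
  {X Xi θ : ℕ × ℕ → S}

/-- The matrix of gauge factors. -/
def gauge (r : Ubar k n →ₐ[k] S) (C : Matrix (Fin n) (Fin n) S) (a α : Fin n) : S :=
  r (vphi k a) * row C (r (hh k n a)) α

theorem isUnit_gauge {C Ci : Matrix (Fin n) (Fin n) S} (h1 : C * Ci = 1) (h2 : Ci * C = 1) :
    IsUnit (Matrix.of (gauge r C)) := by
  -- The powers of h̃_a in row a form a Vandermonde matrix, invertible because the differences
  -- h̃_{ij} are.
  have e : Matrix.of (gauge r C) = r.mapMatrix (diagonal (vphi k)) *
      r.mapMatrix (vandermonde (hh k n)) * C := by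
    ext a α
    simp only [AlgHom.mapMatrix_apply, mul_assoc, Matrix.diagonal_map (map_zero r), diagonal_mul,
      gauge, of_apply, row]
    rw [Matrix.mul_apply]
    simp [vandermonde_apply]
  rw [e]
  refine ((IsUnit.map r.mapMatrix ?_).mul (IsUnit.map r.mapMatrix ?_)).mul ⟨⟨C, Ci, h1, h2⟩, rfl⟩
  · refine IsUnit.of_mul_eq_one (diagonal (vph k)) ?_
    rw [diagonal_mul_diagonal, ← diagonal_one]
    simp only [vphi_mul_vph]
  · rw [Matrix.isUnit_iff_isUnit_det]
    simpa using isUnit_det_vandermonde k n 0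

variable (h : IsTwist c r L T)
include h

theorem row_T {C : Matrix (Fin n) (Fin n) S} (hC : ∀ s α i a, Commute (C s α) (T i a))
    (p : Ubar k n) (α i a : Fin n) :
    row C (r p) α * T i a = T i a * row C (r (trans k (ew a) p)) α := by
  simp only [row, Finset.sum_mul, Finset.mul_sum]
  refine Finset.sum_congr rfl fun s _ => ?_
  rw [mul_assoc, (hC s α i a).eq, ← map_pow, ← mul_assoc, h.r_T, map_pow, map_pow, mul_assoc]

/-- The quadratic gauge factors. -/
def gauge₂ (r : Ubar k n →ₐ[k] S) (C : Matrix (Fin n) (Fin n) S) (α β a b : Fin n) : S :=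
  r (trans k (ew b) (vphi k a) * vphi k b) *
    (row C (r (trans k (ew b) (hh k n a))) α * row C (r (hh k n b)) β)

-- For u = v the two arguments of the row differ by exactly 1, and the exchange relation becomes
-- symmetry in α and β. For u ≠ v it is divided by h̃_{uv}, and the factors φ⁻¹ convert 1 -
-- 1/h̃_{uv} into the entry of R̂.
omit h in
theorem gauge₂_exchange {C : Matrix (Fin n) (Fin n) S}
    (hrow : ∀ p q α β, (r p - r q) * (row C (r p) α * row C (r q) β)
      = row C (r p) β * row C (r q) α + (r p - r q - 1) * (row C (r q) β * row C (r p) α))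
    (α β u v : Fin n) :
    gauge₂ r C α β u v = r (rf k u v) * gauge₂ r C β α u v + r (rg k u v) * gauge₂ r C β α v u := by
  by_cases huv : u = v
  · subst huv
    rw [rf_self, rg_self, map_zero, map_one, zero_mul, zero_add, one_mul]
    have e : trans k (ew u) (hh k n u) = hh k n u + 1 := by simp
    have := hrow (hh k n u + 1) (hh k n u) α β
    rw [map_add, map_one, add_sub_cancel_left, one_mul, sub_self, zero_mul, add_zero] at this
    rw [gauge₂, gauge₂, e, map_add, map_one, this]
  · have e1 : trans k (ew v) (hh k n u) = hh k n u := by simp [huv]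
    have e2 : trans k (ew u) (hh k n v) = hh k n v := by simp [Ne.symm huv]
    have h0 := mul_hinv k huv 0
    have h1 : row C (r (hh k n u)) α * row C (r (hh k n v)) β
        = r (rf k u v) * (row C (r (hh k n u)) β * row C (r (hh k n v)) α)
          + r (1 - rf k u v) * (row C (r (hh k n v)) β * row C (r (hh k n u)) α) := by
      have := congrArg (r (rf k u v) * ·) (hrow (hh k n u) (hh k n v) α β)
      simp only [mul_add, ← mul_assoc, ← map_sub, ← map_mul, ← map_one r] at this
      have e3 : rf k u v * (hh k n u - hh k n v) = 1 := by
        rw [rf_eq k huv]; simpa [hd, mul_comm] using h0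
      rw [e3, map_one, one_mul] at this
      rw [this]
      have e4 : rf k u v * (hh k n u - hh k n v - 1) = 1 - rf k u v := by
        linear_combination e3
      rw [e4]
      simp only [mul_assoc]
    have h2 : rg k u v * (trans k (ew u) (vphi k v) * vphi k u)
        = (trans k (ew v) (vphi k u) * vphi k v) * (1 - rf k u v) := by
      have g1 := rg_mul_vph k u v
      have g2 := vphi_mul_vph k u
      have g3 := vphi_mul_vph k v
      have g4 : trans k (ew v) (vphi k u) * trans k (ew v) (vph k u) = 1 := by
        rw [← map_mul, vphi_mul_vph, map_one]
      have g5 : trans k (ew u) (vphi k v) * trans k (ew u) (vph k v) = 1 := by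
        rw [← map_mul, vphi_mul_vph, map_one]
      calc _ = (trans k (ew v) (vphi k u) * trans k (ew v) (vph k u)) * (vphi k v * vph k v)
            * (rg k u v * (trans k (ew u) (vphi k v) * vphi k u)) := by rw [g4, g3]; ring
        _ = (trans k (ew v) (vphi k u) * vphi k v * (trans k (ew u) (vphi k v) * vphi k u)) *
            (rg k u v * (trans k (ew v) (vph k u) * vph k v)) := by ring
        _ = (trans k (ew v) (vphi k u) * vphi k v * (1 - rf k u v)) *
            ((trans k (ew u) (vphi k v) * trans k (ew u) (vph k v)) * (vphi k u * vph k u)) := by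
          rw [g1]; ring
        _ = _ := by rw [g5, g2]; ring
    have h3 : r (rf k u v) * r (trans k (ew v) (vphi k u) * vphi k v)
        = r (trans k (ew v) (vphi k u) * vphi k v) * r (rf k u v) := ((Commute.all _ _).map r).eq
    rw [gauge₂, gauge₂, gauge₂, e1, e2, h1, mul_add, ← mul_assoc (r (rf k u v)) (r _), h3,
      ← mul_assoc (r (rg k u v)), ← map_mul r (rg k u v), h2, map_mul r _ (1 - _), mul_assoc,
      mul_assoc]

/-- Z is T times the gauge matrix. The relation of T moves R̂ from the left coefficients to the
right ones, where `gauge₂_exchange` absorbs it; the relation with L is untouched, because L commutes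
with the gauge factors. -/
theorem exists_frame (hW : IsWeyl X Xi θ)
    (hc : ∀ p w, Commute (c p) (X w) ∧ Commute (c p) (Xi w) ∧ Commute (c p) (θ w))
    (hr : ∀ p w, Commute (r p) (X w) ∧ Commute (r p) (Xi w) ∧ Commute (r p) (θ w))
    (hL : ∀ i j w, Commute (L i j) (X w) ∧ Commute (L i j) (Xi w) ∧ Commute (L i j) (θ w))
    (hT : ∀ i j w, Commute (T i j) (X w) ∧ Commute (T i j) (Xi w) ∧ Commute (T i j) (θ w)) :
    ∃ Z W : Fin n → Fin n → S, IsFrame c L Z W ∧ ∀ y,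
      (∀ w, Commute y (X w) ∧ Commute y (Xi w) ∧ Commute y (θ w)) → (∀ p, Commute y (c p)) →
      (∀ p, Commute y (r p)) → (∀ i j, Commute y (L i j)) → (∀ i j, Commute y (T i j)) →
      IsScalarFor c L Z W y := by
  obtain ⟨C, Ci, h1, h2, h3, h4⟩ := exists_row hW n
  have hrow : ∀ p q α β, (r p - r q) * (row C (r p) α * row C (r q) β)
      = row C (r p) β * row C (r q) α + (r p - r q - 1) * (row C (r q) β * row C (r p) α) :=
    fun p q => h4 _ _ ((Commute.all p q).map r) (hr p) (hr q)
  have hTC : ∀ s α i a, Commute (C s α) (T i a) := fun s α i a => (h3 _ (hT i a) s α).symm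
  have hrC : ∀ p s α, Commute (r p) (C s α) := fun p => h3 _ (hr p)
  have gauge_comm : ∀ y, (∀ p, Commute y (r p)) → (∀ s α, Commute y (C s α)) →
      ∀ a α, Commute y (gauge r C a α) := fun y hy hyC a α =>
    (hy _).mul_right (commute_row (hy _) hyC α)
  obtain ⟨U, hU⟩ := h.isUnit.mul (isUnit_gauge (r := r) h1 h2)
  have hZ : ∀ i α, (U : Matrix (Fin n) (Fin n) S) i α = ∑ a, T i a * gauge r C a α := fun i α => by
    rw [hU, Matrix.mul_apply]; rfl
  refine ⟨fun i α => (U : Matrix (Fin n) (Fin n) S) i α,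
    fun i α => (U⁻¹ : (Matrix (Fin n) (Fin n) S)ˣ).val α i, ⟨h.red, ?_, ?_, ?_, ?_, ?_⟩, ?_⟩
  · intro p j α
    simp only [hZ, Finset.mul_sum, Finset.sum_mul]
    refine Finset.sum_congr rfl fun a _ => ?_
    rw [← mul_assoc, h.c_T, mul_assoc, mul_assoc, (gauge_comm (c _) (fun q => (h.r_c q _).symm)
      (h3 _ (hc _)) a α).eq]
  · intro i j α β
    have e : ∀ i j α β, (∑ a, T i a * gauge r C a α) * (∑ b, T j b * gauge r C b β)
        = ∑ a, ∑ b, T i a * T j b * gauge₂ r C α β a b := by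
      intro i j α β
      rw [Finset.sum_mul_sum]
      refine Finset.sum_congr rfl fun a _ => Finset.sum_congr rfl fun b _ => ?_
      have e1 : gauge r C a α * T j b = T j b * (r (trans k (ew b) (vphi k a)) *
          row C (r (trans k (ew b) (hh k n a))) α) := by
        rw [gauge, mul_assoc, h.row_T hTC, ← mul_assoc, h.r_T, mul_assoc]
      have e2 : Commute (r (vphi k b)) (row C (r (trans k (ew b) (hh k n a))) α) :=
        commute_row ((Commute.all _ _).map r) (hrC _) α
      rw [mul_assoc (T i a), ← mul_assoc (gauge r C a α), e1, gauge, gauge₂, map_mul]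
      simp only [mul_assoc]
      rw [← mul_assoc (r (vphi k b)), e2.eq, mul_assoc]
    simp only [hZ, e, Finset.mul_sum]
    have e3 : ∀ u v a b, r (Rhat k n u v a b) * (T i u * T j v)
        = T i u * T j v * r (Rhat k n u v a b) := by
      intro u v a b
      have := trans_Rhat_weight k (ew u + ew v) u v a b
      rw [add_sub_cancel_left, sub_self, trans_zero] at this
      rw [← mul_assoc, h.r_T, mul_assoc, h.r_T, trans_trans, ← mul_assoc, add_comm, ← this]
    have e4 : ∀ a b, ∑ u, ∑ v, c (Rhat k n i j u v) * (T u a * T v b * gauge₂ r C β α a b)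
        = ∑ u, ∑ v, T i u * T j v * (r (Rhat k n u v a b) * gauge₂ r C β α a b) := by
      intro a b
      have e5 : ∀ u v, c (Rhat k n i j u v) * (T u a * T v b * gauge₂ r C β α a b)
          = c (Rhat k n i j u v) * (T u a * T v b) * gauge₂ r C β α a b :=
        fun u v => (mul_assoc _ _ _).symm
      simp only [e5, ← Finset.sum_mul, h.T_T]
      simp only [e3, Finset.sum_mul, mul_assoc]
    have e6 (F : Fin n → Fin n → Fin n → Fin n → S) :
        ∑ u, ∑ v, ∑ a, ∑ b, F u v a b = ∑ a, ∑ b, ∑ u, ∑ v, F u v a b := by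
      rw [sum_rotate, Finset.sum_congr rfl fun a _ =>
        sum_rotate (A := Fin n) (B := Fin n) fun u v b => F u v a b]
    rw [e6]
    simp only [e4]
    rw [e6]
    refine Finset.sum_congr rfl fun u _ => Finset.sum_congr rfl fun v _ => ?_
    have e7 := sum_Rhat_left k u v r.toRingHom (gauge₂ r C β α)
    refine (congrArg (T i u * T j v * ·) ((gauge₂_exchange hrow α β u v).trans e7.symm)).trans ?_
    simp only [Finset.mul_sum]
    rfl
  · intro i j l α
    simp only [hZ, Finset.sum_mul, Finset.mul_sum]
    rw [Finset.sum_comm]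
    refine Finset.sum_congr rfl fun a _ => ?_
    rw [mul_assoc, ← (gauge_comm (L l j) (fun p => (h.r_L p l j).symm) (h3 _ (hL l j)) a α).eq,
      ← mul_assoc, h.T_L, Finset.sum_mul]
    simp only [mul_assoc]
  · intro i j
    have := congrFun (congrFun U.mul_inv i) j
    rwa [Matrix.mul_apply, Matrix.one_apply] at this
  · intro i j
    have := congrFun (congrFun U.inv_mul i) j
    rwa [Matrix.mul_apply, Matrix.one_apply] at this
  · intro y hy hyc hyr hyL hyT
    have hyZ : ∀ i α, Commute y ((U : Matrix (Fin n) (Fin n) S) i α) := fun i α => by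
      rw [hZ]
      exact Commute.sum_right _ _ _ fun a _ => (hyT i a).mul_right (gauge_comm y hyr (h3 y hy) a α)
    exact ⟨hyc, hyL, hyZ, fun i α => commute_inverse_matrix U.mul_inv U.inv_mul hyZ α i⟩

end IsTwist

end

end HDiff

/-! ### The representation on lattice functions, and injectivity of τ -/

namespace HDiff

noncomputable section

open Matrix

section Operators

variable {k : Type*} [CommRing k] {A ι : Type*} [AddCommGroup A] [Module k A]

/-- A linear map applied to the values of functions. -/
def pointwise (I : Type*) : Module.End k A →ₐ[k] Module.End k (I → A) where
  toFun f := f.compLeft I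
  map_one' := rfl
  map_mul' _ _ := rfl
  map_zero' := rfl
  map_add' _ _ := rfl
  commutes' _ := rfl

variable (k A) [DecidableEq ι]

/-- The translation of functions on a lattice by `m` times the basis vector at `v`. -/
def translate (m : ℤ) (v : ι) : Module.End k ((ι → ℤ) → A) :=
  LinearMap.funLeft k A fun w => w - Pi.single v m

/-- Multiplication by the coordinate at `v` on functions on a lattice. -/
def euler (v : ι) : Module.End k ((ι → ℤ) → A) where
  toFun x w := w v • x w
  map_add' _ _ := funext fun _ => smul_add _ _ _
  map_smul' _ _ := funext fun _ => smul_comm _ _ _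

/-- A function on the lattice plays the role of a formal Laurent series with coefficients in A: a
translation multiplies by a variable, and the lattice coordinate reads off its exponent. -/
theorem isWeyl_lattice : IsWeyl (translate k A (ι := ι) 1) (translate k A (-1)) (euler k A) where
  X_mul_Xi v := by
    ext x w
    exact congrArg x (by simp [Pi.single_neg])
  Xi_mul_X v := by
    ext x w
    exact congrArg x (by simp [Pi.single_neg])
  X_comm v w := by
    ext x u
    exact congrArg x (sub_right_comm u _ _)
  θ_comm v w := by
    ext x u
    exact smul_comm (u v) (u w) (x u)
  θ_X v w := by
    ext x u
    have : (translate k A 1 w * euler k A v) x u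
        = (u v - (Pi.single w 1 : ι → ℤ) v) • x (u - Pi.single w 1) := rfl
    rw [LinearMap.add_apply, Pi.add_apply, this, Pi.single_apply]
    change u v • x (u - Pi.single w 1) = _
    split_ifs with e
    · change _ = (u v - 1) • x (u - Pi.single w 1) + x (u - Pi.single w 1)
      rw [sub_smul, one_smul, sub_add_cancel]
    · simp

variable {k A}

theorem commute_pointwise_translate (f : Module.End k A) (m : ℤ) (v : ι) :
    Commute (pointwise (ι → ℤ) f) (translate k A m v) := rfl

omit [DecidableEq ι] in
theorem commute_pointwise_euler (f : Module.End k A) (v : ι) :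
    Commute (pointwise (ι → ℤ) f) (euler k A v) := by
  ext x w
  exact map_zsmul f _ _

end Operators

section Weyl

variable {S ι κ : Type*} [Ring S] [DecidableEq ι] [DecidableEq κ] {X Xi θ : ι → S}

theorem IsWeyl.comp (h : IsWeyl X Xi θ) {f : κ → ι} (hf : Function.Injective f) :
    IsWeyl (X ∘ f) (Xi ∘ f) (θ ∘ f) where
  X_mul_Xi v := h.X_mul_Xi _
  Xi_mul_X v := h.Xi_mul_X _
  X_comm v w := h.X_comm _ _
  θ_comm v w := h.θ_comm _ _
  θ_X v w := by simp only [Function.comp_apply, h.θ_X, hf.eq_iff]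

theorem IsWeyl.isHeisenberg {n r : ℕ} {X Xi θ : Fin n × Fin r → S} (h : IsWeyl X Xi θ) :
    IsHeisenberg (fun γ j => X (γ, j)) (fun j γ => Xi (γ, j) * θ (γ, j)) where
  Y_Y _ _ _ _ := h.X_comm _ _
  P_P _ _ _ _ := h.P_comm _ _
  P_Y β δ γ α := by
    rw [h.P_X]
    simp only [Prod.mk.injEq, eq_comm (a := γ), eq_comm (a := α)]

/-- The operators at distinct points commute. -/
theorem IsWeyl.commute_of_ne (h : IsWeyl X Xi θ) {v w : ι} (hvw : v ≠ w) :
    (Commute (X v) (X w) ∧ Commute (X v) (Xi w) ∧ Commute (X v) (θ w)) ∧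
    (Commute (Xi v) (X w) ∧ Commute (Xi v) (Xi w) ∧ Commute (Xi v) (θ w)) ∧
    (Commute (θ v) (X w) ∧ Commute (θ v) (Xi w) ∧ Commute (θ v) (θ w)) :=
  ⟨⟨h.X_comm _ _, (h.Xi_X _ _).symm, h.X_θ_of_ne hvw⟩,
    ⟨h.Xi_X _ _, h.Xi_comm _ _, h.Xi_θ_of_ne hvw⟩,
    ⟨(h.X_θ_of_ne (Ne.symm hvw)).symm, (h.Xi_θ_of_ne (Ne.symm hvw)).symm, h.θ_comm _ _⟩⟩

end Weyl

section Twist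

variable {k : Type*} [CommRing k] {n : ℕ}

theorem mY_map {S S' : Type*} [Ring S] [Algebra k S] [Ring S'] [Algebra k S'] (φ : S →ₐ[k] S')
    (c : Ubar k n →ₐ[k] S) (L : Fin n → Fin n → S) (a b : Fin n × Fin n) :
    mY (φ.comp c) (fun i j => φ (L i j)) a b = φ (mY c L a b) := by
  obtain ⟨i, j⟩ := a
  obtain ⟨x, l⟩ := b
  simp only [mY_apply, map_sub, map_sum, map_mul, AlgHom.comp_apply]

theorem IsTwist.map {S S' : Type*} [Ring S] [Algebra k S] [Ring S'] [Algebra k S']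
    {c r : Ubar k n →ₐ[k] S} {L : Fin n → Fin n → S} {T : Matrix (Fin n) (Fin n) S}
    (h : IsTwist c r L T) (φ : S →ₐ[k] S') :
    IsTwist (φ.comp c) (φ.comp r) (fun i j => φ (L i j)) (φ.mapMatrix T) where
  red := h.red.map φ
  r_c p q := (h.r_c p q).map φ
  r_L p i j := (h.r_L p i j).map φ
  isUnit := h.isUnit.map φ.mapMatrix
  c_T p i a := by
    have := congrArg φ (h.c_T p i a)
    rwa [map_mul, map_mul] at this
  r_T p i a := by
    have := congrArg φ (h.r_T p i a)
    rwa [map_mul, map_mul] at this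
  T_L i a l j := by
    have := congrArg φ (h.T_L i a l j)
    simp only [map_mul, map_sum, ← mY_map] at this
    exact this
  T_T i j a b := by
    have := congrArg φ (h.T_T i j a b)
    simp only [map_mul, map_sum] at this
    exact this

variable (k n) in
/-- Right multiplication by coefficients. -/
def rightC : Ubar k n →ₐ[k] Module.End k (Red k n) where
  toFun p := LinearMap.mulRight k (rC k n p)
  map_one' := by
    rw [map_one]
    exact LinearMap.ext mul_one
  map_zero' := by
    rw [map_zero]
    exact LinearMap.ext mul_zero
  map_add' p q := by
    rw [map_add]
    exact LinearMap.ext fun x => mul_add x _ _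
  map_mul' p q := by
    ext x
    -- Right multiplication reverses products, which is harmless because Ū(h) is commutative.
    rw [mul_comm, map_mul]
    exact (mul_assoc _ _ _).symm
  commutes' a := by
    ext x
    rw [AlgHom.commutes]
    exact (Algebra.commutes a x).symm.trans (Algebra.smul_def a x).symm

variable (k n) in
/-- The entries of `rho` as linear operators. -/
def twist : Matrix (Fin n) (Fin n) (Module.End k (Red k n)) :=
  fun i a => (Matrix.entryLinearMap k (Red k n) i a).comp (rho k n).toLinearMap

variable (k n) in
/-- The entries of `rhoDual` as linear operators. -/
def twistDual : Matrix (Fin n) (Fin n) (Module.End k (Red k n)) :=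
  fun a i => (Matrix.entryLinearMap k (Red k n) i a).comp (rhoDual k n).toLinearMap

theorem rho_rC_mul (p : Ubar k n) (x : Red k n) (i a : Fin n) :
    rho k n (rC k n p * x) i a = rC k n (trans k (-ew i) p) * rho k n x i a := by
  rw [map_mul, Matrix.mul_apply]
  simp only [rho_rC, ite_mul, zero_mul, Finset.sum_ite_eq, Finset.mem_univ, if_true]

theorem rho_mul_rC (p : Ubar k n) (x : Red k n) (i a : Fin n) :
    rho k n (x * rC k n p) i a = rho k n x i a * rC k n (trans k (-ew a) p) := by
  rw [map_mul, Matrix.mul_apply]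
  simp only [rho_rC, mul_ite, mul_zero, Finset.sum_ite_eq', Finset.mem_univ, if_true]

-- The left coefficients and L act by left multiplication, the second coefficients by right
-- multiplication, so they commute. Multiplicativity of ρ gives the relations of T with all of them,
-- `rhoDual` gives its inverse, and `rho_rho` its quadratic relation.
variable (k n) in
theorem isTwist_twist : IsTwist ((Algebra.lmul k (Red k n)).comp (rC k n)) (rightC k n)
    (fun i j => Algebra.lmul k (Red k n) (rL k n i j)) (twist k n) where
  red := (isRedSys_red k n).map _
  r_c p q := by
    ext x
    exact mul_assoc _ _ _
  r_L p i j := by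
    ext x
    exact mul_assoc _ _ _
  isUnit := by
    refine ⟨⟨twist k n, twistDual k n, ?_, ?_⟩, rfl⟩
    · ext i j x
      rw [Matrix.mul_apply, LinearMap.sum_apply]
      refine (rho_rhoDual x j i).trans ?_
      rw [Matrix.one_apply]
      split_ifs <;> rfl
    · ext l a x
      rw [Matrix.mul_apply, LinearMap.sum_apply]
      refine (rhoDual_rho x a l).trans ?_
      rw [Matrix.one_apply]
      simp only [eq_comm (a := a)]
      split_ifs <;> rfl
  c_T p i a := by
    ext x
    change rC k n p * rho k n x i a = rho k n (rC k n _ * x) i a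
    rw [rho_rC_mul, trans_trans, neg_add_cancel, trans_zero]
  r_T p i a := by
    ext x
    change rho k n x i a * rC k n p = rho k n (x * rC k n _) i a
    rw [rho_mul_rC, trans_trans, neg_add_cancel, trans_zero]
  T_L i a l j := by
    ext x
    simp only [mY_map, LinearMap.sum_apply]
    change rho k n (rL k n l j * x) i a = _
    rw [map_mul, Matrix.mul_apply]
    simp only [rho_rL]
    rfl
  T_T i j a b := by
    ext x
    simp only [LinearMap.sum_apply]
    exact rho_rho x i j a b

-- Composing τ with the constructed representation gives left multiplication on the values of
-- lattice functions, and left multiplication of D(gl_n) on itself is faithful.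
variable (k n) in
theorem tau_injective_add (r : ℕ) : Function.Injective (tau k n (n + r)) := by
  -- The first family of variables serves the gauge matrix, the second one the r additional columns;
  -- operators of different families commute.
  let ι := (ℕ × ℕ) ⊕ (Fin n × Fin r)
  let φ := pointwise (k := k) (A := Red k n) (ι → ℤ)
  have hW := isWeyl_lattice k (Red k n) (ι := ι)
  have hφ : ∀ (f : Module.End k (Red k n)) (v : ι), Commute (φ f) (translate k _ 1 v) ∧
      Commute (φ f) (translate k _ (-1) v) ∧ Commute (φ f) (euler k _ v) := fun f v =>
    ⟨commute_pointwise_translate f _ v, commute_pointwise_translate f _ v,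
      commute_pointwise_euler f v⟩
  obtain ⟨Z, W, hF, hs⟩ := ((isTwist_twist k n).map φ).exists_frame
    (hW.comp (f := Sum.inl) Sum.inl_injective) (fun p w => hφ _ _) (fun p w => hφ _ _)
    (fun i j w => hφ _ _) (fun i j w => hφ _ _)
  have hH := (hW.comp (f := Sum.inr) Sum.inr_injective).isHeisenberg
  have hc := fun (v : Fin n × Fin r) (w : ℕ × ℕ) =>
    hW.commute_of_ne (v := Sum.inr v) (w := Sum.inl w) Sum.inr_ne_inl
  have hE := hH.isExtension
    (fun i j => hs _ (fun w => (hc (i, j) w).1) (fun p => (hφ _ _).1.symm) (fun p => (hφ _ _).1.symm)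
      (fun _ _ => (hφ _ _).1.symm) (fun _ _ => (hφ _ _).1.symm))
    (fun j i => hs _
      (fun w => ⟨(hc (i, j) w).2.1.1.mul_left (hc (i, j) w).2.2.1,
        (hc (i, j) w).2.1.2.1.mul_left (hc (i, j) w).2.2.2.1,
        (hc (i, j) w).2.1.2.2.mul_left (hc (i, j) w).2.2.2.2⟩)
      (fun p => ((hφ _ _).2.1.mul_right (hφ _ _).2.2).symm)
      (fun p => ((hφ _ _).2.1.mul_right (hφ _ _).2.2).symm)
      (fun _ _ => ((hφ _ _).2.1.mul_right (hφ _ _).2.2).symm)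
      (fun _ _ => ((hφ _ _).2.1.mul_right (hφ _ _).2.2).symm))
  have e : (diffLift (S := Module.End k ((ι → ℤ) → Red k n)) _ _ _ (hE.isDiffSys hF)).comp
      (tau k n (n + r))
      = φ.comp (Algebra.lmul k (Red k n)) := by
    refine red_algHom_ext (S := Module.End k ((ι → ℤ) → Red k n)) (fun p => ?_) fun i j => ?_
    · rw [AlgHom.comp_apply, tau_rC, diffLift_dC]
      rfl
    · rw [AlgHom.comp_apply, tau_rL, sumZd, map_sum]
      simp only [map_mul, diffLift_dZ, diffLift_dd]
      exact hE.sumZd_ext hF i j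
  intro x y hxy
  have h1 : φ (Algebra.lmul k (Red k n) x) = φ (Algebra.lmul k (Red k n) y) := by
    rw [← AlgHom.comp_apply, ← e, AlgHom.comp_apply, hxy, ← AlgHom.comp_apply, e,
      AlgHom.comp_apply]
  -- Evaluation on the constant function 1, at the origin of the lattice.
  have h2 : x * 1 = y * 1 := congrFun (LinearMap.congr_fun h1 fun _ => 1) 0
  rwa [mul_one, mul_one] at h2

theorem tau_injective {N : ℕ} (hN : n ≤ N) : Function.Injective (tau k n N) := by
  obtain ⟨r, rfl⟩ := Nat.exists_eq_add_of_le hN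
  exact tau_injective_add k n r

end Twist

end

end HDiff

/-! ### Assembly of the five statements -/

theorem mainTheorem5 (k : Type*) [CommRing k] [CharZero k] (n : ℕ) :
    -- the action of `S_n` on `Diff_h(n,N)` and the homomorphism `τ_N` are well defined
    (∀ N : ℕ, ∃! A : Equiv.Perm (Fin n) →* (HDiff.Diff k n N ≃ₐ[k] HDiff.Diff k n N),
      HDiff.IsDiffAction k n N A) ∧
    (∀ N : ℕ, ∃! τ : HDiff.Red k n →ₐ[k] HDiff.Diff k n N, HDiff.IsTau k n N τ) ∧
    -- the action preserves the image of `τ_N`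
    (∀ (N : ℕ) (A : Equiv.Perm (Fin n) →* (HDiff.Diff k n N ≃ₐ[k] HDiff.Diff k n N))
      (τ : HDiff.Red k n →ₐ[k] HDiff.Diff k n N),
      HDiff.IsDiffAction k n N A → HDiff.IsTau k n N τ →
        ∀ g : Equiv.Perm (Fin n), τ.range.map (A g : HDiff.Diff k n N →ₐ[k] HDiff.Diff k n N)
          = τ.range) ∧
    -- `τ_N` is injective for `N ≥ n`
    (∀ (N : ℕ) (τ : HDiff.Red k n →ₐ[k] HDiff.Diff k n N),
      HDiff.IsTau k n N τ → n ≤ N → Function.Injective τ) ∧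
    -- the formulas induce an action of `S_n` by automorphisms on `D(gl_n)`
    (∃! B : Equiv.Perm (Fin n) →* (HDiff.Red k n ≃ₐ[k] HDiff.Red k n),
      ∀ (N : ℕ) (A : Equiv.Perm (Fin n) →* (HDiff.Diff k n N ≃ₐ[k] HDiff.Diff k n N))
        (τ : HDiff.Red k n →ₐ[k] HDiff.Diff k n N),
        HDiff.IsDiffAction k n N A → HDiff.IsTau k n N τ →
          ∀ (g : Equiv.Perm (Fin n)) (x : HDiff.Red k n), τ (B g x) = A g (τ x)) := by
  have hinj := HDiff.tau_injective (k := k) (le_refl n)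
  refine ⟨fun N => ⟨HDiff.permAction k n N, HDiff.isDiffAction_permAction, fun _ h =>
    h.eq_permAction⟩, fun N => ⟨HDiff.tau k n N, HDiff.isTau_tau, fun _ h => h.eq_tau⟩, ?_, ?_,
    HDiff.redPermAction hinj, ?_, ?_⟩
  · intro N A τ hA hτ g
    rw [hA.eq_permAction, hτ.eq_tau]
    exact HDiff.map_range_tau g
  · intro N τ hτ hN
    rw [hτ.eq_tau]
    exact HDiff.tau_injective hN
  · intro N A τ hA hτ g x
    rw [hA.eq_permAction, hτ.eq_tau]
    exact HDiff.tau_redPermHom hinj g x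
  -- Compatibility for N = n alone already determines the action, since τ_n is injective.
  · intro B hB
    refine MonoidHom.ext fun g => AlgEquiv.ext fun x => hinj ?_
    rw [hB n _ _ HDiff.isDiffAction_permAction HDiff.isTau_tau]
    exact (HDiff.tau_redPermHom hinj g x).symm
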